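/- **Setting.** A function $H:\mathbb{R}^2\to[0,+\infty)$ is called an *anisotropy* if $H(0)=0$, $H(\xi)>0$ for $\xi\neq 0$, and $H(t\xi)=tH(\xi)$ for all $t>0$, $\xi\in\mathbb{R}^2$. Let $B_1^H=\{\xi: H(\xi)<1\}$ be its unit ball; we say that $B_1^H$ is strictly convex if its closure is a strictly convex set. The dual function is $H^*(x)=\sup_{|\xi|=1}\langle x,\xi\rangle/H(\xi)$. Consider the condition $$\operatorname{sgn}\langle H(\xi)\nabla H(\xi),\,H^*(x)\nabla H^*(x)\rangle=\operatorname{sgn}\langle\xi,x\rangle\qquad\text{for all }\xi,x\in\mathbb{R}^2, \tag{1.12}$$ where $H\nabla H$ and $H^*\nabla H^*$ are understood to be $0$ at the origin. The anisotropy $H$ is *uniformly elliptic* if the curvature of $\partial B_1^H$ is bounded away from zero, i.e. there is $\lambda>0$ such that $\frac{D^2H(\xi)[\zeta,\zeta]}{|\nabla H(\xi)|}\ge\lambda|\zeta|^2$ for all $\xi\in\partial B_1^H$ and all $\zeta\perp\nabla H(\xi)$. Call a function $r:[0,\pi/2]\to(0,+\infty)$ of class $C^2$ (up to the endpoints) *admissible*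 if $$r(\theta)r''(\theta)<2r'(\theta)^2+r(\theta)^2\qquad\text{for a.e. }\theta\in[0,\pi/2], \tag{1.17}$$ $$r(0)=1,\qquad r(\pi/2)=r^*,\qquad r'(0)=r'(\pi/2)=0,\qquad\text{for some } r^*\ge 1. \tag{1.18}$$ For such $r$ (and for $\eta\in[0,\pi/2]$) put $\tau(\eta)=\frac{\pi}{2}+\eta-\arctan\frac{r'(\eta)}{r(\eta)}$ and let $\tilde r:\mathbb{R}\to\mathbb{R}$ be the $\pi$-periodic function with $$\tilde r(\theta)=\begin{cases} r(\theta), & 0\le\theta\le\frac{\pi}{2},\\[2pt] \dfrac{r^*\sqrt{r(\eta)^2+r'(\eta)^2}}{r(\eta)^2}\ \text{ with }\eta=\tau^{-1}(\theta), & \frac{\pi}{2}\le\theta\le\pi. \end{cases}$$ Let $$K_r=\{(\rho\cos\theta,\rho\sin\theta):\rho\in[0,\tilde r(\theta)],\ \theta\in[0,2\pi]\},\qquad \tilde H_r(\rho\cos\theta,\rho\sin\theta)=\frac{\rho}{\tilde r(\theta)}\quad(\rho\ge0,\ \theta\in[0,2\pi]). \tag{1.19}$$ **Proposition 1.3.**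 1. Let $r$ be admissible. Then $\tau$ is a bijection from $[0,\pi/2]$ onto $[\pi/2,\pi]$, the functions $\tilde r>0$ and $\tilde H_r$ are well defined, $\tilde r\in C^1(\mathbb{R})$, the set $K_r$ is strictly convex, and $\tilde H_r$ satisfies (1.12). 2. Let $H\in C^2(\mathbb{R}^2\setminus\{0\})$ be an even anisotropy with strictly convex unit ball that satisfies (1.12). Then there are a rotation $R$ of the plane about the origin, a number $c>0$ and an admissible $r$ such that $cR(\overline{B_1^H})=K_r$. 3. Let $\alpha\in(0,1]$ and let $H\in C^{3,\alpha}_{\mathrm{loc}}(\mathbb{R}^2\setminus\{0\})$ be an even anisotropy. Then $H$ is uniformly elliptic and satisfies (1.12) if and only if there are a rotation $R$ about the origin, a number $c>0$ and a positive $r\in C^{3,\alpha}([0,\pi/2])$ such that $cR(\overline{B_1^H})=K_r$, the inequality in (1.17) holds at every $\theta\in[0,\pi/2]$, (1.18) holds, and $$r''\left(\tfrac{\pi}{2}\right)=-\frac{r^*r''(0)}{1-r''(0)},\qquad r'''\left(\tfrac{\pi}{2}\right)=-\frac{r^*r'''(0)}{(1-r''(0))^3}. \tag{M}$$ Moreover,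 for every admissible $r$: $\tilde H_r$ belongs to $C^{3,\alpha}_{\mathrm{loc}}(\mathbb{R}^2\setminus\{0\})$, is uniformly elliptic and satisfies (1.12) if and only if $r\in C^{3,\alpha}([0,\pi/2])$, the inequality in (1.17) holds at every $\theta\in[0,\pi/2]$, and (M) holds. -/

import Mathlib

open Set MeasureTheory
open scoped NNReal RealInnerProductSpace

noncomputable section

/-- The Euclidean plane. -/
abbrev Plane : Type := EuclideanSpace ℝ (Fin 2)

/-- The point with polar coordinates `(ρ, θ)`. -/
def polar (ρ θ : ℝ) : Plane := !₂[ρ * Real.cos θ, ρ * Real.sin θ]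

/-- Counterclockwise rotation of the plane by the angle `φ`. -/
def rot (φ : ℝ) (x : Plane) : Plane :=
  !₂[Real.cos φ * x 0 - Real.sin φ * x 1, Real.sin φ * x 0 + Real.cos φ * x 1]

/-! ### Anisotropies -/

/-- A positive function, positively homogeneous of degree one, on the punctured plane, extended by
`0` at the origin. -/
structure IsAnisotropy (H : Plane → ℝ) : Prop where
  map_zero : H 0 = 0
  homogeneous : ∀ t : ℝ, 0 < t → ∀ ξ : Plane, H (t • ξ) = t * H ξ
  pos : ∀ ξ : Plane, ξ ≠ 0 → 0 < H ξ

/-- The open unit ball `{H < 1}`. -/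
def unitBall (H : Plane → ℝ) : Set Plane := {ξ | H ξ < 1}

/-- The dual function `H*(x) = sup_{|ξ| = 1} ⟨x, ξ⟩ / H(ξ)`. -/
def dual (H : Plane → ℝ) (x : Plane) : ℝ :=
  ⨆ ξ : Metric.sphere (0 : Plane) 1, ⟪x, (ξ : Plane)⟫ / H ξ

/-- `sgn ⟨H(ξ) ∇H(ξ), H*(x) ∇H*(x)⟩ = sgn ⟨ξ, x⟩` for all `ξ, x`. When `ξ = 0` or `x = 0`, the
corresponding factor is `0`, since `H` and `H*` vanish there. -/
def SignCondition (H : Plane → ℝ) : Prop :=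
  ∀ ξ x : Plane,
    SignType.sign ⟪H ξ • gradient H ξ, dual H x • gradient (dual H) x⟫ = SignType.sign ⟪ξ, x⟫

/-- Strict convexity of the unit ball. It is expressed on the closed ball, because Mathlib's
`StrictConvex` only sees a set up to its interior and says nothing more than convexity for an
open set. -/
def HasStrictlyConvexBall (H : Plane → ℝ) : Prop := StrictConvex ℝ (closure (unitBall H))

/-- The second fundamental form `H_{ij}(ξ) ζ_i v_j / |∇H(ξ)|` of `∂{H < 1}` at `ξ`. -/
def secondFundamentalForm (H : Plane → ℝ) (ξ ζ v : Plane) : ℝ :=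
  fderiv ℝ (fderiv ℝ H) ξ ζ v / ‖gradient H ξ‖

/-- The curvature of the boundary of the unit ball is bounded away from zero. -/
def UniformlyElliptic (H : Plane → ℝ) : Prop :=
  ∃ l : ℝ, 0 < l ∧ ∀ ξ ∈ frontier (unitBall H), ∀ ζ : Plane, ⟪gradient H ξ, ζ⟫ = 0 →
    l * ‖ζ‖ ^ 2 ≤ secondFundamentalForm H ξ ζ ζ

/-- `H ∈ C^{3,α}_loc(ℝ² \ {0})`. -/
def IsC3HolderLoc (α : ℝ≥0) (H : Plane → ℝ) : Prop :=
  ContDiffOn ℝ 3 H {0}ᶜ ∧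
    ∀ K : Set Plane, IsCompact K → K ⊆ {0}ᶜ →
      ∃ C : ℝ≥0, HolderOnWith C α (iteratedFDeriv ℝ 3 H) K

/-! ### Radius functions on the first quadrant -/

/-- The interval `[0, π/2]`. -/
def quarter : Set ℝ := Icc 0 (Real.pi / 2)

/-- The `k`-th derivative on `[0, π/2]`, one-sided at the endpoints. -/
def qDeriv (k : ℕ) (r : ℝ → ℝ) (θ : ℝ) : ℝ := iteratedDerivWithin k r quarter θ

/-- `r(0) = 1`, `r(π/2) ≥ 1`, `r'(0) = r'(π/2) = 0`. -/
structure BoundaryConditions (r : ℝ → ℝ) : Prop where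
  at_zero : r 0 = 1
  one_le : 1 ≤ r (Real.pi / 2)
  deriv_zero : qDeriv 1 r 0 = 0
  deriv_half_pi : qDeriv 1 r (Real.pi / 2) = 0

/-- The pointwise inequality `r r'' < 2 r'² + r²` at `θ`. -/
def CurvatureIneq (r : ℝ → ℝ) (θ : ℝ) : Prop :=
  r θ * qDeriv 2 r θ < 2 * qDeriv 1 r θ ^ 2 + r θ ^ 2

/-- Positive `C²` functions on `[0, π/2]` satisfying the differential inequality almost everywhere
and the boundary conditions. -/
structure IsAdmissible (r : ℝ → ℝ) : Prop where
  pos : ∀ θ ∈ quarter, 0 < r θ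
  contDiffOn : ContDiffOn ℝ 2 r quarter
  ineq : ∀ᵐ θ ∂(volume.restrict quarter), CurvatureIneq r θ
  boundary : BoundaryConditions r

/-- `r ∈ C^{3,α}([0, π/2])`. -/
def IsC3HolderOnQuarter (α : ℝ≥0) (r : ℝ → ℝ) : Prop :=
  ContDiffOn ℝ 3 r quarter ∧ ∃ C : ℝ≥0, HolderOnWith C α (qDeriv 3 r) quarter

/-- The matching conditions on the second and third derivatives at `π/2`. -/
def MatchingConditions (r : ℝ → ℝ) : Prop :=
  qDeriv 2 r (Real.pi / 2) = -(r (Real.pi / 2) * qDeriv 2 r 0 / (1 - qDeriv 2 r 0)) ∧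
  qDeriv 3 r (Real.pi / 2) = -(r (Real.pi / 2) * qDeriv 3 r 0 / (1 - qDeriv 2 r 0) ^ 3)

/-! ### The reflection -/

/-- `τ(η) = π/2 + η - arctan (r'(η) / r(η))`. -/
def tau (r : ℝ → ℝ) (η : ℝ) : ℝ :=
  Real.pi / 2 + η - Real.arctan (qDeriv 1 r η / r η)

/-- `r* √(r(η)² + r'(η)²) / r(η)²`, with `r* = r(π/2)`. -/
def reflectedRadius (r : ℝ → ℝ) (η : ℝ) : ℝ :=
  r (Real.pi / 2) * √(r η ^ 2 + qDeriv 1 r η ^ 2) / r η ^ 2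

open Classical in
/-- The reflection on one period: `r(θ)` on `[0, π/2]` and `reflectedRadius r (τ⁻¹(θ))` on
`(π/2, π]`. -/
def rTildeBase (r : ℝ → ℝ) (θ : ℝ) : ℝ :=
  if θ ≤ Real.pi / 2 then r θ else reflectedRadius r (Function.invFunOn (tau r) quarter θ)

/-- The `π`-periodic reflection of `r`. -/
def rTilde (r : ℝ → ℝ) (θ : ℝ) : ℝ := rTildeBase r (toIcoMod Real.pi_pos 0 θ)

/-- `{(ρ cos θ, ρ sin θ) : ρ ∈ [0, R(θ)], θ ∈ [0, 2π]}`. -/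
def polarSet (R : ℝ → ℝ) : Set Plane :=
  {x | ∃ θ ∈ Icc 0 (2 * Real.pi), ∃ ρ ∈ Icc 0 (R θ), x = polar ρ θ}

/-- The function equal to `ρ / r̃(θ)` at the point with polar coordinates `(ρ, θ)`; the choice of
the angle is immaterial as `r̃` is periodic. -/
def HTilde (r : ℝ → ℝ) (x : Plane) : ℝ := ‖x‖ / rTilde r (Complex.arg ⟨x 0, x 1⟩)

/-- The closed unit ball of `H` is, after a rotation and a homothety, the set with polar radius
`r̃`. -/
def BallIsReflectionOf (H : Plane → ℝ) (r : ℝ → ℝ) : Prop :=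
  ∃ φ c : ℝ, 0 < c ∧
    (fun x : Plane => c • rot φ x) '' closure (unitBall H) = polarSet (rTilde r)

end

/-! Everything is read off from the tangent angle `T θ = π/2 + θ - arctan (L θ)` of the curve `ρ = R
θ`, where `R` is the polar radius of the ball and `L = R'/R`. The gradient of `H` in the direction
`θ` is the normal to the curve, of direction `T θ - π/2`. When `T` is strictly increasing the curve
lies strictly on one side of each of its tangents (`IsProfile.mul_sin_lt`). This makes the ball
strictly convex, and it also computes the dual: at the normal direction of the boundary point `m`,
the supremum is attained at that point, which is then the gradient of `H*` (`IsRadial.dual_polar`,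
`IsRadial.hasGradientAt_dual`).

The sign condition thus says that `sin (T θ - m)` and `sin (T m - θ)` always have the same sign:
conjugacy of directions is symmetric. Taking `m = T θ` forces `T (T θ) = θ + π`, and for increasing
`T` this identity is also sufficient (`IsRadial.signCondition_iff`). Such curves are the Radon
curves.

The identity `T ∘ T = id + π` is equivalent to `L (T θ) = -L θ`, so the arc over `[0, π/2]`
determines the arc over `[π/2, π]`. Since `sin (τ - η) = r / √(r² + r'²)`, the prescribed reflection
reads `r̃ (τ η) * r η * sin (τ η - η) = r*`: the parallelogram on two conjugate radii has constant
area. Its logarithmic derivative at `τ η` is `-L η`, whence `T (τ η) = η + π`. For a merely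
admissible `r`, `τ'` may vanish on a null set and `τ⁻¹` need not be differentiable there; the
reflection is still `C¹` because the derivative of the reflected radius is a continuous multiple of
`τ'` (`hasDerivWithinAt_of_comp`).

Conversely, given `H`, the angle is counted from a minimum of `R`, where `L = 0`, and `R` is scaled
to be `1` there. Convexity or ellipticity makes `T` increasing, and `R ∘ T` and the reflected radius
solve the same linear differential equation with the same initial value (`IsProfile.rTilde_eq`).
Differentiating `T ∘ T = id + π` once shows that `T'` never vanishes, which is the strict
differential inequality and is equivalent to uniform ellipticity. Evaluating the first two
derivatives of the identity at `0` gives the matching conditions. In the other direction these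
conditions are exactly the gluing of `L'` and `L''` at the multiples of `π/2`, and Hölder continuity
on the two arcs gives Hölder continuity on the line. Regularity passes between `H` and `R` through a
smooth local angle. -/

noncomputable section

open Filter Topology Real

/-! ### Profiles: positive `π`-periodic radius functions with a continuous logarithmic derivative -/

/-- `R` is a positive `π`-periodic `C¹` function with logarithmic derivative `L`. -/
structure IsProfile (R L : ℝ → ℝ) : Prop where
  pos : ∀ θ, 0 < R θ
  periodic : Function.Periodic R π
  hasDerivAt : ∀ θ, HasDerivAt R (R θ * L θ) θ
  continuous : Continuous L

/-- The angle of the tangent to the curve with polar equation `ρ = R(θ)`, in terms of the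
logarithmic derivative `L` of `R`. -/
def tangentAngle (L : ℝ → ℝ) (θ : ℝ) : ℝ := π / 2 + θ - arctan (L θ)

theorem lt_tangentAngle (L : ℝ → ℝ) (θ : ℝ) : θ < tangentAngle L θ := by
  have := arctan_lt_pi_div_two (L θ)
  unfold tangentAngle; linarith

theorem tangentAngle_lt (L : ℝ → ℝ) (θ : ℝ) : tangentAngle L θ < θ + π := by
  have := neg_pi_div_two_lt_arctan (L θ)
  unfold tangentAngle; linarith

theorem sin_tangentAngle_sub_pos (L : ℝ → ℝ) (θ : ℝ) : 0 < sin (tangentAngle L θ - θ) :=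
  sin_pos_of_pos_of_lt_pi (by linarith [lt_tangentAngle L θ]) (by linarith [tangentAngle_lt L θ])

theorem cos_tangentAngle_sub (L : ℝ → ℝ) (θ : ℝ) :
    cos (tangentAngle L θ - θ) = L θ * sin (tangentAngle L θ - θ) := by
  have h : tangentAngle L θ - θ = π / 2 - arctan (L θ) := by unfold tangentAngle; ring
  have h2 : L θ * cos (arctan (L θ)) = sin (arctan (L θ)) := by
    have := tan_mul_cos (cos_arctan_pos (L θ)).ne'
    rwa [tan_arctan] at this
  rw [h, cos_pi_div_two_sub, sin_pi_div_two_sub, h2]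

namespace IsProfile

variable {R L : ℝ → ℝ}

theorem contDiff (h : IsProfile R L) : ContDiff ℝ 1 R := by
  have hd : deriv R = fun θ => R θ * L θ := funext fun θ => (h.hasDerivAt θ).deriv
  have hdiff : Differentiable ℝ R := fun θ => (h.hasDerivAt θ).differentiableAt
  refine contDiff_one_iff_deriv.2 ⟨hdiff, ?_⟩
  rw [hd]
  exact hdiff.continuous.mul h.continuous

theorem continuous_radius (h : IsProfile R L) : Continuous R := h.contDiff.continuous

theorem periodic_logDeriv (h : IsProfile R L) : Function.Periodic L π := by
  intro θ
  have h1 : HasDerivAt (fun x => R (x + π)) (R (θ + π) * L (θ + π)) θ :=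
    (h.hasDerivAt (θ + π)).comp_add_const θ π
  have h2 : (fun x => R (x + π)) = R := funext h.periodic
  rw [h2] at h1
  have h3 := h1.unique (h.hasDerivAt θ)
  rw [h.periodic θ] at h3
  exact mul_left_cancel₀ (h.pos θ).ne' h3

theorem tangentAngle_add_pi (h : IsProfile R L) (θ : ℝ) :
    tangentAngle L (θ + π) = tangentAngle L θ + π := by
  unfold tangentAngle; rw [h.periodic_logDeriv θ]; ring

theorem continuous_tangentAngle (h : IsProfile R L) : Continuous (tangentAngle L) := by
  have := h.continuous
  unfold tangentAngle; fun_prop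

theorem surjective_tangentAngle (h : IsProfile R L) : Function.Surjective (tangentAngle L) := by
  intro y
  have h1 : tangentAngle L (y - π) ≤ y := by linarith [tangentAngle_lt L (y - π)]
  have h2 : y ≤ tangentAngle L y := (lt_tangentAngle L y).le
  obtain ⟨x, -, hx⟩ := intermediate_value_Icc (by linarith [pi_pos] : y - π ≤ y)
    h.continuous_tangentAngle.continuousOn ⟨h1, h2⟩
  exact ⟨x, hx⟩

/-- The derivative of the signed height of the curve over the line of direction `ψ`. -/
theorem hasDerivAt_mul_sin (h : IsProfile R L) (ψ φ : ℝ) :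
    HasDerivAt (fun φ => R φ * sin (ψ - φ))
      (R φ / sin (tangentAngle L φ - φ) * sin (ψ - tangentAngle L φ)) φ := by
  refine ((h.hasDerivAt φ).fun_mul (((hasDerivAt_id' φ).const_sub ψ).sin)).congr_deriv ?_
  have hs := sin_tangentAngle_sub_pos L φ
  have hc := cos_tangentAngle_sub L φ
  have : sin (ψ - tangentAngle L φ) =
      sin (ψ - φ) * cos (tangentAngle L φ - φ) - cos (ψ - φ) * sin (tangentAngle L φ - φ) := by
    rw [← sin_sub]; ring_nf
  rw [this, hc]
  field_simp
  ring

/-- The strict support property. -/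
theorem mul_sin_lt (h : IsProfile R L) (hT : StrictMono (tangentAngle L)) {θ φ : ℝ}
    (hne : φ ≠ θ) (h1 : θ - π ≤ φ) (h2 : φ ≤ θ + π) :
    R φ * sin (tangentAngle L θ - φ) < R θ * sin (tangentAngle L θ - θ) := by
  set f : ℝ → ℝ := fun φ => R φ * sin (tangentAngle L θ - φ) with hf
  have hder := h.hasDerivAt_mul_sin (tangentAngle L θ)
  have hcont : Continuous f := continuous_iff_continuousAt.2 fun x => (hder x).continuousAt
  have hq : ∀ x, 0 < R x / sin (tangentAngle L x - x) := fun x =>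
    div_pos (h.pos x) (sin_tangentAngle_sub_pos L x)
  -- The derivative of the height `f` at `x` has the sign of `sin (T θ - T x)`. Since `T` increases
  -- by exactly `π` over a period, the argument stays in `(0, π)` on the left of `θ` and in `(-π,
  -- 0)` on the right, so `f` has a strict maximum at `θ`.
  rcases lt_or_gt_of_ne hne with hlt | hgt
  · have hmono : StrictMonoOn f (Icc (θ - π) θ) := by
      refine strictMonoOn_of_deriv_pos (convex_Icc _ _) hcont.continuousOn ?_
      intro x hx
      rw [interior_Icc] at hx
      rw [(hder x).deriv]
      refine mul_pos (hq x) (sin_pos_of_pos_of_lt_pi (by linarith [hT hx.2]) ?_)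
      have := hT hx.1
      have h3 := h.tangentAngle_add_pi (θ - π)
      rw [sub_add_cancel] at h3
      linarith
    exact hmono ⟨h1, hlt.le⟩ ⟨by linarith [pi_pos], le_rfl⟩ hlt
  · have hanti : StrictAntiOn f (Icc θ (θ + π)) := by
      refine strictAntiOn_of_deriv_neg (convex_Icc _ _) hcont.continuousOn ?_
      intro x hx
      rw [interior_Icc] at hx
      rw [(hder x).deriv]
      refine mul_neg_of_pos_of_neg (hq x) (sin_neg_of_neg_of_neg_pi_lt (by linarith [hT hx.1]) ?_)
      have := hT hx.2
      rw [h.tangentAngle_add_pi θ] at this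
      linarith
    exact hanti ⟨le_rfl, by linarith [pi_pos]⟩ ⟨hgt.le, h2⟩ hgt

theorem mul_sin_le (h : IsProfile R L) (hT : StrictMono (tangentAngle L)) (θ φ : ℝ) :
    R φ * sin (tangentAngle L θ - φ) ≤ R θ * sin (tangentAngle L θ - θ) := by
  obtain ⟨k, hk, -⟩ := existsUnique_add_zsmul_mem_Ico (two_pi_pos) φ (θ - π)
  have hk' : φ + k • (2 * π) ∈ Ico (θ - π) (θ - π + 2 * π) := hk
  have hp : Function.Periodic R (2 * π) := by
    have := h.periodic.nat_mul 2; simpa using this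
  have e1 : R (φ + k • (2 * π)) = R φ := hp.zsmul k φ
  have e2 : sin (tangentAngle L θ - (φ + k • (2 * π))) = sin (tangentAngle L θ - φ) := by
    rw [← sub_sub, zsmul_eq_mul, sin_sub_int_mul_two_pi]
  rw [← e1, ← e2]
  rcases eq_or_ne (φ + k • (2 * π)) θ with he | he
  · rw [he]
  · exact (h.mul_sin_lt hT he hk'.1 (by linarith [hk'.2])).le

end IsProfile
end

noncomputable section

open Filter Topology Real

/-! ### Polar coordinates -/

@[simp] theorem polar_apply_zero (ρ θ : ℝ) : polar ρ θ 0 = ρ * cos θ := rfl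

@[simp] theorem polar_apply_one (ρ θ : ℝ) : polar ρ θ 1 = ρ * sin θ := rfl

theorem plane_ext {x y : Plane} (h0 : x 0 = y 0) (h1 : x 1 = y 1) : x = y := by
  ext i; fin_cases i <;> assumption

theorem inner_plane (x y : Plane) : ⟪x, y⟫ = x 0 * y 0 + x 1 * y 1 := by
  simp [PiLp.inner_apply, Fin.sum_univ_two, mul_comm]

theorem inner_polar (a α b β : ℝ) : ⟪polar a α, polar b β⟫ = a * b * cos (α - β) := by
  rw [inner_plane, cos_sub]; simp; ring

theorem norm_sq_plane (x : Plane) : ‖x‖ ^ 2 = x 0 ^ 2 + x 1 ^ 2 := by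
  rw [← real_inner_self_eq_norm_sq, inner_plane]; ring

theorem norm_polar {ρ : ℝ} (hρ : 0 ≤ ρ) (θ : ℝ) : ‖polar ρ θ‖ = ρ := by
  have : ‖polar ρ θ‖ ^ 2 = ρ ^ 2 := by
    rw [← real_inner_self_eq_norm_sq, inner_polar, sub_self, cos_zero]; ring
  exact (sq_eq_sq₀ (norm_nonneg _) hρ).1 this

theorem smul_polar (t ρ θ : ℝ) : t • polar ρ θ = polar (t * ρ) θ := by
  apply plane_ext <;> simp [mul_assoc]

theorem polar_zero (θ : ℝ) : polar 0 θ = 0 := by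
  apply plane_ext <;> simp

theorem polar_add_pi (ρ θ : ℝ) : polar ρ (θ + π) = -polar ρ θ := by
  apply plane_ext <;> simp

theorem polar_ne_zero {ρ : ℝ} (hρ : 0 < ρ) (θ : ℝ) : polar ρ θ ≠ 0 := by
  rw [← norm_pos_iff, norm_polar hρ.le]; exact hρ

theorem eq_polar_arg (x : Plane) : x = polar ‖x‖ (Complex.arg ⟨x 0, x 1⟩) := by
  have h : ‖(⟨x 0, x 1⟩ : ℂ)‖ = ‖x‖ := by
    have : ‖(⟨x 0, x 1⟩ : ℂ)‖ ^ 2 = ‖x‖ ^ 2 := by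
      rw [norm_sq_plane, Complex.sq_norm, Complex.normSq_mk]; ring
    exact (sq_eq_sq₀ (norm_nonneg _) (norm_nonneg _)).1 this
  apply plane_ext
  · simp [← h, Complex.norm_mul_cos_arg]
  · simp [← h, Complex.norm_mul_sin_arg]

theorem exists_eq_polar (x : Plane) : ∃ θ, x = polar ‖x‖ θ := ⟨_, eq_polar_arg x⟩

theorem exists_eq_polar_mem (x : Plane) (a : ℝ) : ∃ θ ∈ Ico a (a + 2 * π), x = polar ‖x‖ θ := by
  obtain ⟨φ, hφ⟩ := exists_eq_polar x
  obtain ⟨k, hk, -⟩ := existsUnique_add_zsmul_mem_Ico (two_pi_pos) φ a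
  refine ⟨φ + k • (2 * π), hk, ?_⟩
  conv_lhs => rw [hφ]
  rw [zsmul_eq_mul]
  apply plane_ext
  · rw [polar_apply_zero, polar_apply_zero, cos_add_int_mul_two_pi]
  · rw [polar_apply_one, polar_apply_one, sin_add_int_mul_two_pi]

theorem contDiff_polar {n : WithTop ℕ∞} (ρ : ℝ) : ContDiff ℝ n (polar ρ) := by
  refine (contDiff_piLp 2).2 fun i => ?_
  fin_cases i
  · exact contDiff_const.mul contDiff_cos
  · exact contDiff_const.mul contDiff_sin

theorem continuous_polar : Continuous fun p : ℝ × ℝ => polar p.1 p.2 := by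
  refine (PiLp.continuous_toLp 2 _).comp (continuous_pi fun i => ?_)
  fin_cases i <;> simp <;> fun_prop

theorem hasDerivAt_polar (ρ θ : ℝ) : HasDerivAt (polar ρ) (polar ρ (θ + π / 2)) θ := by
  rw [hasDerivAt_iff_hasFDerivAt, ← hasFDerivWithinAt_univ, hasFDerivWithinAt_euclidean]
  intro i
  rw [hasFDerivWithinAt_univ]
  fin_cases i
  · have : HasDerivAt (fun x => ρ * cos x) (ρ * (- sin θ)) θ := (hasDerivAt_cos θ).const_mul ρ
    refine this.hasFDerivAt.congr_fderiv ?_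
    ext; simp [cos_add_pi_div_two, PiLp.proj_apply]
  · have : HasDerivAt (fun x => ρ * sin x) (ρ * cos θ) θ := (hasDerivAt_sin θ).const_mul ρ
    refine this.hasFDerivAt.congr_fderiv ?_
    ext; simp [sin_add_pi_div_two, PiLp.proj_apply]

/-! ### A smooth local determination of the angle -/

/-- The determination of the angle on the half plane around the direction `θ₀`. -/
def localAngle (θ₀ : ℝ) (x : Plane) : ℝ :=
  θ₀ + arctan (⟪polar 1 (θ₀ + π / 2), x⟫ / ⟪polar 1 θ₀, x⟫)

theorem eq_polar_localAngle {θ₀ : ℝ} {x : Plane} (hx : 0 < ⟪polar 1 θ₀, x⟫) :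
    x = polar ‖x‖ (localAngle θ₀ x) := by
  set a := ⟪polar 1 θ₀, x⟫ with ha
  set b := ⟪polar 1 (θ₀ + π / 2), x⟫ with hb
  have ha' : a = cos θ₀ * x 0 + sin θ₀ * x 1 := by rw [ha, inner_plane]; simp
  have hb' : b = - sin θ₀ * x 0 + cos θ₀ * x 1 := by
    rw [hb, inner_plane]; simp [cos_add_pi_div_two, sin_add_pi_div_two]
  have hsc := sin_sq_add_cos_sq θ₀
  have hx0 : x 0 = cos θ₀ * a - sin θ₀ * b := by
    rw [ha', hb']; linear_combination (-x 0) * hsc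
  have hx1 : x 1 = sin θ₀ * a + cos θ₀ * b := by
    rw [ha', hb']; linear_combination (-x 1) * hsc
  have hn : ‖x‖ ^ 2 = a ^ 2 + b ^ 2 := by
    rw [norm_sq_plane, hx0, hx1]; linear_combination (a ^ 2 + b ^ 2) * hsc
  have hnpos : 0 < ‖x‖ := by
    have : 0 < ‖x‖ ^ 2 := by rw [hn]; positivity
    exact lt_of_le_of_ne (norm_nonneg _) fun h0 => by simp [← h0] at this
  have hsq : √(1 + (b / a) ^ 2) = ‖x‖ / a := by
    rw [show 1 + (b / a) ^ 2 = (‖x‖ / a) ^ 2 by rw [div_pow, div_pow, hn]; field_simp]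
    exact sqrt_sq (by positivity)
  have hcos : cos (arctan (b / a)) = a / ‖x‖ := by rw [cos_arctan, hsq]; field_simp
  have hsin : sin (arctan (b / a)) = b / ‖x‖ := by rw [sin_arctan, hsq]; field_simp
  apply plane_ext
  · rw [polar_apply_zero, localAngle, cos_add, ← ha, ← hb, hcos, hsin, hx0]; field_simp
  · rw [polar_apply_one, localAngle, sin_add, ← ha, ← hb, hcos, hsin, hx1]; field_simp

theorem localAngle_polar {ρ : ℝ} (θ : ℝ) : localAngle θ (polar ρ θ) = θ := by
  rw [localAngle, inner_polar]; simp

theorem isOpen_halfPlane (v : Plane) : IsOpen {x : Plane | 0 < ⟪v, x⟫} :=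
  isOpen_lt continuous_const (by fun_prop)

theorem polar_mem_halfPlane {ρ : ℝ} (hρ : 0 < ρ) (θ : ℝ) : 0 < ⟪polar 1 θ, polar ρ θ⟫ := by
  rw [inner_polar]; simpa using hρ

theorem halfPlane_mem_nhds {ρ : ℝ} (hρ : 0 < ρ) (θ : ℝ) :
    ∀ᶠ x in 𝓝 (polar ρ θ), 0 < ⟪polar 1 θ, x⟫ :=
  (isOpen_halfPlane _).mem_nhds (polar_mem_halfPlane hρ θ)

theorem contDiffAt_localAngle {n : WithTop ℕ∞} {θ₀ : ℝ} {x : Plane}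
    (hx : 0 < ⟪polar 1 θ₀, x⟫) : ContDiffAt ℝ n (localAngle θ₀) x := by
  unfold localAngle
  refine contDiffAt_const.add ((contDiff_arctan.contDiffAt).comp x ?_)
  exact (innerSL ℝ (polar 1 (θ₀ + π / 2))).contDiff.contDiffAt.div
    (innerSL ℝ (polar 1 θ₀)).contDiff.contDiffAt hx.ne'

theorem hasFDerivAt_localAngle {ρ : ℝ} (hρ : 0 < ρ) (θ : ℝ) :
    HasFDerivAt (localAngle θ) (ρ⁻¹ • innerSL ℝ (polar 1 (θ + π / 2))) (polar ρ θ) := by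
  have h1 : HasFDerivAt (fun x : Plane => ⟪polar 1 (θ + π / 2), x⟫)
    (innerSL ℝ (polar 1 (θ + π / 2))) (polar ρ θ) :=
    (innerSL ℝ (polar 1 (θ + π / 2))).hasFDerivAt
  have h2 : HasFDerivAt (fun x : Plane => ⟪polar 1 θ, x⟫)
    (innerSL ℝ (polar 1 θ)) (polar ρ θ) := (innerSL ℝ (polar 1 θ)).hasFDerivAt
  have e1 : ⟪polar 1 (θ + π / 2), polar ρ θ⟫ = 0 := by rw [inner_polar]; simp
  have e2 : ⟪polar 1 θ, polar ρ θ⟫ = ρ := by rw [inner_polar]; simp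
  have h3 := (h1.fun_mul ((hasDerivAt_inv (x := ⟪polar 1 θ, polar ρ θ⟫)
    (by rw [e2]; exact hρ.ne')).comp_hasFDerivAt _ h2)).arctan.const_add θ
  refine HasFDerivAt.congr_fderiv (f' := _) h3 ?_
  ext v
  simp [e1, e2]

theorem hasFDerivAt_norm_polar {ρ : ℝ} (hρ : 0 < ρ) (θ : ℝ) :
    HasFDerivAt (fun x : Plane => ‖x‖) (innerSL ℝ (polar 1 θ)) (polar ρ θ) := by
  have h1 : HasFDerivAt (fun x : Plane => ‖x‖ ^ 2) (2 • innerSL ℝ (polar ρ θ)) (polar ρ θ) := by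
    simpa using (hasStrictFDerivAt_norm_sq (polar ρ θ)).hasFDerivAt
  have h2 := h1.sqrt (by rw [norm_polar hρ.le]; positivity)
  simp only [sqrt_sq (norm_nonneg _)] at h2
  refine h2.congr_fderiv ?_
  ext v
  have : ⟪polar ρ θ, v⟫ = ρ * ⟪polar 1 θ, v⟫ := by
    rw [← real_inner_smul_left, smul_polar, mul_one]
  simp [norm_polar hρ.le, this]
  field_simp

/-! ### Functions that are homogeneous of degree one, in polar coordinates -/

/-- `H` is homogeneous of degree one, and `{H ≤ 1}` has polar radius `R`. -/
def IsRadial (H : Plane → ℝ) (R : ℝ → ℝ) : Prop :=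
  ∀ ρ θ : ℝ, 0 ≤ ρ → H (polar ρ θ) = ρ / R θ

variable {H : Plane → ℝ} {R L : ℝ → ℝ}

theorem IsRadial.eq_on_halfPlane (hH : IsRadial H R) {θ₀ : ℝ} {x : Plane}
    (hx : 0 < ⟪polar 1 θ₀, x⟫) : H x = ‖x‖ * (R (localAngle θ₀ x))⁻¹ := by
  conv_lhs => rw [eq_polar_localAngle hx]
  rw [hH _ _ (norm_nonneg _), div_eq_mul_inv]

/-- Two forms of the normal vector. The polar one is adapted to the support inequality; the one in
the moving frame is affine in `L`, and so can be differentiated. -/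
theorem IsProfile.gradient_eq (h : IsProfile R L) (θ : ℝ) :
    polar (R θ * sin (tangentAngle L θ - θ))⁻¹ (tangentAngle L θ - π / 2) =
      (R θ)⁻¹ • (polar 1 θ - L θ • polar 1 (θ + π / 2)) := by
  have hs := sin_tangentAngle_sub_pos L θ
  have hc := cos_tangentAngle_sub L θ
  have hR := h.pos θ
  set T := tangentAngle L θ
  have ec : cos (T - π / 2) = sin (T - θ) * cos θ + cos (T - θ) * sin θ := by
    rw [cos_sub_pi_div_two, ← sin_add]; ring_nf
  have es : sin (T - π / 2) = sin (T - θ) * sin θ - cos (T - θ) * cos θ := by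
    rw [sin_sub_pi_div_two, show T = (T - θ) + θ by ring, cos_add]; ring_nf
  apply plane_ext
  · simp [ec, hc, cos_add_pi_div_two]; field_simp
  · simp [es, hc, sin_add_pi_div_two]; field_simp

/-- Near the ray, `H` is the product of the norm and of `R⁻¹` composed with the local angle; the
product rule gives the moving-frame form of the normal. As for any function homogeneous of degree
one, the result does not depend on `ρ`. -/
theorem IsRadial.hasGradientAt (hH : IsRadial H R) (h : IsProfile R L) {ρ : ℝ} (hρ : 0 < ρ)
    (θ : ℝ) : HasGradientAt H
      (polar (R θ * sin (tangentAngle L θ - θ))⁻¹ (tangentAngle L θ - π / 2)) (polar ρ θ) := by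
  have h1 := hasFDerivAt_norm_polar hρ θ
  have h2 : HasDerivAt (fun t => (R t)⁻¹) (-(R θ * L θ) / R θ ^ 2) (localAngle θ (polar ρ θ)) := by
    rw [localAngle_polar]; exact (h.hasDerivAt θ).fun_inv (h.pos θ).ne'
  have h3 := h1.fun_mul (h2.comp_hasFDerivAt _ (hasFDerivAt_localAngle hρ θ))
  rw [hasGradientAt_iff_hasFDerivAt]
  refine (h3.congr_of_eventuallyEq ?_).congr_fderiv ?_
  · filter_upwards [halfPlane_mem_nhds hρ θ] with x hx
    exact hH.eq_on_halfPlane hx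
  · ext v
    have hR := h.pos θ
    simp only [add_apply, smul_apply, localAngle_polar, innerSL_apply_apply, Function.comp,
      smul_eq_mul, InnerProductSpace.toDual_apply_apply, norm_polar hρ.le, h.gradient_eq,
      inner_smul_left, inner_sub_left, conj_trivial]
    field_simp
    ring
end

noncomputable section

open Filter Topology Real

variable {H : Plane → ℝ} {R L : ℝ → ℝ}

/-! ### Continuity and level sets -/

namespace IsProfile

theorem exists_min (h : IsProfile R L) : ∃ θ₀, ∀ θ, R θ₀ ≤ R θ := by
  obtain ⟨y, ⟨⟨θ₀, rfl⟩, hy⟩⟩ := (h.periodic.compact_of_continuous pi_ne_zero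
    h.continuous_radius).exists_isLeast (range_nonempty R)
  exact ⟨θ₀, fun θ => hy ⟨θ, rfl⟩⟩

theorem add_two_pi (h : IsProfile R L) (θ : ℝ) : R (θ + 2 * π) = R θ := by
  rw [show θ + 2 * π = θ + π + π by ring, h.periodic, h.periodic]

end IsProfile

namespace IsRadial

theorem map_zero (hH : IsRadial H R) : H 0 = 0 := by
  rw [← polar_zero 0, hH 0 0 le_rfl, zero_div]

theorem continuous (hH : IsRadial H R) (h : IsProfile R L) : Continuous H := by
  rw [continuous_iff_continuousAt]
  intro x
  rcases eq_or_ne x 0 with rfl | hx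
  · obtain ⟨θ₀, hmin⟩ := h.exists_min
    have hb : ∀ x, ‖H x‖ ≤ ‖x‖ / R θ₀ := fun x => by
      obtain ⟨θ, hθ⟩ := exists_eq_polar x
      have : H x = ‖x‖ / R θ := by
        conv_lhs => rw [hθ]
        exact hH _ _ (norm_nonneg _)
      rw [this, norm_of_nonneg (div_nonneg (norm_nonneg _) (h.pos θ).le)]
      exact div_le_div_of_nonneg_left (norm_nonneg _) (h.pos θ₀) (hmin θ)
    rw [ContinuousAt, hH.map_zero]
    refine squeeze_zero_norm hb ?_
    have : Continuous fun x : Plane => ‖x‖ / R θ₀ := by fun_prop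
    simpa using this.tendsto 0
  · obtain ⟨θ, hθ⟩ := exists_eq_polar x
    rw [hθ]
    exact (hH.hasGradientAt h (norm_pos_iff.2 hx) θ).hasFDerivAt.continuousAt

theorem smul (hH : IsRadial H R) {t : ℝ} (ht : 0 ≤ t) (x : Plane) : H (t • x) = t * H x := by
  obtain ⟨θ, hθ⟩ := exists_eq_polar x
  rw [hθ, smul_polar, hH _ _ (by positivity), hH _ _ (norm_nonneg _), mul_div_assoc]

theorem closure_unitBall (hH : IsRadial H R) (h : IsProfile R L) :
    closure (unitBall H) = {x | H x ≤ 1} := by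
  have hc := hH.continuous h
  refine subset_antisymm (closure_minimal (fun x (hx : H x < 1) => show H x ≤ 1 from hx.le)
    (isClosed_le hc continuous_const)) fun x hx => ?_
  -- A point of level at most one is the limit of its own contractions, which lie in the open ball.
  have ht : Tendsto (fun t : ℝ => t • x) (𝓝[<] 1) (𝓝 x) := by
    have : Continuous fun t : ℝ => t • x := by fun_prop
    simpa using (this.tendsto 1).mono_left nhdsWithin_le_nhds
  refine mem_closure_of_tendsto ht ?_
  have h0 : ∀ᶠ t : ℝ in 𝓝[<] 1, t ∈ Ioo (0 : ℝ) 1 := Ioo_mem_nhdsLT one_pos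
  filter_upwards [h0] with t ht
  change H (t • x) < 1
  rw [hH.smul ht.1.le]
  calc t * H x ≤ t * 1 := mul_le_mul_of_nonneg_left hx ht.1.le
    _ < 1 := by linarith [ht.2]

theorem isOpen_unitBall (hH : IsRadial H R) (h : IsProfile R L) : IsOpen (unitBall H) :=
  isOpen_lt (hH.continuous h) continuous_const

theorem frontier_unitBall (hH : IsRadial H R) (h : IsProfile R L) :
    frontier (unitBall H) = {x | H x = 1} := by
  rw [(hH.isOpen_unitBall h).frontier_eq, hH.closure_unitBall h]
  ext x
  simp only [unitBall, Set.mem_sdiff, mem_ofPred_eq, not_lt]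
  exact ⟨fun hx => le_antisymm hx.1 hx.2, fun hx => ⟨hx.le, hx.ge⟩⟩

theorem setOf_le_one (hH : IsRadial H R) (h : IsProfile R L) : {x | H x ≤ 1} = polarSet R := by
  ext x
  constructor
  · intro hx
    obtain ⟨θ, hθ, hxθ⟩ := exists_eq_polar_mem x 0
    have : H x = ‖x‖ / R θ := by
      conv_lhs => rw [hxθ]
      exact hH _ _ (norm_nonneg _)
    rw [mem_ofPred_eq, this, div_le_one (h.pos θ)] at hx
    exact ⟨θ, ⟨hθ.1, by linarith [hθ.2]⟩, ‖x‖, ⟨norm_nonneg _, hx⟩, hxθ⟩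
  · rintro ⟨θ, -, ρ, hρ, rfl⟩
    rw [mem_ofPred_eq, hH _ _ hρ.1, div_le_one (h.pos θ)]
    exact hρ.2

end IsRadial

/-! ### Strict convexity -/

/-- The quotient of the two sides at a point of angle `φ` is the ratio of the heights of the
boundary points `φ` and `θ` over the tangent direction at `θ`, so this is the strict support
property in the plane, equality case included. -/
theorem IsRadial.inner_gradient_le (hH : IsRadial H R) (h : IsProfile R L)
    (hT : StrictMono (tangentAngle L)) (θ : ℝ) (x : Plane) :
    ⟪polar (R θ * sin (tangentAngle L θ - θ))⁻¹ (tangentAngle L θ - π / 2), x⟫ ≤ H x ∧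
    (⟪polar (R θ * sin (tangentAngle L θ - θ))⁻¹ (tangentAngle L θ - π / 2), x⟫ = H x →
      x = polar ‖x‖ θ) := by
  have hN : 0 < R θ * sin (tangentAngle L θ - θ) :=
    mul_pos (h.pos θ) (sin_tangentAngle_sub_pos L θ)
  obtain ⟨φ, hφ, hx⟩ := exists_eq_polar_mem x (θ - π)
  rcases eq_or_ne x 0 with rfl | hx0
  · simp [hH.map_zero, polar_zero]
  have hxpos : 0 < ‖x‖ := norm_pos_iff.2 hx0
  have e1 : ⟪polar (R θ * sin (tangentAngle L θ - θ))⁻¹ (tangentAngle L θ - π / 2), x⟫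
      = ‖x‖ / R φ * (R φ * sin (tangentAngle L θ - φ) / (R θ * sin (tangentAngle L θ - θ))) := by
    have hR := (h.pos φ).ne'
    conv_lhs => rw [hx]
    rw [inner_polar, show tangentAngle L θ - π / 2 - φ = tangentAngle L θ - φ - π / 2 by ring,
      cos_sub_pi_div_two]
    field_simp
  have e2 : H x = ‖x‖ / R φ := by
    conv_lhs => rw [hx]
    exact hH _ _ (norm_nonneg _)
  have hq : 0 < ‖x‖ / R φ := div_pos hxpos (h.pos φ)
  rcases eq_or_ne φ θ with rfl | hne
  · refine ⟨?_, fun _ => hx⟩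
    rw [e1, e2, div_self hN.ne', mul_one]
  · have hlt := h.mul_sin_lt hT hne hφ.1 (by linarith [hφ.2])
    have : ⟪polar (R θ * sin (tangentAngle L θ - θ))⁻¹ (tangentAngle L θ - π / 2), x⟫ < H x := by
      rw [e1, e2]
      have := (div_lt_one hN).2 hlt
      exact mul_lt_of_lt_one_right hq this
    exact ⟨this.le, fun he => absurd he this.ne⟩

/-- The normal `N` in the direction of a convex combination `z` evaluates to `H z` on `z` and is at
most `H` elsewhere. If `H z` were at least one, `N` would equal one at both endpoints; the equality
case puts both on the same ray at level one, so they coincide. -/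
theorem IsRadial.strictConvex (hH : IsRadial H R) (h : IsProfile R L)
    (hT : StrictMono (tangentAngle L)) : StrictConvex ℝ (polarSet R) := by
  rw [← hH.setOf_le_one h]
  intro x hx y hy hxy a b ha hb hab
  have hsub : unitBall H ⊆ interior {x | H x ≤ 1} :=
    (hH.isOpen_unitBall h).subset_interior_iff.2 fun z (hz : H z < 1) => show H z ≤ 1 from hz.le
  apply hsub
  change H (a • x + b • y) < 1
  set z := a • x + b • y with hz
  rcases eq_or_ne z 0 with h0 | h0
  · rw [h0, hH.map_zero]; exact one_pos
  obtain ⟨θ, hθ⟩ := exists_eq_polar z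
  set N := polar (R θ * sin (tangentAngle L θ - θ))⁻¹ (tangentAngle L θ - π / 2) with hN
  have hsp := sin_tangentAngle_sub_pos L θ
  have hR := h.pos θ
  have hNz : ⟪N, z⟫ = H z := by
    conv_rhs => rw [hθ]
    rw [hH _ _ (norm_nonneg _)]
    conv_lhs => rw [hθ]
    rw [hN, inner_polar, show tangentAngle L θ - π / 2 - θ = tangentAngle L θ - θ - π / 2 by ring,
      cos_sub_pi_div_two]
    field_simp
  obtain ⟨hx1, hx2⟩ := hH.inner_gradient_le h hT θ x
  obtain ⟨hy1, hy2⟩ := hH.inner_gradient_le h hT θ y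
  have hz2 : H z = a * ⟪N, x⟫ + b * ⟪N, y⟫ := by
    rw [← hNz, hz, inner_add_right, inner_smul_right, inner_smul_right]
  have hx3 : H x ≤ 1 := hx
  have hy3 : H y ≤ 1 := hy
  by_contra hcon
  push Not at hcon
  have hbx : b * ⟪N, y⟫ ≤ b * 1 := mul_le_mul_of_nonneg_left (hy1.trans hy3) hb.le
  have hax : a * ⟪N, x⟫ ≤ a * 1 := mul_le_mul_of_nonneg_left (hx1.trans hx3) ha.le
  have ex : ⟪N, x⟫ = 1 := by
    have : a * ⟪N, x⟫ = a * 1 := by linarith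
    exact mul_left_cancel₀ ha.ne' this
  have ey : ⟪N, y⟫ = 1 := by
    have : b * ⟪N, y⟫ = b * 1 := by linarith
    exact mul_left_cancel₀ hb.ne' this
  have Hx : H x = 1 := le_antisymm hx3 (ex ▸ hx1)
  have Hy : H y = 1 := le_antisymm hy3 (ey ▸ hy1)
  have px := hx2 (ex.trans Hx.symm)
  have py := hy2 (ey.trans Hy.symm)
  rw [px, hH _ _ (norm_nonneg _), div_eq_one_iff_eq hR.ne'] at Hx
  rw [py, hH _ _ (norm_nonneg _), div_eq_one_iff_eq hR.ne'] at Hy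
  exact hxy (by rw [px, py, Hx, Hy])

/-! ### The dual function -/

/-- The quotient in the supremum is `s` times the height of the boundary point `ψ` over the tangent
direction at `θ`, and the support property says that `ψ = θ` maximizes it. Parametrizing the dual
variable by the contact angle avoids inverting `T`. -/
theorem IsRadial.dual_polar (hH : IsRadial H R) (h : IsProfile R L)
    (hT : StrictMono (tangentAngle L)) {s : ℝ} (hs : 0 ≤ s) (θ : ℝ) :
    dual H (polar s (tangentAngle L θ - π / 2)) =
      s * (R θ * sin (tangentAngle L θ - θ)) := by
  have key : ∀ ψ, ⟪polar s (tangentAngle L θ - π / 2), polar 1 ψ⟫ / H (polar 1 ψ) =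
      s * (R ψ * sin (tangentAngle L θ - ψ)) := fun ψ => by
    have := (h.pos ψ).ne'
    rw [inner_polar, hH _ _ zero_le_one,
      show tangentAngle L θ - π / 2 - ψ = tangentAngle L θ - ψ - π / 2 by ring, cos_sub_pi_div_two]
    field_simp
  have hle : ∀ ξ : Metric.sphere (0 : Plane) 1,
      ⟪polar s (tangentAngle L θ - π / 2), (ξ : Plane)⟫ / H ξ ≤
        s * (R θ * sin (tangentAngle L θ - θ)) := fun ξ => by
    obtain ⟨ψ, hψ⟩ := exists_eq_polar (ξ : Plane)
    have h1 : ‖(ξ : Plane)‖ = 1 := by simp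
    rw [hψ, h1, key]
    exact mul_le_mul_of_nonneg_left (h.mul_sin_le hT θ ψ) hs
  have : Nonempty (Metric.sphere (0 : Plane) 1) :=
    ⟨⟨polar 1 0, by simp [norm_polar zero_le_one]⟩⟩
  refine le_antisymm (ciSup_le hle) ?_
  have := le_ciSup (f := fun ξ : Metric.sphere (0 : Plane) 1 =>
    ⟪polar s (tangentAngle L θ - π / 2), (ξ : Plane)⟫ / H ξ)
    ⟨_, by rintro _ ⟨ξ, rfl⟩; exact hle ξ⟩ ⟨polar 1 θ, by simp [norm_polar zero_le_one]⟩
  rwa [key] at this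

/-- Envelope theorem: a supremum of linear functionals is differentiable where the maximizer
depends continuously on the point. -/
theorem hasGradientAt_of_envelope {f : Plane → ℝ} {p : Plane → Plane} {x : Plane}
    (hp : ContinuousAt p x) (h1 : ∀ᶠ y in 𝓝 x, f y = ⟪p y, y⟫)
    (h2 : ∀ᶠ y in 𝓝 x, ⟪p y, x⟫ ≤ f x ∧ ⟪p x, y⟫ ≤ f y) : HasGradientAt f (p x) x := by
  rw [hasGradientAt_iff_isLittleO]
  have hlittle : (fun y => ‖p y - p x‖ * ‖y - x‖) =o[𝓝 x] fun y => y - x := by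
    have ho : (fun y => ‖p y - p x‖) =o[𝓝 x] (fun _ => (1 : ℝ)) := by
      rw [Asymptotics.isLittleO_one_iff]
      have : Tendsto (fun y => p y - p x) (𝓝 x) (𝓝 0) := by
        simpa using hp.tendsto.sub_const (p x)
      simpa using this.norm
    have := ho.mul_isBigO (Asymptotics.isBigO_refl (fun y => ‖y - x‖) (𝓝 x))
    simpa using this
  -- The two inequalities squeeze the remainder between `0` and `⟪p y - p x, y - x⟫`, which
  -- Cauchy–Schwarz bounds by `‖p y - p x‖ * ‖y - x‖`.
  refine (Asymptotics.IsBigO.of_bound 1 ?_).trans_isLittleO hlittle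
  have hx := h1.self_of_nhds
  filter_upwards [h1, h2] with y hy1 hy2
  have e : f y - f x - ⟪p x, y - x⟫ = f y - ⟪p x, y⟫ := by rw [inner_sub_right, hx]; ring
  have e2 : ⟪p y - p x, y - x⟫ = ⟪p y, y⟫ - ⟪p x, y⟫ + ⟪p x, x⟫ - ⟪p y, x⟫ := by
    rw [inner_sub_right, inner_sub_left, inner_sub_left]; ring
  rw [e, one_mul, norm_of_nonneg (by linarith [hy2.2]), norm_of_nonneg (by positivity)]
  have := real_inner_le_norm (p y - p x) (y - x)
  linarith [hy2.1]

/-- The maximizer in the dual is the contact point `polar (R m) m`. As `T` is an order isomorphism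
of the line, its inverse is continuous and the contact point varies continuously, which is what the
envelope theorem needs. -/
theorem IsRadial.hasGradientAt_dual (hH : IsRadial H R) (h : IsProfile R L)
    (hT : StrictMono (tangentAngle L)) {s : ℝ} (hs : 0 < s) (θ : ℝ) :
    HasGradientAt (dual H) (polar (R θ) θ) (polar s (tangentAngle L θ - π / 2)) := by
  set E : ℝ ≃o ℝ := hT.orderIsoOfSurjective _ h.surjective_tangentAngle with hE
  have hEs : ∀ y, tangentAngle L (E.symm y) = y := fun y => E.apply_symm_apply y
  set φ := tangentAngle L θ - π / 2 with hφ
  set x := polar s φ with hx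
  set σ : Plane → ℝ := fun y => E.symm (localAngle φ y + π / 2) with hσ
  have hσx : σ x = θ := by
    simp only [hσ, hx, localAngle_polar, hφ, sub_add_cancel]
    exact E.symm_apply_apply θ
  have hσc : ContinuousAt σ x :=
    (E.symm.continuous.continuousAt).comp
      (((contDiffAt_localAngle (n := 1) (polar_mem_halfPlane hs φ)).continuousAt).add
        continuousAt_const)
  have hpc : ContinuousAt (fun y => polar (R (σ y)) (σ y)) x :=
    continuous_polar.continuousAt.comp
      ((h.continuous_radius.continuousAt.comp hσc).prodMk hσc)
  have hin : ∀ (ψ a m : ℝ), ⟪polar (R m) m, polar a (ψ - π / 2)⟫ = a * (R m * sin (ψ - m)) := by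
    intro ψ a m
    rw [inner_polar, ← cos_neg, show -(m - (ψ - π / 2)) = ψ - m - π / 2 by ring,
      cos_sub_pi_div_two]; ring
  have hval : ∀ y, 0 < ⟪polar 1 φ, y⟫ →
      y = polar ‖y‖ (tangentAngle L (σ y) - π / 2) := fun y hy => by
    rw [hσ]; simp only [hEs, add_sub_cancel_right]
    exact eq_polar_localAngle hy
  have hxx : x = polar s (tangentAngle L θ - π / 2) := rfl
  have hev := halfPlane_mem_nhds hs φ
  have := hasGradientAt_of_envelope (f := dual H) (p := fun y => polar (R (σ y)) (σ y)) hpc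
    (by
      filter_upwards [hev] with y hy
      have hy' := hval y hy
      set m := σ y
      rw [hy', hin, hH.dual_polar h hT (norm_nonneg _)])
    (by
      filter_upwards [hev] with y hy
      have hy' := hval y hy
      constructor
      · rw [hxx, hin, hH.dual_polar h hT hs.le]
        exact mul_le_mul_of_nonneg_left (h.mul_sin_le hT _ _) hs.le
      · set m := σ y
        rw [hy', hin, hH.dual_polar h hT (norm_nonneg _)]
        exact mul_le_mul_of_nonneg_left (h.mul_sin_le hT _ _) (norm_nonneg _))
  simpa only [hσx] using this

/-! ### The sign condition -/

theorem sign_mul_of_pos {a : ℝ} (ha : 0 < a) (b : ℝ) :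
    SignType.sign (a * b) = SignType.sign b := by
  rw [sign_mul, sign_pos ha, one_mul]

/-- Up to positive factors, the pairing is that of the normal at `θ` with the boundary point `m`,
since the gradient of the dual at the normal of `m` is the point `m` itself. -/
theorem IsRadial.sign_inner (hH : IsRadial H R) (h : IsProfile R L)
    (hT : StrictMono (tangentAngle L)) {ρ s : ℝ} (hρ : 0 < ρ) (hs : 0 < s) (θ m : ℝ) :
    SignType.sign ⟪H (polar ρ θ) • gradient H (polar ρ θ),
      dual H (polar s (tangentAngle L m - π / 2)) •
        gradient (dual H) (polar s (tangentAngle L m - π / 2))⟫ =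
      SignType.sign (sin (tangentAngle L θ - m)) := by
  rw [(hH.hasGradientAt h hρ θ).gradient, (hH.hasGradientAt_dual h hT hs m).gradient,
    hH _ _ hρ.le, hH.dual_polar h hT hs.le, inner_smul_left, inner_smul_right, inner_polar,
    show tangentAngle L θ - π / 2 - m = tangentAngle L θ - m - π / 2 by ring, cos_sub_pi_div_two]
  have h1 := h.pos θ
  have h2 := h.pos m
  have h3 := sin_tangentAngle_sub_pos L θ
  have h4 := sin_tangentAngle_sub_pos L m
  simp only [conj_trivial]
  rw [sign_mul_of_pos (by positivity), sign_mul_of_pos (by positivity),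
    sign_mul_of_pos (by positivity)]

/-- Taking `m = T θ` makes the left side vanish, and `T (T θ) - θ` lies in `(0, 2π)`, so it must be
`π`. Conversely, for `m` between `T θ - π` and `T θ` monotonicity puts `T m` between `θ` and `θ +
π`, so both sines are positive; translating `m` by `π` changes both signs. -/
theorem IsProfile.sign_sin_iff (h : IsProfile R L) (hT : StrictMono (tangentAngle L)) :
    (∀ θ m, SignType.sign (sin (tangentAngle L θ - m)) =
      SignType.sign (sin (tangentAngle L m - θ))) ↔
    ∀ θ, tangentAngle L (tangentAngle L θ) = θ + π := by
  constructor
  · intro hs θ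
    have h0 := hs θ (tangentAngle L θ)
    rw [sub_self, sin_zero, _root_.sign_zero, eq_comm, _root_.sign_eq_zero_iff] at h0
    have a1 := lt_tangentAngle L θ
    have a2 := lt_tangentAngle L (tangentAngle L θ)
    have b1 := tangentAngle_lt L θ
    have b2 := tangentAngle_lt L (tangentAngle L θ)
    have := sin_eq_zero_iff_of_lt_of_lt
      (x := tangentAngle L (tangentAngle L θ) - θ - π) (by linarith) (by linarith)
    rw [sin_sub_pi, h0, neg_zero] at this
    linarith [this.1 rfl]
  · intro hTT
    have base : ∀ θ m, m ∈ Ioc (tangentAngle L θ - π) (tangentAngle L θ) →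
        SignType.sign (sin (tangentAngle L θ - m)) =
          SignType.sign (sin (tangentAngle L m - θ)) := by
      intro θ m hm
      rcases hm.2.eq_or_lt with rfl | hlt
      · simp [hTT]
      · have h1 := hT hm.1
        have h2 := hT hlt
        have h3 := h.tangentAngle_add_pi (tangentAngle L θ - π)
        rw [sub_add_cancel, hTT] at h3
        rw [hTT] at h2
        rw [sign_pos (sin_pos_of_pos_of_lt_pi (by linarith) (by linarith [hm.1])),
          sign_pos (sin_pos_of_pos_of_lt_pi (by linarith) (by linarith))]
    have step : ∀ θ m, SignType.sign (sin (tangentAngle L θ - m)) =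
        SignType.sign (sin (tangentAngle L m - θ)) ↔
        SignType.sign (sin (tangentAngle L θ - (m + π))) =
        SignType.sign (sin (tangentAngle L (m + π) - θ)) := by
      intro θ m
      rw [h.tangentAngle_add_pi, show tangentAngle L θ - (m + π) = tangentAngle L θ - m - π by ring,
        show tangentAngle L m + π - θ = tangentAngle L m - θ + π by ring, sin_sub_pi, sin_add_pi,
        Left.sign_neg, Left.sign_neg, neg_inj]
    have stepz : ∀ (k : ℤ) θ m, SignType.sign (sin (tangentAngle L θ - m)) =
        SignType.sign (sin (tangentAngle L m - θ)) ↔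
        SignType.sign (sin (tangentAngle L θ - (m + k * π))) =
        SignType.sign (sin (tangentAngle L (m + k * π) - θ)) := by
      intro k θ m
      induction k using Int.induction_on with
      | zero => simp
      | succ n ih =>
        rw [ih, step, show m + ((n : ℤ) : ℝ) * π + π = m + ((n + 1 : ℤ) : ℝ) * π by
          push_cast; ring]
      | pred n ih =>
        rw [ih, step θ (m + ((-n - 1 : ℤ) : ℝ) * π),
          show m + ((-n - 1 : ℤ) : ℝ) * π + π = m + ((-n : ℤ) : ℝ) * π by push_cast; ring]
    intro θ m
    obtain ⟨k, hk, -⟩ := existsUnique_add_zsmul_mem_Ioc pi_pos m (tangentAngle L θ - π)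
    rw [stepz k]
    apply base
    rw [zsmul_eq_mul, sub_add_cancel] at hk
    exact hk

theorem IsRadial.signCondition_iff (hH : IsRadial H R) (h : IsProfile R L)
    (hT : StrictMono (tangentAngle L)) :
    SignCondition H ↔ ∀ θ, tangentAngle L (tangentAngle L θ) = θ + π := by
  rw [← h.sign_sin_iff hT]
  have e : ∀ {ρ s : ℝ}, 0 < ρ → 0 < s → ∀ θ m,
      SignType.sign ⟪polar ρ θ, polar s (tangentAngle L m - π / 2)⟫ =
        SignType.sign (sin (tangentAngle L m - θ)) := fun {ρ s} hρ hs θ m => by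
    rw [inner_polar, sign_mul_of_pos (by positivity), ← cos_neg,
      show -(θ - (tangentAngle L m - π / 2)) = tangentAngle L m - θ - π / 2 by ring,
      cos_sub_pi_div_two]
  constructor
  · intro hS θ m
    have := hS (polar 1 θ) (polar 1 (tangentAngle L m - π / 2))
    rwa [hH.sign_inner h hT one_pos one_pos, e one_pos one_pos] at this
  · intro hs ξ x
    rcases eq_or_ne ξ 0 with rfl | hξ
    · simp [hH.map_zero]
    rcases eq_or_ne x 0 with rfl | hx
    · have : dual H 0 = 0 := by simp [dual]
      simp [this]
    obtain ⟨θ, hθ⟩ := exists_eq_polar ξ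
    obtain ⟨φ, hφ⟩ := exists_eq_polar x
    -- Since `T` is onto, every direction of `x` is the normal direction at some contact angle `m`.
    obtain ⟨m, hm⟩ := h.surjective_tangentAngle (φ + π / 2)
    have hφm : φ = tangentAngle L m - π / 2 := by rw [hm]; ring
    rw [hφm] at hφ
    rw [hθ, hφ, hH.sign_inner h hT (norm_pos_iff.2 hξ) (norm_pos_iff.2 hx),
      e (norm_pos_iff.2 hξ) (norm_pos_iff.2 hx)]
    exact hs θ m
end

noncomputable section

open Filter Topology Real

variable {H : Plane → ℝ} {R L L' : ℝ → ℝ}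

/-! ### The radius function of an anisotropy -/

/-- The polar radius of the unit ball of `H`. -/
def ballRadius (H : Plane → ℝ) (θ : ℝ) : ℝ := (H (polar 1 θ))⁻¹

theorem IsAnisotropy.isRadial (hH : IsAnisotropy H) : IsRadial H (ballRadius H) := by
  intro ρ θ hρ
  rcases hρ.eq_or_lt with rfl | hρ
  · rw [polar_zero, hH.map_zero, zero_div]
  · rw [ballRadius, div_inv_eq_mul, ← hH.homogeneous ρ hρ, smul_polar, mul_one]

theorem IsAnisotropy.ballRadius_pos (hH : IsAnisotropy H) (θ : ℝ) : 0 < ballRadius H θ :=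
  inv_pos.2 (hH.pos _ (polar_ne_zero one_pos θ))

theorem IsAnisotropy.contDiff_ballRadius (hH : IsAnisotropy H) {n : WithTop ℕ∞}
    (hn : ContDiffOn ℝ n H {0}ᶜ) : ContDiff ℝ n (ballRadius H) := by
  refine ContDiff.inv ?_ fun θ => (hH.pos _ (polar_ne_zero one_pos θ)).ne'
  exact hn.comp_contDiff (contDiff_polar 1) fun θ => polar_ne_zero one_pos θ

theorem IsAnisotropy.isProfile (hH : IsAnisotropy H) (heven : ∀ ξ, H (-ξ) = H ξ)
    (hn : ContDiffOn ℝ 1 H {0}ᶜ) :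
    IsProfile (ballRadius H) (fun θ => deriv (ballRadius H) θ / ballRadius H θ) where
  pos := hH.ballRadius_pos
  periodic θ := by rw [ballRadius, polar_add_pi, heven]; rfl
  hasDerivAt θ := by
    have h1 := ((hH.contDiff_ballRadius hn).differentiable one_ne_zero θ).hasDerivAt
    rwa [mul_div_cancel₀ _ (hH.ballRadius_pos θ).ne']
  continuous := by
    have h1 := hH.contDiff_ballRadius hn
    exact (h1.continuous_deriv le_rfl).div h1.continuous fun θ => ne_of_gt (hH.ballRadius_pos θ)

/-! ### Strict convexity forces the tangent angle to increase -/

/-- Along the segment from the boundary point `x` of angle `θ` to `z`, `H` starts at one and never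
exceeds one, so its derivative at `x`, which is `⟪N, z - x⟫`, is nonpositive; and `⟪N, x⟫ = 1`. -/
theorem IsRadial.inner_le_one_of_convex (hH : IsRadial H R) (h : IsProfile R L)
    (hK : Convex ℝ {x | H x ≤ 1}) (θ : ℝ) {z : Plane} (hz : H z ≤ 1) :
    ⟪polar (R θ * sin (tangentAngle L θ - θ))⁻¹ (tangentAngle L θ - π / 2), z⟫ ≤ 1 := by
  set N := polar (R θ * sin (tangentAngle L θ - θ))⁻¹ (tangentAngle L θ - π / 2) with hN
  have hR := h.pos θ
  have hs := sin_tangentAngle_sub_pos L θ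
  set x := polar (R θ) θ with hx
  have hNx : ⟪N, x⟫ = 1 := by
    rw [hN, hx, inner_polar,
      show tangentAngle L θ - π / 2 - θ = tangentAngle L θ - θ - π / 2 by ring, cos_sub_pi_div_two]
    field_simp
  have hHx : H x = 1 := by rw [hx, hH _ _ hR.le, div_self hR.ne']
  have hd : HasDerivAt (fun t : ℝ => H (x + t • (z - x))) ⟪N, z - x⟫ 0 := by
    have h1 : HasFDerivAt H (InnerProductSpace.toDual ℝ Plane N) (x + (0 : ℝ) • (z - x)) := by
      rw [zero_smul, add_zero]; exact (hH.hasGradientAt h hR θ).hasFDerivAt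
    have h2 : HasDerivAt (fun t : ℝ => x + t • (z - x)) (z - x) 0 := by
      simpa using ((hasDerivAt_id (0 : ℝ)).smul_const (z - x)).const_add x
    exact (h1.comp_hasDerivAt 0 h2).congr_deriv
      (InnerProductSpace.toDual_apply_apply (𝕜 := ℝ) (E := Plane))
  have hle : ⟪N, z - x⟫ ≤ 0 := by
    refine le_of_tendsto hd.tendsto_slope_zero_right ?_
    filter_upwards [Ioo_mem_nhdsGT (zero_lt_one' ℝ)] with t ht
    have hmem : H (x + t • (z - x)) ≤ 1 :=
      hK.add_smul_sub_mem (x := x) (y := z) hHx.le hz ⟨ht.1.le, ht.2.le⟩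
    simp only [zero_add, zero_smul, add_zero, hHx, smul_eq_mul]
    exact mul_nonpos_of_nonneg_of_nonpos (inv_nonneg.2 ht.1.le) (by linarith)
  rw [inner_sub_right, hNx] at hle
  linarith

/-- The midpoint of the two boundary points is interior, so it can be pushed a little along the
normal `N` without leaving the ball. The weak support inequality at the pushed point gives the
strict one at `φ`. -/
theorem IsRadial.mul_sin_lt_of_strictConvex (hH : IsRadial H R) (h : IsProfile R L)
    (hK : StrictConvex ℝ {x | H x ≤ 1}) {θ φ : ℝ} (hne : polar (R φ) φ ≠ polar (R θ) θ) :
    R φ * sin (tangentAngle L θ - φ) < R θ * sin (tangentAngle L θ - θ) := by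
  have hs := mul_pos (h.pos θ) (sin_tangentAngle_sub_pos L θ)
  set N := polar (R θ * sin (tangentAngle L θ - θ))⁻¹ (tangentAngle L θ - π / 2) with hN
  have hin : ∀ ψ, ⟪N, polar (R ψ) ψ⟫ =
      R ψ * sin (tangentAngle L θ - ψ) / (R θ * sin (tangentAngle L θ - θ)) := fun ψ => by
    rw [hN, inner_polar,
      show tangentAngle L θ - π / 2 - ψ = tangentAngle L θ - ψ - π / 2 by ring, cos_sub_pi_div_two]
    field_simp
  have hmem : ∀ ψ, polar (R ψ) ψ ∈ {x | H x ≤ 1} := fun ψ => by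
    rw [mem_ofPred_eq, hH _ _ (h.pos ψ).le, div_self (h.pos ψ).ne']
  have hint := hK (hmem φ) (hmem θ) hne (a := 1 / 2) (b := 1 / 2) (by norm_num) (by norm_num)
    (by norm_num)
  set z := (1 / 2 : ℝ) • polar (R φ) φ + (1 / 2 : ℝ) • polar (R θ) θ with hz
  have hcont : Continuous fun ε : ℝ => z + ε • N := by fun_prop
  have hev : ∀ᶠ ε : ℝ in 𝓝 0, z + ε • N ∈ interior {x | H x ≤ 1} := by
    refine hcont.continuousAt.eventually_mem (isOpen_interior.mem_nhds ?_)
    simpa using hint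
  obtain ⟨ε, hε, hεpos⟩ := ((hev.filter_mono nhdsWithin_le_nhds).and
    (self_mem_nhdsWithin : ∀ᶠ ε in 𝓝[>] (0 : ℝ), ε ∈ Ioi (0 : ℝ))).exists
  have hεpos' : 0 < ε := hεpos
  have hεmem : H (z + ε • N) ≤ 1 := by
    have := interior_subset hε
    rwa [mem_ofPred_eq] at this
  have hb := hH.inner_le_one_of_convex h hK.convex θ hεmem
  have hNN : 0 < ⟪N, N⟫ := by
    rw [real_inner_self_eq_norm_sq, hN, norm_polar (inv_pos.2 hs).le]; positivity
  rw [← hN, inner_add_right, inner_smul_right, hz, inner_add_right, inner_smul_right,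
    inner_smul_right, hin, hin, div_self hs.ne'] at hb
  rw [← div_lt_one hs]
  have := mul_pos hεpos' hNN
  linarith

/-- Multiplying the strict support inequalities at `θ` and at a nearby `φ` shows that `sin (φ - θ)`
and `sin (T φ - T θ)` have the same sign, so `T` is strictly increasing through each point.
Differentiability of `T` turns this into global monotonicity. -/
theorem IsRadial.strictMono_of_strictConvex (hH : IsRadial H R) (h : IsProfile R L)
    (hL : Differentiable ℝ L) (hK : StrictConvex ℝ {x | H x ≤ 1}) :
    StrictMono (tangentAngle L) := by
  set T := tangentAngle L with hT
  have hTc : Continuous T := h.continuous_tangentAngle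
  have hTd : Differentiable ℝ T := by
    have : T = fun θ => π / 2 + θ - arctan (L θ) := rfl
    rw [this]; exact (differentiable_id.const_add _).sub hL.arctan
  have key : ∀ θ, ∀ᶠ φ in 𝓝[≠] θ, 0 < (φ - θ) * (T φ - T θ) := by
    intro θ
    have c1 : ∀ᶠ φ in 𝓝 θ, 0 < sin (T θ - φ) :=
      (by fun_prop : ContinuousAt (fun φ => sin (T θ - φ)) θ).eventually_const_lt
        (sin_tangentAngle_sub_pos L θ)
    have c2 : ∀ᶠ φ in 𝓝 θ, 0 < sin (T φ - θ) :=
      (by fun_prop : ContinuousAt (fun φ => sin (T φ - θ)) θ).eventually_const_lt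
        (sin_tangentAngle_sub_pos L θ)
    have c3 : ∀ᶠ φ in 𝓝 θ, |φ - θ| < π :=
      (by fun_prop : ContinuousAt (fun φ => |φ - θ|) θ).eventually_lt_const (by simp [pi_pos])
    have c4 : ∀ᶠ φ in 𝓝 θ, |T φ - T θ| < π :=
      (by fun_prop : ContinuousAt (fun φ => |T φ - T θ|) θ).eventually_lt_const (by simp [pi_pos])
    have hall := (((c1.and c2).and (c3.and c4)).filter_mono
      (nhdsWithin_le_nhds : 𝓝[≠] θ ≤ 𝓝 θ)).and
      (self_mem_nhdsWithin : ∀ᶠ φ in 𝓝[≠] θ, φ ∈ ({θ}ᶜ : Set ℝ))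
    filter_upwards [hall] with φ hφ
    obtain ⟨⟨⟨h1, h2⟩, h3, h4⟩, hne⟩ := hφ
    have hne' : φ ≠ θ := hne
    have hpn : polar (R φ) φ ≠ polar (R θ) θ := by
      intro he
      have hcos : R φ * R θ * sin (φ - θ) = 0 := by
        have e0 : polar (R φ) φ 0 = polar (R θ) θ 0 := by rw [he]
        have e1 : polar (R φ) φ 1 = polar (R θ) θ 1 := by rw [he]
        simp only [polar_apply_zero, polar_apply_one] at e0 e1
        rw [sin_sub]
        linear_combination (R θ * cos θ) * e1 - (R θ * sin θ) * e0
      have hs0 : sin (φ - θ) = 0 := by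
        have := (mul_pos (h.pos φ) (h.pos θ)).ne'
        exact (mul_eq_zero.1 hcos).resolve_left this
      rw [abs_lt] at h3
      exact hne' (sub_eq_zero.1 ((sin_eq_zero_iff_of_lt_of_lt h3.1 h3.2).1 hs0))
    have a1 := hH.mul_sin_lt_of_strictConvex h hK hpn
    have a2 := hH.mul_sin_lt_of_strictConvex h hK hpn.symm
    have hmul := mul_lt_mul'' a1 a2 (mul_pos (h.pos φ) h1).le (mul_pos (h.pos θ) h2).le
    have hRR := mul_pos (h.pos φ) (h.pos θ)
    have hsin : 0 < sin (φ - θ) * sin (T φ - T θ) := by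
      have e : sin (φ - θ) * sin (T φ - T θ) =
          sin (T θ - θ) * sin (T φ - φ) - sin (T θ - φ) * sin (T φ - θ) := by
        simp only [sin_sub]
        ring
      rw [e]
      have : 0 < R φ * R θ * (sin (T θ - θ) * sin (T φ - φ) - sin (T θ - φ) * sin (T φ - θ)) := by
        have e1 : R φ * R θ * (sin (T θ - θ) * sin (T φ - φ) - sin (T θ - φ) * sin (T φ - θ)) =
          R θ * sin (T θ - θ) * (R φ * sin (T φ - φ)) -
          R φ * sin (T θ - φ) * (R θ * sin (T φ - θ)) := by ring
        rw [e1]; linarith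
      exact (mul_pos_iff_of_pos_left hRR).1 this
    rw [abs_lt] at h3 h4
    rcases lt_or_gt_of_ne hne' with hlt | hgt
    · have : sin (φ - θ) < 0 := sin_neg_of_neg_of_neg_pi_lt (by linarith) h3.1
      have hs2 : sin (T φ - T θ) < 0 := by nlinarith
      have : T φ - T θ < 0 := by
        by_contra hcon
        linarith [sin_nonneg_of_nonneg_of_le_pi (not_lt.1 hcon) h4.2.le]
      exact mul_pos_of_neg_of_neg (by linarith) this
    · have : 0 < sin (φ - θ) := sin_pos_of_pos_of_lt_pi (by linarith) h3.2
      have hs2 : 0 < sin (T φ - T θ) := (mul_pos_iff_of_pos_left this).1 hsin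
      have : 0 < T φ - T θ := by
        by_contra hcon
        linarith [sin_nonpos_of_nonpos_of_neg_pi_le (not_lt.1 hcon) h4.1.le]
      exact mul_pos (by linarith) this
  have hderiv : ∀ θ, 0 ≤ deriv T θ := by
    intro θ
    refine ge_of_tendsto (hasDerivAt_iff_tendsto_slope.1 (hTd θ).hasDerivAt) ?_
    filter_upwards [key θ] with φ hφ
    rw [slope_def_field]
    rcases lt_trichotomy (φ - θ) 0 with hlt | h0 | hgt
    · exact div_nonneg_of_nonpos (by nlinarith) hlt.le
    · rw [h0, div_zero]
    · exact div_nonneg (by nlinarith) hgt.le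
  have hmono : Monotone T := monotone_of_deriv_nonneg hTd hderiv
  intro a b hab
  refine lt_of_le_of_ne (hmono hab.le) fun he => ?_
  -- If `T a = T b`, monotonicity gives `T φ ≤ T a` for every `φ` in between, against the strict
  -- local growth to the right of `a`.
  have h1 : ∀ᶠ φ in 𝓝[>] a, 0 < (φ - a) * (T φ - T a) :=
    (key a).filter_mono (nhdsWithin_mono _ fun x (hx : a < x) => hx.ne')
  obtain ⟨φ, hφ1, hφ2⟩ := (h1.and (Ioo_mem_nhdsGT hab)).exists
  have : T φ ≤ T a := he ▸ hmono hφ2.2.le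
  nlinarith [hφ2.1]

/-! ### Uniform ellipticity -/

/-- The radial components cancel, so the normal moves only in the angular direction. The coefficient
`1 + L² - L'` obtained here is the curvature term on which ellipticity depends. -/
theorem IsProfile.hasDerivAt_gradient (h : IsProfile R L) {θ l : ℝ} (hL : HasDerivAt L l θ) :
    HasDerivAt (fun θ => polar (R θ * sin (tangentAngle L θ - θ))⁻¹ (tangentAngle L θ - π / 2))
      (((1 + L θ ^ 2 - l) / R θ) • polar 1 (θ + π / 2)) θ := by
  simp only [h.gradient_eq]
  have h1 := (h.hasDerivAt θ).fun_inv (h.pos θ).ne'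
  have h2 := hasDerivAt_polar 1 θ
  have h3 : HasDerivAt (fun t => polar 1 (t + π / 2)) (polar 1 (θ + π / 2 + π / 2)) θ :=
    (hasDerivAt_polar 1 (θ + π / 2)).comp_add_const θ (π / 2)
  refine (h1.fun_smul (h2.fun_sub (hL.fun_smul h3))).congr_deriv ?_
  have hR := (h.pos θ).ne'
  rw [show θ + π / 2 + π / 2 = θ + π by ring, polar_add_pi]
  match_scalars <;> field_simp <;> ring

/-- The gradient is homogeneous of degree zero, so the radial direction is in the kernel of the
Hessian; its action on the angular direction is the derivative of the normal along the circle of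
radius `ρ`. -/
theorem IsRadial.hessian (hH : IsRadial H R) (h : IsProfile R L) (h2 : ContDiffOn ℝ 2 H {0}ᶜ)
    {ρ θ l : ℝ} (hρ : 0 < ρ) (hL : HasDerivAt L l θ) (ζ : Plane) :
    fderiv ℝ (fderiv ℝ H) (polar ρ θ) ζ ζ =
      ⟪polar 1 (θ + π / 2), ζ⟫ ^ 2 * ((1 + L θ ^ 2 - l) / (R θ * ρ)) := by
  set N : ℝ → Plane := fun θ =>
    polar (R θ * sin (tangentAngle L θ - θ))⁻¹ (tangentAngle L θ - π / 2) with hN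
  have hF : ∀ {ρ : ℝ}, 0 < ρ → ∀ θ,
      fderiv ℝ H (polar ρ θ) = InnerProductSpace.toDual ℝ Plane (N θ) := fun hρ θ =>
    (hH.hasGradientAt h hρ θ).hasFDerivAt.fderiv
  have hdiff : DifferentiableAt ℝ (fderiv ℝ H) (polar ρ θ) :=
    ((h2.contDiffAt (isOpen_compl_singleton.mem_nhds (polar_ne_zero hρ θ))).fderiv_right
      (m := 1) (by norm_num)).differentiableAt one_ne_zero
  set B := fderiv ℝ (fderiv ℝ H) (polar ρ θ) with hB
  have hBd : HasFDerivAt (fderiv ℝ H) B (polar ρ θ) := hdiff.hasFDerivAt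
  have hB1 : B (polar 1 θ) = 0 := by
    have hc : HasDerivAt (fun t : ℝ => polar t θ) (polar 1 θ) ρ := by
      have : (fun t : ℝ => polar t θ) = fun t => t • polar 1 θ := by
        funext t; rw [smul_polar, mul_one]
      rw [this]; simpa using (hasDerivAt_id ρ).smul_const (polar 1 θ)
    have hcomp : HasDerivAt (fun t => fderiv ℝ H (polar t θ)) (B (polar 1 θ)) ρ :=
      HasFDerivAt.comp_hasDerivAt ρ hBd hc
    refine hcomp.unique ((hasDerivAt_const ρ
      (InnerProductSpace.toDual ℝ Plane (N θ))).congr_of_eventuallyEq ?_)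
    filter_upwards [lt_mem_nhds hρ] with t ht
    exact hF ht θ
  have hB2 : ∀ w, B (polar ρ (θ + π / 2)) w =
      ⟪((1 + L θ ^ 2 - l) / R θ) • polar 1 (θ + π / 2), w⟫ := fun w => by
    have hcomp : HasDerivAt (fun t => fderiv ℝ H (polar ρ t)) (B (polar ρ (θ + π / 2))) θ :=
      HasFDerivAt.comp_hasDerivAt θ hBd (hasDerivAt_polar ρ θ)
    have hcw : HasDerivAt (fun t => fderiv ℝ H (polar ρ t) w) (B (polar ρ (θ + π / 2)) w) θ := by
      simpa using hcomp.clm_apply (hasDerivAt_const θ w)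
    have hd2 : HasDerivAt (fun t => ⟪N t, w⟫)
        ⟪((1 + L θ ^ 2 - l) / R θ) • polar 1 (θ + π / 2), w⟫ θ := by
      exact ((h.hasDerivAt_gradient hL).inner ℝ (hasDerivAt_const θ w)).congr_deriv (by simp)
    simp only [hF hρ, InnerProductSpace.toDual_apply_apply] at hcw
    exact hcw.unique hd2
  have hζ : ζ = ⟪polar 1 θ, ζ⟫ • polar 1 θ +
      (⟪polar 1 (θ + π / 2), ζ⟫ / ρ) • polar ρ (θ + π / 2) := by
    have hsc := sin_sq_add_cos_sq θ
    apply plane_ext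
    · simp [inner_plane, cos_add_pi_div_two, sin_add_pi_div_two]
      field_simp
      linear_combination (-ζ 0) * hsc
    · simp [inner_plane, cos_add_pi_div_two, sin_add_pi_div_two]
      field_simp
      linear_combination (-ζ 1) * hsc
  have hBζ : B ζ ζ = (⟪polar 1 (θ + π / 2), ζ⟫ / ρ) *
      ⟪((1 + L θ ^ 2 - l) / R θ) • polar 1 (θ + π / 2), ζ⟫ := by
    have : B ζ = (⟪polar 1 (θ + π / 2), ζ⟫ / ρ) • B (polar ρ (θ + π / 2)) := by
      conv_lhs => rw [hζ]
      rw [map_add, map_smul, map_smul, hB1, smul_zero, zero_add]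
    rw [this, smul_apply, hB2, smul_eq_mul]
  rw [hBζ, inner_smul_left]
  simp only [conj_trivial]
  have hR := (h.pos θ).ne'
  field_simp

theorem Function.Periodic.of_hasDerivAt {f g : ℝ → ℝ} {c : ℝ} (hf : Function.Periodic f c)
    (hfg : ∀ x, HasDerivAt f (g x) x) : Function.Periodic g c := fun x => by
  have h1 : HasDerivAt (fun y => f (y + c)) (g (x + c)) x := (hfg (x + c)).comp_add_const x c
  rw [show (fun y => f (y + c)) = f from funext hf] at h1
  exact h1.unique (hfg x)

theorem norm_sq_eq_inner (θ : ℝ) (ζ : Plane) :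
    ‖ζ‖ ^ 2 = ⟪polar 1 θ, ζ⟫ ^ 2 + ⟪polar 1 (θ + π / 2), ζ⟫ ^ 2 := by
  rw [norm_sq_plane, inner_plane, inner_plane]
  simp only [polar_apply_zero, polar_apply_one, cos_add_pi_div_two, sin_add_pi_div_two]
  linear_combination (-(ζ 0) ^ 2 - (ζ 1) ^ 2) * sin_sq_add_cos_sq θ

/-- The tangent space at the boundary point `θ` is a line, on which the second fundamental form is a
multiple of the squared norm. The factor is continuous and `π`-periodic and has the sign of `1 + L²
- L'`, so by compactness pointwise positivity is a uniform bound. -/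
theorem IsRadial.uniformlyElliptic_iff (hH : IsRadial H R) (h : IsProfile R L)
    (h2 : ContDiffOn ℝ 2 H {0}ᶜ) (hL : ∀ θ, HasDerivAt L (L' θ) θ) (hL' : Continuous L') :
    UniformlyElliptic H ↔ ∀ θ, L' θ < 1 + L θ ^ 2 := by
  have hinner : ∀ θ ζ, ⟪polar (R θ * sin (tangentAngle L θ - θ))⁻¹ (tangentAngle L θ - π / 2), ζ⟫ =
      (R θ)⁻¹ * (⟪polar 1 θ, ζ⟫ - L θ * ⟪polar 1 (θ + π / 2), ζ⟫) := fun θ ζ => by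
    rw [h.gradient_eq, inner_smul_left, inner_sub_left, inner_smul_left]; simp
  have hNn : ∀ θ, ‖polar (R θ * sin (tangentAngle L θ - θ))⁻¹ (tangentAngle L θ - π / 2)‖ =
      (R θ * sin (tangentAngle L θ - θ))⁻¹ := fun θ =>
    norm_polar (inv_pos.2 (mul_pos (h.pos θ) (sin_tangentAngle_sub_pos L θ))).le _
  constructor
  · rintro ⟨l, hl, hU⟩ θ
    have hR := h.pos θ
    have hs := sin_tangentAngle_sub_pos L θ
    have := hU (polar (R θ) θ) (by
        rw [hH.frontier_unitBall h, mem_ofPred_eq, hH _ _ hR.le, div_self hR.ne'])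
      -- This is a tangent vector to the boundary at angle `θ`, written in the moving frame.
      (L θ • polar 1 θ + polar 1 (θ + π / 2))
      (by
        rw [(hH.hasGradientAt h hR θ).gradient, hinner]
        simp [inner_add_right, inner_smul_right, inner_polar, norm_polar])
    rw [secondFundamentalForm, hH.hessian h h2 hR (hL θ), (hH.hasGradientAt h hR θ).gradient, hNn,
      norm_sq_eq_inner θ] at this
    simp only [inner_add_right, inner_smul_right, inner_polar, add_sub_cancel_left, sub_self,
      cos_zero, sub_add_cancel_left, cos_neg, cos_pi_div_two, mul_zero, mul_one, add_zero,
      zero_add, one_pow, one_mul] at this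
    have hpos : 0 < l * (L θ ^ 2 + 1) := by positivity
    have h3 := hpos.trans_le this
    rw [div_inv_eq_mul] at h3
    have h4 : 0 < (1 + L θ ^ 2 - L' θ) / (R θ * R θ) := pos_of_mul_pos_left h3 (by positivity)
    have h5 := (div_pos_iff_of_pos_right (by positivity)).1 h4
    linarith
  · intro hlt
    -- The curvature of the boundary at angle `θ`: the angular Hessian coefficient, divided by the
    -- norm of the gradient and by the squared norm `1 + L²` of the tangent vector with unit angular
    -- component.
    set c : ℝ → ℝ := fun θ => (1 + L θ ^ 2 - L' θ) / (R θ * R θ) *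
      (R θ * sin (tangentAngle L θ - θ)) / (1 + L θ ^ 2) with hc
    have hLp := h.periodic_logDeriv
    have hLp' := hLp.of_hasDerivAt hL
    have hcp : Function.Periodic c π := fun θ => by
      simp only [hc, h.tangentAngle_add_pi, hLp θ, hLp' θ, h.periodic θ,
        add_sub_add_right_eq_sub]
    have hcc : Continuous c := by
      have c1 := h.continuous
      have c2 := h.continuous_radius
      have c3 := h.continuous_tangentAngle
      refine (((by fun_prop : Continuous fun θ => 1 + L θ ^ 2 - L' θ).div (c2.mul c2)
        fun θ => (mul_pos (h.pos θ) (h.pos θ)).ne').mul (by fun_prop)).div (by fun_prop)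
        fun θ => by positivity
    have hcpos : ∀ θ, 0 < c θ := fun θ => by
      have hR := h.pos θ
      have hs := sin_tangentAngle_sub_pos L θ
      have : 0 < 1 + L θ ^ 2 - L' θ := by linarith [hlt θ]
      simp only [hc]; positivity
    obtain ⟨_, ⟨⟨θ₀, rfl⟩, hmin⟩⟩ := (hcp.compact_of_continuous pi_ne_zero hcc).exists_isLeast
      (range_nonempty c)
    refine ⟨c θ₀, hcpos θ₀, fun ξ hξ ζ hζ => ?_⟩
    rw [hH.frontier_unitBall h, mem_ofPred_eq] at hξ
    obtain ⟨θ, hθ⟩ := exists_eq_polar ξ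
    have hR := h.pos θ
    have hρ : ‖ξ‖ = R θ := by
      rw [hθ, hH _ _ (norm_nonneg _), div_eq_one_iff_eq hR.ne'] at hξ; exact hξ
    rw [hρ] at hθ
    rw [hθ, (hH.hasGradientAt h hR θ).gradient, hinner] at hζ
    have hab : ⟪polar 1 θ, ζ⟫ = L θ * ⟪polar 1 (θ + π / 2), ζ⟫ := by
      have := (mul_eq_zero.1 hζ).resolve_left (inv_pos.2 hR).ne'
      linarith
    rw [hθ, secondFundamentalForm, hH.hessian h h2 hR (hL θ), (hH.hasGradientAt h hR θ).gradient,
      hNn, div_inv_eq_mul]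
    have hle : c θ₀ * ‖ζ‖ ^ 2 ≤ c θ * ‖ζ‖ ^ 2 :=
      mul_le_mul_of_nonneg_right (hmin ⟨θ, rfl⟩) (sq_nonneg _)
    refine hle.trans_eq ?_
    rw [norm_sq_eq_inner θ, hab]
    simp only [hc]
    field_simp
    ring
end

noncomputable section

open Filter Topology Real

/-! ### One-sided derivatives on the quarter -/

theorem uniqueDiffOn_quarter : UniqueDiffOn ℝ quarter := uniqueDiffOn_Icc (by positivity)

theorem isCompact_quarter : IsCompact quarter := isCompact_Icc

theorem zero_mem_quarter : (0 : ℝ) ∈ quarter := ⟨le_rfl, by positivity⟩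

theorem half_pi_mem_quarter : π / 2 ∈ quarter := ⟨by positivity, le_rfl⟩

theorem qDeriv_zero (r : ℝ → ℝ) : qDeriv 0 r = r := by
  funext θ; simp [qDeriv]

theorem ContDiffOn.hasDerivWithinAt_qDeriv {r : ℝ → ℝ} {n k : ℕ}
    (h : ContDiffOn ℝ n r quarter) (hk : k < n) {θ : ℝ} (hθ : θ ∈ quarter) :
    HasDerivWithinAt (qDeriv k r) (qDeriv (k + 1) r θ) quarter θ := by
  have h1 := h.differentiableOn_iteratedDerivWithin (m := k) (by exact_mod_cast hk)
    uniqueDiffOn_quarter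
  have h2 := (h1 θ hθ).hasDerivWithinAt
  rw [← iteratedDerivWithin_succ] at h2
  exact h2

theorem ContDiffOn.continuousOn_qDeriv {r : ℝ → ℝ} {n k : ℕ}
    (h : ContDiffOn ℝ n r quarter) (hk : k ≤ n) : ContinuousOn (qDeriv k r) quarter :=
  h.continuousOn_iteratedDerivWithin (by exact_mod_cast hk) uniqueDiffOn_quarter

/-- The logarithmic derivative `r' / r`. -/
def logDer (r : ℝ → ℝ) (η : ℝ) : ℝ := qDeriv 1 r η / r η

/-- The derivative of `r' / r`. -/
def logDerDeriv (r : ℝ → ℝ) (η : ℝ) : ℝ :=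
  (qDeriv 2 r η * r η - qDeriv 1 r η * qDeriv 1 r η) / r η ^ 2

/-- The derivative of `tau r`. -/
def tauDeriv (r : ℝ → ℝ) (η : ℝ) : ℝ := 1 - logDerDeriv r η / (1 + logDer r η ^ 2)

theorem tau_eq_tangentAngle (r : ℝ → ℝ) : tau r = tangentAngle (logDer r) := rfl

/-- The preimage under the inverse of a closed set is the image of a compact set, hence closed. -/
theorem continuousOn_invFunOn_of_isCompact {t : ℝ → ℝ} {s : Set ℝ} (hs : IsCompact s)
    (ht : ContinuousOn t s) (hinj : InjOn t s) :
    ContinuousOn (Function.invFunOn t s) (t '' s) := by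
  rw [continuousOn_iff_isClosed]
  intro C hC
  refine ⟨t '' (s ∩ C), ((hs.inter_right hC).image_of_continuousOn
    (ht.mono inter_subset_left)).isClosed, ?_⟩
  ext y
  constructor
  · rintro ⟨h1, ⟨x, hx, rfl⟩⟩
    refine ⟨⟨x, ⟨hx, ?_⟩, rfl⟩, ⟨x, hx, rfl⟩⟩
    rwa [mem_preimage, hinj.leftInvOn_invFunOn hx] at h1
  · rintro ⟨⟨x, ⟨hx, hxC⟩, rfl⟩, h2⟩
    refine ⟨?_, h2⟩
    rwa [mem_preimage, hinj.leftInvOn_invFunOn hx]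

/-- A mean value inequality of Cauchy type: `(m₀ + ε) * t - F` and `F - (m₀ - ε) * t` are monotone.
No division by `t'` occurs, so `t'` is allowed to vanish. -/
theorem norm_sub_le_of_deriv_mul {F t m t' : ℝ → ℝ} {a b m₀ ε : ℝ}
    (hF : ∀ x ∈ Icc a b, HasDerivWithinAt F (m x * t' x) (Icc a b) x)
    (ht : ∀ x ∈ Icc a b, HasDerivWithinAt t (t' x) (Icc a b) x)
    (ht' : ∀ x ∈ Icc a b, 0 ≤ t' x) (hm : ∀ x ∈ Icc a b, |m x - m₀| ≤ ε) (hab : a ≤ b) :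
    |F b - F a - m₀ * (t b - t a)| ≤ ε * (t b - t a) := by
  have key : ∀ c, (∀ x ∈ Icc a b, 0 ≤ (c - m x)) → F b - F a ≤ c * (t b - t a) := by
    intro c hc
    have hmono : MonotoneOn (fun x => c * t x - F x) (Icc a b) := by
      have hd : ∀ x ∈ Icc a b,
          HasDerivWithinAt (fun x => c * t x - F x) (c * t' x - m x * t' x) (Icc a b) x :=
        fun x hx => ((ht x hx).const_mul c).sub (hF x hx)
      refine monotoneOn_of_hasDerivWithinAt_nonneg (convex_Icc a b)
        (fun x hx => (hd x hx).continuousWithinAt)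
        (fun x hx => (hd x (interior_subset hx)).mono interior_subset) fun x hx => ?_
      have := mul_nonneg (hc x (interior_subset hx)) (ht' x (interior_subset hx))
      linarith
    have := hmono (left_mem_Icc.2 hab) (right_mem_Icc.2 hab) hab
    simp only at this
    linarith
  have key' : ∀ c, (∀ x ∈ Icc a b, 0 ≤ (m x - c)) → c * (t b - t a) ≤ F b - F a := by
    intro c hc
    have hmono : MonotoneOn (fun x => F x - c * t x) (Icc a b) := by
      have hd : ∀ x ∈ Icc a b,
          HasDerivWithinAt (fun x => F x - c * t x) (m x * t' x - c * t' x) (Icc a b) x :=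
        fun x hx => (hF x hx).sub ((ht x hx).const_mul c)
      refine monotoneOn_of_hasDerivWithinAt_nonneg (convex_Icc a b)
        (fun x hx => (hd x hx).continuousWithinAt)
        (fun x hx => (hd x (interior_subset hx)).mono interior_subset) fun x hx => ?_
      have := mul_nonneg (hc x (interior_subset hx)) (ht' x (interior_subset hx))
      linarith
    have := hmono (left_mem_Icc.2 hab) (right_mem_Icc.2 hab) hab
    simp only at this
    linarith
  have h1 := key (m₀ + ε) fun x hx => by linarith [(abs_le.1 (hm x hx)).2]
  have h2 := key' (m₀ - ε) fun x hx => by linarith [(abs_le.1 (hm x hx)).1]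
  rw [abs_le]
  constructor <;> linarith

/-- If `F = g ∘ t` on a compact interval, where `t` is injective with derivative `t' ≥ 0` and `F`
has derivative `m t'`, then `g` has derivative `m ∘ t⁻¹`. -/
theorem hasDerivWithinAt_of_comp {F t m t' g : ℝ → ℝ} {a b : ℝ}
    (hF : ∀ x ∈ Icc a b, HasDerivWithinAt F (m x * t' x) (Icc a b) x)
    (ht : ∀ x ∈ Icc a b, HasDerivWithinAt t (t' x) (Icc a b) x)
    (ht' : ∀ x ∈ Icc a b, 0 ≤ t' x) (hinj : InjOn t (Icc a b)) (hm : ContinuousOn m (Icc a b))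
    (hg : ∀ x ∈ Icc a b, g (t x) = F x) {x : ℝ} (hx : x ∈ Icc a b) :
    HasDerivWithinAt g (m x) (t '' Icc a b) (t x) := by
  have htc : ContinuousOn t (Icc a b) := fun y hy => (ht y hy).continuousWithinAt
  have hσ := continuousOn_invFunOn_of_isCompact isCompact_Icc htc hinj
  set σ := Function.invFunOn t (Icc a b)
  have hσl : ∀ y ∈ Icc a b, σ (t y) = y := fun y hy => hinj.leftInvOn_invFunOn hy
  rw [hasDerivWithinAt_iff_hasFDerivWithinAt, hasFDerivWithinAt_iff_isLittleO,
    Asymptotics.isLittleO_iff]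
  intro ε hε
  obtain ⟨δ, hδ, hδ'⟩ := Metric.continuousOn_iff.1 hm x hx ε hε
  -- The inverse is continuous, so for values close to `t x` the whole interval between the two
  -- parameters stays where `m` is within `ε` of `m x`, and the mean value inequality applies on it.
  have hev : ∀ᶠ y in 𝓝[t '' Icc a b] (t x), dist (σ y) x < δ := by
    have h1 : ContinuousWithinAt σ (t '' Icc a b) (t x) := hσ _ ⟨x, hx, rfl⟩
    have h2 := h1 (Metric.ball_mem_nhds _ hδ)
    rw [hσl x hx] at h2
    exact h2
  filter_upwards [hev, self_mem_nhdsWithin] with y hy hyt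
  obtain ⟨z, hz, rfl⟩ := hyt
  rw [hσl z hz] at hy
  have hsub : ∀ {p q}, p ∈ Icc a b → q ∈ Icc a b → Icc p q ⊆ Icc a b := fun hp hq =>
    Icc_subset_Icc hp.1 hq.2
  have gen : ∀ {p q}, p ∈ Icc a b → q ∈ Icc a b → dist p x < δ → dist q x < δ → p ≤ q →
      |F q - F p - m x * (t q - t p)| ≤ ε * (t q - t p) := by
    intro p q hp hq hpd hqd hpq
    refine norm_sub_le_of_deriv_mul (m := m) (t' := t')
      (fun w hw => (hF w (hsub hp hq hw)).mono (hsub hp hq))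
      (fun w hw => (ht w (hsub hp hq hw)).mono (hsub hp hq))
      (fun w hw => ht' w (hsub hp hq hw)) (fun w hw => ?_) hpq
    refine (hδ' w (hsub hp hq hw) ?_).le
    rw [Real.dist_eq, abs_lt] at hpd hqd ⊢
    exact ⟨by linarith [hw.1], by linarith [hw.2]⟩
  simp only [hg z hz, hg x hx, ContinuousLinearMap.toSpanSingleton_apply, smul_eq_mul,
    Real.norm_eq_abs]
  rcases le_total x z with hle | hle
  · have := gen hx hz (by simpa using hδ) hy hle
    rw [mul_comm (t z - t x)]
    exact this.trans (mul_le_mul_of_nonneg_left (le_abs_self _) hε.le)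
  · have := gen hz hx hy (by simpa using hδ) hle
    rw [mul_comm (t z - t x), ← abs_neg, abs_sub_comm (t z)]
    refine le_trans (le_of_eq ?_) (this.trans (mul_le_mul_of_nonneg_left (le_abs_self _) hε.le))
    ring_nf

/-! ### Gluing along translates of `[0, π/2]` and `[π/2, π]` -/

/-- Continuity, differentiability and Hölder continuity on an interval all survive concatenation and
translation by a period, so they need checking only on two arcs. Two consecutive periods are joined
so that `θ` is interior even when it is a multiple of `π`. -/
theorem exists_Icc_of_glue {P : ℝ → ℝ → Prop}
    (hunion : ∀ a b c, a ≤ b → b ≤ c → P a b → P b c → P a c)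
    (hadd : ∀ a b, P a b → P (a + π) (b + π)) (hsub : ∀ a b, P a b → P (a - π) (b - π))
    (h1 : P 0 (π / 2)) (h2 : P (π / 2) π) (θ : ℝ) : ∃ a b, a < θ ∧ θ < b ∧ P a b := by
  have hpi := pi_pos
  have h0 : P 0 π := hunion _ _ _ (by linarith) (by linarith) h1 h2
  have hz : ∀ k : ℤ, P (k * π) ((k + 1) * π) := by
    intro k
    induction k using Int.induction_on with
    | zero => simpa using h0
    | succ n ih =>
      have := hadd _ _ ih
      push_cast at this ⊢
      convert this using 1 <;> ring
    | pred n ih =>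
      have := hsub _ _ ih
      push_cast at this ⊢
      convert this using 1 <;> ring
  set k := ⌊θ / π⌋ with hk
  have f1 : (k : ℝ) * π ≤ θ := by rw [← le_div_iff₀ hpi]; exact Int.floor_le _
  have f2 : θ < (k + 1) * π := by rw [← div_lt_iff₀ hpi]; exact Int.lt_floor_add_one _
  have hprev := hz (k - 1)
  push_cast at hprev
  rw [sub_add_cancel] at hprev
  refine ⟨(k - 1) * π, (k + 1) * π, by linarith, f2, ?_⟩
  exact hunion _ _ _ (by linarith) (by linarith) hprev (hz k)

theorem continuous_of_glue {f : ℝ → ℝ} (hf : Function.Periodic f π)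
    (h1 : ContinuousOn f (Icc 0 (π / 2))) (h2 : ContinuousOn f (Icc (π / 2) π)) :
    Continuous f := by
  rw [continuous_iff_continuousAt]
  intro θ
  obtain ⟨a, b, ha, hb, hab⟩ := exists_Icc_of_glue (P := fun a b => ContinuousOn f (Icc a b))
    (fun a b c hab hbc h1 h2 => by
      rw [← Icc_union_Icc_eq_Icc hab hbc]
      exact h1.union_of_isClosed h2 isClosed_Icc isClosed_Icc)
    (fun a b h => by
      have hc : ContinuousOn (fun x => f (x - π)) (Icc (a + π) (b + π)) :=
        h.comp (by fun_prop) fun x hx => ⟨by linarith [hx.1], by linarith [hx.2]⟩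
      exact hc.congr fun x _ => (hf.sub_eq x).symm)
    (fun a b h => by
      have hc : ContinuousOn (fun x => f (x + π)) (Icc (a - π) (b - π)) :=
        h.comp (by fun_prop) fun x hx => ⟨by linarith [hx.1], by linarith [hx.2]⟩
      exact hc.congr fun x _ => (hf x).symm) h1 h2 θ
  exact hab.continuousAt (Icc_mem_nhds ha hb)

theorem hasDerivAt_of_glue {f g : ℝ → ℝ} (hf : Function.Periodic f π) (hg : Function.Periodic g π)
    (h1 : ∀ x ∈ Icc 0 (π / 2), HasDerivWithinAt f (g x) (Icc 0 (π / 2)) x)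
    (h2 : ∀ x ∈ Icc (π / 2) π, HasDerivWithinAt f (g x) (Icc (π / 2) π) x) (θ : ℝ) :
    HasDerivAt f (g θ) θ := by
  -- Outside the closed interval the derivative within it holds vacuously; this lets the union rule
  -- be applied at every point.
  have ext : ∀ {a b : ℝ}, (∀ x ∈ Icc a b, HasDerivWithinAt f (g x) (Icc a b) x) →
      ∀ x, HasDerivWithinAt f (g x) (Icc a b) x := by
    intro a b h x
    by_cases hx : x ∈ Icc a b
    · exact h x hx
    · exact HasFDerivWithinAt.of_notMem_closure (by rwa [isClosed_Icc.closure_eq])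
  obtain ⟨a, b, ha, hb, hab⟩ := exists_Icc_of_glue
    (P := fun a b => ∀ x ∈ Icc a b, HasDerivWithinAt f (g x) (Icc a b) x)
    (fun a b c hab hbc h1 h2 => by
      rw [← Icc_union_Icc_eq_Icc hab hbc]
      exact fun x _ => (ext h1 x).union (ext h2 x))
    (fun a b h x hx => by
      have hm : x - π ∈ Icc a b := ⟨by linarith [hx.1], by linarith [hx.2]⟩
      have hc := (h _ hm).scomp x ((hasDerivAt_id' x).sub_const π).hasDerivWithinAt
        (s := Icc (a + π) (b + π)) (show MapsTo (fun y => y - π) _ (Icc a b) from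
          fun y hy => ⟨by linarith [hy.1], by linarith [hy.2]⟩)
      rw [hg.sub_eq, one_smul] at hc
      exact hc.congr (fun y _ => (hf.sub_eq y).symm) (hf.sub_eq x).symm)
    (fun a b h x hx => by
      have hm : x + π ∈ Icc a b := ⟨by linarith [hx.1], by linarith [hx.2]⟩
      have hc := (h _ hm).scomp x ((hasDerivAt_id' x).add_const π).hasDerivWithinAt
        (s := Icc (a - π) (b - π)) (show MapsTo (fun y => y + π) _ (Icc a b) from
          fun y hy => ⟨by linarith [hy.1], by linarith [hy.2]⟩)
      rw [hg x, one_smul] at hc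
      exact hc.congr (fun y _ => (hf y).symm) (hf x).symm) h1 h2 θ
  exact (hab θ ⟨ha.le, hb.le⟩).hasDerivAt (Icc_mem_nhds ha hb)

/-! ### The angle `tau` of an admissible radius function -/

namespace IsAdmissible

variable {r : ℝ → ℝ}

theorem hasDerivWithinAt (h : IsAdmissible r) {η : ℝ} (hη : η ∈ quarter) :
    HasDerivWithinAt r (r η * logDer r η) quarter η := by
  have := ContDiffOn.hasDerivWithinAt_qDeriv (n := 2) (k := 0) h.contDiffOn (by norm_num) hη
  rw [qDeriv_zero] at this
  rwa [logDer, mul_div_cancel₀ _ (h.pos η hη).ne']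

theorem hasDerivWithinAt_logDer (h : IsAdmissible r) {η : ℝ} (hη : η ∈ quarter) :
    HasDerivWithinAt (logDer r) (logDerDeriv r η) quarter η := by
  have h0 := ContDiffOn.hasDerivWithinAt_qDeriv (n := 2) (k := 0) h.contDiffOn (by norm_num) hη
  have h1 := ContDiffOn.hasDerivWithinAt_qDeriv (n := 2) (k := 1) h.contDiffOn (by norm_num) hη
  rw [qDeriv_zero] at h0
  exact h1.div h0 (h.pos η hη).ne'

theorem hasDerivWithinAt_tau (h : IsAdmissible r) {η : ℝ} (hη : η ∈ quarter) :
    HasDerivWithinAt (tau r) (tauDeriv r η) quarter η := by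
  refine (((hasDerivWithinAt_id η quarter).const_add (π / 2)).sub
    (h.hasDerivWithinAt_logDer hη).arctan).congr_deriv ?_
  rw [tauDeriv]; ring

theorem continuousOn (h : IsAdmissible r) : ContinuousOn r quarter := h.contDiffOn.continuousOn

theorem continuousOn_logDer (h : IsAdmissible r) : ContinuousOn (logDer r) quarter :=
  fun _ hη => (h.hasDerivWithinAt_logDer hη).continuousWithinAt

theorem continuousOn_tau (h : IsAdmissible r) : ContinuousOn (tau r) quarter :=
  fun _ hη => (h.hasDerivWithinAt_tau hη).continuousWithinAt

theorem continuousOn_logDerDeriv (h : IsAdmissible r) : ContinuousOn (logDerDeriv r) quarter := by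
  have h1 := ContDiffOn.continuousOn_qDeriv (n := 2) (k := 1) h.contDiffOn (by norm_num)
  have h2 := ContDiffOn.continuousOn_qDeriv (n := 2) (k := 2) h.contDiffOn le_rfl
  exact ((h2.mul h.continuousOn).sub (h1.mul h1)).div (h.continuousOn.pow 2) fun η hη =>
    (pow_pos (h.pos η hη) 2).ne'

theorem continuousOn_tauDeriv (h : IsAdmissible r) : ContinuousOn (tauDeriv r) quarter :=
  continuousOn_const.sub (h.continuousOn_logDerDeriv.div
    (continuousOn_const.add (h.continuousOn_logDer.pow 2)) fun η _ => by positivity)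

theorem logDer_zero (h : IsAdmissible r) : logDer r 0 = 0 := by
  rw [logDer, h.boundary.deriv_zero, zero_div]

theorem logDer_half_pi (h : IsAdmissible r) : logDer r (π / 2) = 0 := by
  rw [logDer, h.boundary.deriv_half_pi, zero_div]

theorem tau_zero (h : IsAdmissible r) : tau r 0 = π / 2 := by
  rw [tau_eq_tangentAngle, tangentAngle, h.logDer_zero]; simp

theorem tau_half_pi (h : IsAdmissible r) : tau r (π / 2) = π := by
  rw [tau_eq_tangentAngle, tangentAngle, h.logDer_half_pi]; simp

end IsAdmissible

theorem curvatureIneq_iff {r : ℝ → ℝ} {η : ℝ} (hr : 0 < r η) :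
    CurvatureIneq r η ↔ logDerDeriv r η < 1 + logDer r η ^ 2 := by
  rw [CurvatureIneq, logDerDeriv, logDer, div_lt_iff₀ (by positivity), add_mul, div_pow,
    div_mul_cancel₀ _ (by positivity)]
  constructor <;> intro h <;> nlinarith

theorem tauDeriv_pos_iff {r : ℝ → ℝ} {η : ℝ} :
    0 < tauDeriv r η ↔ logDerDeriv r η < 1 + logDer r η ^ 2 := by
  rw [tauDeriv, sub_pos, div_lt_one (by positivity)]

namespace IsAdmissible

variable {r : ℝ → ℝ}

/-- The derivative of `tau` is continuous and almost everywhere positive, so its integral over any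
nontrivial interval is positive. An almost everywhere inequality is enough because the increment is
an integral. -/
theorem strictMonoOn_tau (h : IsAdmissible r) : StrictMonoOn (tau r) quarter := by
  intro a ha b hb hab
  have hsub : Icc a b ⊆ quarter := Icc_subset_Icc ha.1 hb.2
  have hFTC : ∫ x in a..b, tauDeriv r x = tau r b - tau r a := by
    refine intervalIntegral.integral_eq_sub_of_hasDerivAt_of_le hab.le
      (h.continuousOn_tau.mono hsub) (fun x hx => ?_)
      ((h.continuousOn_tauDeriv.mono hsub).intervalIntegrable_of_Icc hab.le)
    have hxq : x ∈ quarter := hsub (Ioo_subset_Icc_self hx)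
    exact (h.hasDerivWithinAt_tau hxq).hasDerivAt
      (Icc_mem_nhds (ha.1.trans_lt hx.1) (hx.2.trans_le hb.2))
  have hae : ∀ᵐ x ∂(volume.restrict (Ioc a b)), 0 < tauDeriv r x := by
    have h1 : ∀ᵐ x ∂(volume.restrict (Ioc a b)), CurvatureIneq r x :=
      ae_restrict_of_ae_restrict_of_subset (Ioc_subset_Icc_self.trans hsub) h.ineq
    filter_upwards [h1, ae_restrict_mem measurableSet_Ioc] with x hx hx'
    exact tauDeriv_pos_iff.2 ((curvatureIneq_iff (h.pos x (hsub (Ioc_subset_Icc_self hx')))).1 hx)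
  have hpos : 0 < ∫ x in a..b, tauDeriv r x := by
    rw [intervalIntegral.integral_of_le hab.le]
    have hint : IntegrableOn (tauDeriv r) (Ioc a b) :=
      ((h.continuousOn_tauDeriv.mono hsub).integrableOn_Icc).mono_set Ioc_subset_Icc_self
    rw [integral_pos_iff_support_of_nonneg_ae (hae.mono fun x hx => hx.le) hint]
    have hfull : (volume.restrict (Ioc a b)) (Function.support (tauDeriv r))ᶜ = 0 := by
      refine measure_mono_null (fun x hx => ?_) (ae_iff.1 hae)
      have h0 : tauDeriv r x = 0 := by simpa using hx
      simp [h0]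
    have htot : (volume.restrict (Ioc a b)) univ ≠ 0 := by
      simp [hab]
    by_contra hcon
    have h0 : (volume.restrict (Ioc a b)) (Function.support (tauDeriv r)) = 0 := by
      simpa using hcon
    apply htot
    rw [← union_compl_self (Function.support (tauDeriv r))]
    exact measure_union_null h0 hfull
  linarith

theorem tauDeriv_nonneg (h : IsAdmissible r) {η : ℝ} (hη : η ∈ quarter) : 0 ≤ tauDeriv r η := by
  rw [← (h.hasDerivWithinAt_tau hη).derivWithin (uniqueDiffOn_quarter η hη)]
  exact h.strictMonoOn_tau.monotoneOn.derivWithin_nonneg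

theorem image_tau (h : IsAdmissible r) : tau r '' quarter = Icc (π / 2) π := by
  refine subset_antisymm ?_ ?_
  · rintro _ ⟨η, hη, rfl⟩
    have h1 := h.strictMonoOn_tau.monotoneOn zero_mem_quarter hη hη.1
    have h2 := h.strictMonoOn_tau.monotoneOn hη half_pi_mem_quarter hη.2
    rw [h.tau_zero] at h1
    rw [h.tau_half_pi] at h2
    exact ⟨h1, h2⟩
  · have := intermediate_value_Icc (by positivity : (0 : ℝ) ≤ π / 2) h.continuousOn_tau
    rwa [h.tau_zero, h.tau_half_pi] at this

theorem bijOn_tau (h : IsAdmissible r) : BijOn (tau r) quarter (Icc (π / 2) π) := by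
  rw [← h.image_tau]; exact h.strictMonoOn_tau.injOn.bijOn_image

end IsAdmissible

/-! ### Periodic extension by reflection -/

open Classical in
/-- The `π`-periodic function equal to `A` on `[0, π/2]` and to `B ∘ τ⁻¹` on `(π/2, π)`. -/
def reflExt (r A B : ℝ → ℝ) (θ : ℝ) : ℝ :=
  if toIcoMod pi_pos 0 θ ≤ π / 2 then A (toIcoMod pi_pos 0 θ)
  else B (Function.invFunOn (tau r) quarter (toIcoMod pi_pos 0 θ))

theorem rTilde_eq_reflExt (r : ℝ → ℝ) : rTilde r = reflExt r r (reflectedRadius r) := rfl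

theorem periodic_reflExt (r A B : ℝ → ℝ) : Function.Periodic (reflExt r A B) π := fun θ => by
  rw [reflExt, toIcoMod_add_right]; rfl

theorem reflExt_of_mem (r A B : ℝ → ℝ) {θ : ℝ} (hθ : θ ∈ quarter) : reflExt r A B θ = A θ := by
  have h1 : toIcoMod pi_pos 0 θ = θ :=
    (toIcoMod_eq_self pi_pos).2 ⟨hθ.1, by linarith [hθ.2, pi_pos]⟩
  rw [reflExt, h1, if_pos hθ.2]

theorem rTilde_of_mem {r : ℝ → ℝ} {θ : ℝ} (hθ : θ ∈ quarter) : rTilde r θ = r θ :=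
  reflExt_of_mem _ _ _ hθ

namespace IsAdmissible

variable {r A B A' B' : ℝ → ℝ}

/-- The definition uses the first branch at `π/2 = tau r 0`, and also at `π = tau r (π/2)`, which is
reduced to `0`. The two hypotheses say that the branches agree at these corners. -/
theorem reflExt_tau (h : IsAdmissible r) (h0 : A (π / 2) = B 0) (h1 : A 0 = B (π / 2)) {η : ℝ}
    (hη : η ∈ quarter) : reflExt r A B (tau r η) = B η := by
  have hmono := h.strictMonoOn_tau
  rcases hη.1.eq_or_lt with rfl | hpos
  · rw [h.tau_zero, reflExt_of_mem _ _ _ half_pi_mem_quarter, h0]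
  rcases hη.2.eq_or_lt with rfl | hlt
  · have := periodic_reflExt r A B 0
    rw [zero_add] at this
    rw [h.tau_half_pi, this, reflExt_of_mem _ _ _ zero_mem_quarter, h1]
  have a1 := hmono zero_mem_quarter hη hpos
  have a2 := hmono hη half_pi_mem_quarter hlt
  rw [h.tau_zero] at a1
  rw [h.tau_half_pi] at a2
  have e : toIcoMod pi_pos 0 (tau r η) = tau r η :=
    (toIcoMod_eq_self pi_pos).2 ⟨by linarith [pi_pos], by linarith⟩
  rw [reflExt, e, if_neg a1.not_ge, hmono.injOn.leftInvOn_invFunOn hη]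

theorem reflExt_eq_comp_inv (h : IsAdmissible r) (h0 : A (π / 2) = B 0) (h1 : A 0 = B (π / 2))
    {θ : ℝ} (hθ : θ ∈ Icc (π / 2) π) :
    reflExt r A B θ = B (Function.invFunOn (tau r) quarter θ) := by
  rw [← h.image_tau] at hθ
  obtain ⟨η, hη, rfl⟩ := hθ
  rw [h.reflExt_tau h0 h1 hη, h.strictMonoOn_tau.injOn.leftInvOn_invFunOn hη]

theorem continuousOn_inv_tau (h : IsAdmissible r) :
    ContinuousOn (Function.invFunOn (tau r) quarter) (Icc (π / 2) π) := by
  rw [← h.image_tau]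
  exact continuousOn_invFunOn_of_isCompact isCompact_quarter h.continuousOn_tau
    h.strictMonoOn_tau.injOn

theorem inv_tau_mem (h : IsAdmissible r) {θ : ℝ} (hθ : θ ∈ Icc (π / 2) π) :
    Function.invFunOn (tau r) quarter θ ∈ quarter := by
  rw [← h.image_tau] at hθ
  exact Function.invFunOn_mem hθ

theorem continuous_reflExt (h : IsAdmissible r) (h0 : A (π / 2) = B 0) (h1 : A 0 = B (π / 2))
    (hA : ContinuousOn A quarter) (hB : ContinuousOn B quarter) : Continuous (reflExt r A B) :=
  continuous_of_glue (periodic_reflExt r A B)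
    (hA.congr fun _ hθ => reflExt_of_mem r A B hθ)
    ((hB.comp h.continuousOn_inv_tau fun _ hθ => h.inv_tau_mem hθ).congr
      fun _ hθ => h.reflExt_eq_comp_inv h0 h1 hθ)

/-- On the second arc `B'` is the derivative of `B` with respect to `tau`, not to `η`: the
derivative in `η` carries the factor `tauDeriv`, and no differentiability of the inverse of `tau` is
needed. -/
theorem hasDerivAt_reflExt (h : IsAdmissible r) (h0 : A (π / 2) = B 0) (h1 : A 0 = B (π / 2))
    (h0' : A' (π / 2) = B' 0) (h1' : A' 0 = B' (π / 2))
    (hA : ∀ η ∈ quarter, HasDerivWithinAt A (A' η) quarter η)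
    (hB : ∀ η ∈ quarter, HasDerivWithinAt B (B' η * tauDeriv r η) quarter η)
    (hB' : ContinuousOn B' quarter) (θ : ℝ) :
    HasDerivAt (reflExt r A B) (reflExt r A' B' θ) θ := by
  refine hasDerivAt_of_glue (periodic_reflExt r A B) (periodic_reflExt r A' B') ?_ ?_ θ
  · intro x hx
    rw [reflExt_of_mem r A' B' hx]
    exact (hA x hx).congr (fun _ hθ => reflExt_of_mem r A B hθ) (reflExt_of_mem r A B hx)
  · intro x hx
    rw [← h.image_tau] at hx ⊢
    obtain ⟨η, hη, rfl⟩ := hx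
    rw [h.reflExt_tau h0' h1' hη]
    exact hasDerivWithinAt_of_comp hB (fun x hx => h.hasDerivWithinAt_tau hx)
      (fun x hx => h.tauDeriv_nonneg hx) h.strictMonoOn_tau.injOn hB'
      (fun x hx => h.reflExt_tau h0 h1 hx) hη

/-- The reflected radius is `r* / (r * cos (arctan (r'/r)))`; taking the logarithm gives the
derivative `-L + L L' / (1 + L²)`, that is `-L` times `tauDeriv`. -/
theorem hasDerivWithinAt_reflectedRadius (h : IsAdmissible r) {η : ℝ} (hη : η ∈ quarter) :
    HasDerivWithinAt (reflectedRadius r)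
      (-(reflectedRadius r η * logDer r η) * tauDeriv r η) quarter η := by
  have h0 := ContDiffOn.hasDerivWithinAt_qDeriv (n := 2) (k := 0) h.contDiffOn (by norm_num) hη
  have h1 := ContDiffOn.hasDerivWithinAt_qDeriv (n := 2) (k := 1) h.contDiffOn (by norm_num) hη
  rw [qDeriv_zero] at h0
  have hr := h.pos η hη
  have hD : 0 < r η ^ 2 + qDeriv 1 r η ^ 2 := by positivity
  have hS := sqrt_pos.2 hD
  have hS2 := sq_sqrt hD.le
  refine ((((h0.fun_pow 2).fun_add (h1.fun_pow 2)).sqrt hD.ne').const_mul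
    (r (π / 2)) |>.fun_div (h0.fun_pow 2) (by positivity)).congr_deriv ?_
  simp only [reflectedRadius, logDer, tauDeriv, logDerDeriv]
  set S := √(r η ^ 2 + qDeriv 1 r η ^ 2)
  have hD2 : 1 + (qDeriv 1 r η / r η) ^ 2 = S ^ 2 / r η ^ 2 := by rw [hS2]; field_simp
  rw [hD2]
  have hS3 : S ^ 2 - r η ^ 2 - qDeriv 1 r η ^ 2 = 0 := by rw [hS2]; ring
  field_simp
  norm_num
  linear_combination (-2 * r (π / 2) * qDeriv 1 r η * r η) * hS3

theorem half_pi_pos (h : IsAdmissible r) : 0 < r (π / 2) := h.pos _ half_pi_mem_quarter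

theorem reflectedRadius_zero (h : IsAdmissible r) : r (π / 2) = reflectedRadius r 0 := by
  simp [reflectedRadius, h.boundary.at_zero, h.boundary.deriv_zero]

theorem reflectedRadius_half_pi (h : IsAdmissible r) : r 0 = reflectedRadius r (π / 2) := by
  have := h.half_pi_pos
  simp only [reflectedRadius, h.boundary.at_zero, h.boundary.deriv_half_pi]
  rw [zero_pow two_ne_zero, add_zero, sqrt_sq this.le]
  field_simp

theorem reflectedRadius_pos (h : IsAdmissible r) {η : ℝ} (hη : η ∈ quarter) :
    0 < reflectedRadius r η := by
  have h1 := h.pos η hη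
  have h2 := h.half_pi_pos
  unfold reflectedRadius
  positivity

theorem rTilde_tau (h : IsAdmissible r) {η : ℝ} (hη : η ∈ quarter) :
    rTilde r (tau r η) = reflectedRadius r η :=
  h.reflExt_tau h.reflectedRadius_zero h.reflectedRadius_half_pi hη

end IsAdmissible

/-- Every angle is, up to a multiple of `π`, in `[0, π/2]` or in `[π/2, π]`. -/
theorem IsAdmissible.induction_mod_pi {r : ℝ → ℝ} (h : IsAdmissible r) {p : ℝ → Prop}
    (hp : ∀ θ, p (θ + π) ↔ p θ) (h1 : ∀ θ ∈ quarter, p θ) (h2 : ∀ η ∈ quarter, p (tau r η))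
    (θ : ℝ) : p θ := by
  have hper : Function.Periodic p π := fun θ => propext (hp θ)
  obtain ⟨y, hy, hpy⟩ := hper.exists_mem_Ico₀ pi_pos θ
  rw [hpy]
  rcases le_total y (π / 2) with hle | hle
  · exact h1 y ⟨hy.1, hle⟩
  · have : y ∈ tau r '' quarter := by rw [h.image_tau]; exact ⟨hle, hy.2.le⟩
    obtain ⟨η, hη, rfl⟩ := this
    exact h2 η hη

/-- The logarithmic derivative of `rTilde r`. -/
def logDerTilde (r : ℝ → ℝ) : ℝ → ℝ := reflExt r (logDer r) (fun η => -logDer r η)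

theorem logDerTilde_of_mem {r : ℝ → ℝ} {θ : ℝ} (hθ : θ ∈ quarter) :
    logDerTilde r θ = logDer r θ := reflExt_of_mem _ _ _ hθ

theorem tangentAngle_logDerTilde {r : ℝ → ℝ} {θ : ℝ} (hθ : θ ∈ quarter) :
    tangentAngle (logDerTilde r) θ = tau r θ := by
  rw [tangentAngle, logDerTilde_of_mem hθ]; rfl

/-! ### The reflected curve as a profile, and its identity `T ∘ T = id + π` -/

namespace IsAdmissible

variable {r : ℝ → ℝ}

theorem logDerTilde_tau (h : IsAdmissible r) {η : ℝ} (hη : η ∈ quarter) :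
    logDerTilde r (tau r η) = -logDer r η :=
  h.reflExt_tau (by simp [h.logDer_zero, h.logDer_half_pi])
    (by simp [h.logDer_zero, h.logDer_half_pi]) hη

theorem rTilde_pos (h : IsAdmissible r) (θ : ℝ) : 0 < rTilde r θ := by
  refine h.induction_mod_pi (p := fun θ => 0 < rTilde r θ) (fun θ => ?_) (fun θ hθ => ?_)
    (fun η hη => ?_) θ
  · rw [rTilde_eq_reflExt, periodic_reflExt]
  · rw [rTilde_of_mem hθ]; exact h.pos θ hθ
  · rw [h.rTilde_tau hη]; exact h.reflectedRadius_pos hη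

theorem isProfile (h : IsAdmissible r) : IsProfile (rTilde r) (logDerTilde r) where
  pos := h.rTilde_pos
  periodic := periodic_reflExt r _ _
  hasDerivAt θ := by
    have hd := h.hasDerivAt_reflExt h.reflectedRadius_zero h.reflectedRadius_half_pi
      (A' := fun η => r η * logDer r η) (B' := fun η => -(reflectedRadius r η * logDer r η))
      (by simp [h.logDer_zero, h.logDer_half_pi]) (by simp [h.logDer_zero, h.logDer_half_pi])
      (fun η hη => h.hasDerivWithinAt hη) (fun η hη => h.hasDerivWithinAt_reflectedRadius hη)
      ((ContinuousOn.mul (fun η hη => (h.hasDerivWithinAt_reflectedRadius hη).continuousWithinAt)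
        h.continuousOn_logDer).neg) θ
    refine hd.congr_deriv ?_
    refine h.induction_mod_pi (p := fun θ => reflExt r (fun η => r η * logDer r η)
      (fun η => -(reflectedRadius r η * logDer r η)) θ = rTilde r θ * logDerTilde r θ)
      (fun θ => ?_) (fun θ hθ => ?_) (fun η hη => ?_) θ
    · rw [periodic_reflExt, logDerTilde, periodic_reflExt, rTilde_eq_reflExt, periodic_reflExt]
    · rw [reflExt_of_mem _ _ _ hθ, rTilde_of_mem hθ, logDerTilde_of_mem hθ]
    · rw [h.reflExt_tau (by simp [h.logDer_zero, h.logDer_half_pi])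
        (by simp [h.logDer_zero, h.logDer_half_pi]) hη, h.rTilde_tau hη, h.logDerTilde_tau hη]
      ring
  continuous := h.continuous_reflExt (by simp [h.logDer_zero, h.logDer_half_pi])
    (by simp [h.logDer_zero, h.logDer_half_pi]) h.continuousOn_logDer h.continuousOn_logDer.neg

/-- The logarithmic derivative changes sign under the reflection and `arctan` is odd, so the two
`arctan` terms cancel. -/
theorem tangentAngle_tau (h : IsAdmissible r) {η : ℝ} (hη : η ∈ quarter) :
    tangentAngle (logDerTilde r) (tau r η) = η + π := by
  rw [tangentAngle, h.logDerTilde_tau hη, arctan_neg, tau_eq_tangentAngle, tangentAngle]; ring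

theorem tangentAngle_tangentAngle (h : IsAdmissible r) (θ : ℝ) :
    tangentAngle (logDerTilde r) (tangentAngle (logDerTilde r) θ) = θ + π := by
  have hadd := h.isProfile.tangentAngle_add_pi
  refine h.induction_mod_pi (p := fun θ => tangentAngle (logDerTilde r)
    (tangentAngle (logDerTilde r) θ) = θ + π) (fun θ => ?_) (fun θ hθ => ?_) (fun η hη => ?_) θ
  · rw [hadd, hadd, add_left_inj]
  · rw [tangentAngle_logDerTilde hθ, h.tangentAngle_tau hθ]
  · rw [h.tangentAngle_tau hη, hadd, tangentAngle_logDerTilde hη]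

/-- No derivative is used: `T ∘ T = id + π` makes `T` injective, a continuous injective function on
the line is strictly monotone, and `T π = T 0 + π` excludes a decreasing one. -/
theorem strictMono_tangentAngle (h : IsAdmissible r) :
    StrictMono (tangentAngle (logDerTilde r)) := by
  have hc := h.isProfile.continuous_tangentAngle
  have hinj : Function.Injective (tangentAngle (logDerTilde r)) := fun a b hab => by
    have := congrArg (tangentAngle (logDerTilde r)) hab
    rw [h.tangentAngle_tangentAngle, h.tangentAngle_tangentAngle] at this
    linarith
  rcases hc.strictMono_of_inj hinj with hm | ha
  · exact hm
  · exfalso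
    have := ha pi_pos
    have h2 := h.isProfile.tangentAngle_add_pi 0
    rw [zero_add] at h2
    linarith [pi_pos]

end IsAdmissible

theorem HTilde_isRadial {r : ℝ → ℝ} (h : IsAdmissible r) : IsRadial (HTilde r) (rTilde r) := by
  intro ρ θ hρ
  rcases hρ.eq_or_lt with rfl | hpos
  · simp [HTilde, polar_zero]
  have e : (⟨polar ρ θ 0, polar ρ θ 1⟩ : ℂ) = ρ * (Complex.cos θ + Complex.sin θ * Complex.I) := by
    apply Complex.ext <;> simp [Complex.cos_ofReal_re, Complex.sin_ofReal_re]
  have hper : Function.Periodic (rTilde r) (2 * π) := by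
    have := h.isProfile.periodic.nat_mul 2; simpa using this
  rw [HTilde, norm_polar hρ, e, Complex.arg_mul_cos_add_sin_mul_I_eq_toIocMod hpos]
  congr 1
  rw [toIocMod]
  exact hper.sub_zsmul_eq _
end

noncomputable section

open Filter Topology Real

/-! ### Polar sets, rotations and homotheties -/

theorem mem_polarSet_iff {Q : ℝ → ℝ} (hQ : Function.Periodic Q (2 * π)) {x : Plane} :
    x ∈ polarSet Q ↔ ∃ θ ρ : ℝ, 0 ≤ ρ ∧ ρ ≤ Q θ ∧ x = polar ρ θ := by
  constructor
  · rintro ⟨θ, -, ρ, hρ, rfl⟩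
    exact ⟨θ, ρ, hρ.1, hρ.2, rfl⟩
  · rintro ⟨θ, ρ, h0, h1, rfl⟩
    obtain ⟨k, hk, -⟩ := existsUnique_add_zsmul_mem_Ico (two_pi_pos) θ 0
    rw [zero_add] at hk
    refine ⟨θ + k • (2 * π), ⟨hk.1, hk.2.le⟩, ρ, ⟨h0, ?_⟩, ?_⟩
    · rw [hQ.zsmul k θ]; exact h1
    · rw [zsmul_eq_mul]
      apply plane_ext
      · rw [polar_apply_zero, polar_apply_zero, cos_add_int_mul_two_pi]
      · rw [polar_apply_one, polar_apply_one, sin_add_int_mul_two_pi]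

theorem polar_mem_polarSet_iff {Q : ℝ → ℝ} (hQ : Function.Periodic Q (2 * π)) {s θ : ℝ}
    (hs : 0 < s) : polar s θ ∈ polarSet Q ↔ s ≤ Q θ := by
  rw [mem_polarSet_iff hQ]
  constructor
  · rintro ⟨ψ, ρ, h0, h1, he⟩
    have hρ : ρ = s := by rw [← norm_polar h0 ψ, ← he, norm_polar hs.le]
    have hc : cos (θ - ψ) = 1 := by
      have h2 := inner_polar s θ ρ ψ
      rw [← he, real_inner_self_eq_norm_sq, norm_polar hs.le, hρ] at h2
      have h3 : s * s * (cos (θ - ψ) - 1) = 0 := by linarith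
      have := (mul_eq_zero.1 h3).resolve_left (by positivity)
      linarith
    obtain ⟨n, hn⟩ := (cos_eq_one_iff _).1 hc
    have : θ = ψ + n • (2 * π) := by rw [zsmul_eq_mul]; linarith
    rw [this, hQ.zsmul n ψ, ← hρ]
    exact h1
  · intro h
    exact ⟨θ, s, hs.le, h, rfl⟩

theorem polarSet_injective {P Q : ℝ → ℝ} (hP : Function.Periodic P (2 * π))
    (hQ : Function.Periodic Q (2 * π)) (hP0 : ∀ θ, 0 < P θ) (hQ0 : ∀ θ, 0 < Q θ)
    (h : polarSet P = polarSet Q) : P = Q := by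
  funext θ
  apply le_antisymm
  · rw [← polar_mem_polarSet_iff hQ (hP0 θ), ← h, polar_mem_polarSet_iff hP (hP0 θ)]
  · rw [← polar_mem_polarSet_iff hP (hQ0 θ), h, polar_mem_polarSet_iff hQ (hQ0 θ)]

theorem smul_rot_polar (c φ ρ θ : ℝ) : c • rot φ (polar ρ θ) = polar (c * ρ) (θ + φ) := by
  apply plane_ext
  · simp [rot, cos_add]; ring
  · simp [rot, sin_add]; ring

theorem image_polarSet {Q : ℝ → ℝ} (hQ : Function.Periodic Q (2 * π)) {c : ℝ} (hc : 0 < c)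
    (φ : ℝ) : (fun x : Plane => c • rot φ x) '' polarSet Q = polarSet fun θ => c * Q (θ - φ) := by
  have hQ' : Function.Periodic (fun θ => c * Q (θ - φ)) (2 * π) := fun θ => by
    simp only [show θ + 2 * π - φ = θ - φ + 2 * π by ring, hQ (θ - φ)]
  ext x
  rw [mem_polarSet_iff hQ']
  constructor
  · rintro ⟨y, hy, rfl⟩
    obtain ⟨θ, ρ, h0, h1, rfl⟩ := (mem_polarSet_iff hQ).1 hy
    refine ⟨θ + φ, c * ρ, by positivity, ?_, smul_rot_polar _ _ _ _⟩
    rw [add_sub_cancel_right]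
    exact mul_le_mul_of_nonneg_left h1 hc.le
  · rintro ⟨θ, ρ, h0, h1, rfl⟩
    refine ⟨polar (ρ / c) (θ - φ), (mem_polarSet_iff hQ).2
      ⟨θ - φ, ρ / c, by positivity, (div_le_iff₀' hc).2 h1, rfl⟩, ?_⟩
    simp only [smul_rot_polar, sub_add_cancel, mul_div_cancel₀ _ (ne_of_gt hc)]

/-! ### Radon profiles -/

namespace IsProfile

variable {R L L' L'' : ℝ → ℝ}

theorem periodic_two_pi (h : IsProfile R L) : Function.Periodic R (2 * π) := h.add_two_pi

theorem rescale (h : IsProfile R L) {c : ℝ} (hc : 0 < c) (a : ℝ) :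
    IsProfile (fun θ => c * R (θ + a)) (fun θ => L (θ + a)) where
  pos θ := mul_pos hc (h.pos _)
  periodic θ := by simp only [show θ + π + a = θ + a + π by ring, h.periodic (θ + a)]
  hasDerivAt θ := by
    refine (((h.hasDerivAt (θ + a)).comp_add_const θ a).const_mul c).congr_deriv ?_
    ring
  continuous := h.continuous.comp (by fun_prop)

theorem tangentAngle_shift (L : ℝ → ℝ) (a θ : ℝ) :
    tangentAngle (fun θ => L (θ + a)) θ = tangentAngle L (θ + a) - a := by
  unfold tangentAngle; ring

theorem strictMono_shift (hT : StrictMono (tangentAngle L)) (a : ℝ) :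
    StrictMono (tangentAngle fun θ => L (θ + a)) := fun x y hxy => by
  rw [tangentAngle_shift, tangentAngle_shift]
  have := hT (add_lt_add_left hxy a)
  linarith

theorem tangentAngle_tangentAngle_shift
    (hTT : ∀ θ, tangentAngle L (tangentAngle L θ) = θ + π) (a θ : ℝ) :
    tangentAngle (fun θ => L (θ + a)) (tangentAngle (fun θ => L (θ + a)) θ) = θ + π := by
  rw [tangentAngle_shift, tangentAngle_shift, sub_add_cancel, hTT]; ring

theorem logDeriv_eq_zero_of_min (h : IsProfile R L) {θ₀ : ℝ} (hmin : ∀ θ, R θ₀ ≤ R θ) :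
    L θ₀ = 0 := by
  have := IsLocalMin.hasDerivAt_eq_zero (Eventually.of_forall hmin) (h.hasDerivAt θ₀)
  exact (mul_eq_zero.1 this).resolve_left (h.pos θ₀).ne'

/-- In `T (T θ) = θ + π` the two `arctan` terms must add up to zero, and `arctan` is odd and
injective. -/
theorem logDeriv_tangentAngle (hTT : ∀ θ, tangentAngle L (tangentAngle L θ) = θ + π) (θ : ℝ) :
    L (tangentAngle L θ) = -L θ := by
  have h1 := hTT θ
  rw [tangentAngle] at h1
  apply arctan_injective
  rw [arctan_neg]
  have h2 : tangentAngle L θ = π / 2 + θ - arctan (L θ) := rfl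
  linarith

theorem tangentAngle_zero (h0 : L 0 = 0) : tangentAngle L 0 = π / 2 := by
  rw [tangentAngle, h0]; simp

theorem logDeriv_half_pi (hTT : ∀ θ, tangentAngle L (tangentAngle L θ) = θ + π) (h0 : L 0 = 0) :
    L (π / 2) = 0 := by
  have := logDeriv_tangentAngle hTT 0
  rwa [tangentAngle_zero h0, h0, neg_zero] at this

theorem hasDerivAt_tangentAngle (hL : ∀ θ, HasDerivAt L (L' θ) θ) (θ : ℝ) :
    HasDerivAt (tangentAngle L) (1 - L' θ / (1 + L θ ^ 2)) θ := by
  refine (((hasDerivAt_id' θ).const_add (π / 2)).fun_sub (hL θ).arctan).congr_deriv ?_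
  ring

theorem deriv_mul_deriv (hL : ∀ θ, HasDerivAt L (L' θ) θ)
    (hTT : ∀ θ, tangentAngle L (tangentAngle L θ) = θ + π) (θ : ℝ) :
    (1 - L' (tangentAngle L θ) / (1 + L (tangentAngle L θ) ^ 2)) * (1 - L' θ / (1 + L θ ^ 2)) =
      1 := by
  have h1 := (hasDerivAt_tangentAngle hL (tangentAngle L θ)).comp θ (hasDerivAt_tangentAngle hL θ)
  have h2 : tangentAngle L ∘ tangentAngle L = fun θ => θ + π := funext hTT
  rw [h2] at h1
  exact h1.unique ((hasDerivAt_id' θ).add_const π)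

/-- Monotonicity alone gives `T' ≥ 0`; the chain rule identity `T' (T θ) * T' θ = 1` excludes zero.
Thus for a Radon curve with differentiable `L` the strict inequality holds at every angle. -/
theorem logDeriv_deriv_lt (hL : ∀ θ, HasDerivAt L (L' θ) θ) (hT : StrictMono (tangentAngle L))
    (hTT : ∀ θ, tangentAngle L (tangentAngle L θ) = θ + π) (θ : ℝ) : L' θ < 1 + L θ ^ 2 := by
  have h1 : 0 ≤ 1 - L' θ / (1 + L θ ^ 2) := by
    rw [← (hasDerivAt_tangentAngle hL θ).deriv]
    exact hT.monotone.deriv_nonneg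
  have h2 : 1 - L' θ / (1 + L θ ^ 2) ≠ 0 := fun h0 => by
    have := deriv_mul_deriv hL hTT θ
    rw [h0, mul_zero] at this
    exact zero_ne_one this
  have h3 := lt_of_le_of_ne h1 h2.symm
  rwa [sub_pos, div_lt_one (by positivity)] at h3

theorem strictMono_of_deriv_lt (hL : ∀ θ, HasDerivAt L (L' θ) θ) (hlt : ∀ θ, L' θ < 1 + L θ ^ 2) :
    StrictMono (tangentAngle L) := by
  refine strictMono_of_deriv_pos fun θ => ?_
  rw [(hasDerivAt_tangentAngle hL θ).deriv, sub_pos, div_lt_one (by positivity)]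
  exact hlt θ

theorem qDeriv_one (h : IsProfile R L) {θ : ℝ} (hθ : θ ∈ quarter) : qDeriv 1 R θ = R θ * L θ := by
  rw [qDeriv, iteratedDerivWithin_one]
  exact (h.hasDerivAt θ).hasDerivWithinAt.derivWithin (uniqueDiffOn_quarter θ hθ)

theorem qDeriv_two (h : IsProfile R L) (hL : ∀ θ, HasDerivAt L (L' θ) θ) {θ : ℝ}
    (hθ : θ ∈ quarter) : qDeriv 2 R θ = R θ * (L θ ^ 2 + L' θ) := by
  rw [qDeriv, iteratedDerivWithin_succ]
  have h1 : HasDerivWithinAt (fun θ => R θ * L θ) (R θ * L θ * L θ + R θ * L' θ) quarter θ :=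
    ((h.hasDerivAt θ).fun_mul (hL θ)).hasDerivWithinAt
  have h2 := h1.congr (fun x hx => h.qDeriv_one hx) (h.qDeriv_one hθ)
  refine (h2.derivWithin (uniqueDiffOn_quarter θ hθ)).trans ?_
  ring

theorem qDeriv_three (h : IsProfile R L) (hL : ∀ θ, HasDerivAt L (L' θ) θ)
    (hL' : ∀ θ, HasDerivAt L' (L'' θ) θ) {θ : ℝ} (hθ : θ ∈ quarter) :
    qDeriv 3 R θ = R θ * (L θ * (L θ ^ 2 + L' θ) + 2 * L θ * L' θ + L'' θ) := by
  rw [qDeriv, iteratedDerivWithin_succ]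
  have h1 := (((h.hasDerivAt θ).fun_mul (((hL θ).fun_pow 2).fun_add (hL' θ)))).hasDerivWithinAt
    (s := quarter)
  have h2 := h1.congr (fun x hx => h.qDeriv_two hL hx) (h.qDeriv_two hL hθ)
  refine (h2.derivWithin (uniqueDiffOn_quarter θ hθ)).trans ?_
  norm_num
  ring

theorem curvatureIneq_iff (h : IsProfile R L) (hL : ∀ θ, HasDerivAt L (L' θ) θ) {θ : ℝ}
    (hθ : θ ∈ quarter) : CurvatureIneq R θ ↔ L' θ < 1 + L θ ^ 2 := by
  have hR := h.pos θ
  have e : CurvatureIneq R θ ↔ R θ ^ 2 * L' θ < R θ ^ 2 * (1 + L θ ^ 2) := by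
    rw [CurvatureIneq, h.qDeriv_one hθ, h.qDeriv_two hL hθ]
    constructor <;> intro h <;> linarith
  rw [e, mul_lt_mul_iff_right₀ (by positivity)]

theorem boundaryConditions (h : IsProfile R L)
    (hTT : ∀ θ, tangentAngle L (tangentAngle L θ) = θ + π) (h0 : L 0 = 0) (hR0 : R 0 = 1)
    (hR1 : 1 ≤ R (π / 2)) : BoundaryConditions R where
  at_zero := hR0
  one_le := hR1
  deriv_zero := by rw [h.qDeriv_one zero_mem_quarter, h0, mul_zero]
  deriv_half_pi := by
    rw [h.qDeriv_one half_pi_mem_quarter, logDeriv_half_pi hTT h0, mul_zero]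

theorem isAdmissible (h : IsProfile R L) (hR : ContDiff ℝ 2 R) (hL : ∀ θ, HasDerivAt L (L' θ) θ)
    (hT : StrictMono (tangentAngle L)) (hTT : ∀ θ, tangentAngle L (tangentAngle L θ) = θ + π)
    (h0 : L 0 = 0) (hR0 : R 0 = 1) (hR1 : 1 ≤ R (π / 2)) : IsAdmissible R where
  pos θ _ := h.pos θ
  contDiffOn := hR.contDiffOn
  ineq := by
    filter_upwards [ae_restrict_mem measurableSet_Icc] with θ hθ
    exact (h.curvatureIneq_iff hL hθ).2 (logDeriv_deriv_lt hL hT hTT θ)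
  boundary := h.boundaryConditions hTT h0 hR0 hR1

/-- A profile whose tangent angle `T` satisfies `T ∘ T = id + π` is the reflection of its
restriction to the first quadrant. -/
theorem rTilde_eq (h : IsProfile R L) (hadm : IsAdmissible R)
    (hTT : ∀ θ, tangentAngle L (tangentAngle L θ) = θ + π)
    (hL : ∀ θ, HasDerivAt L (L' θ) θ) : rTilde R = R := by
  have hlog : ∀ η ∈ quarter, logDer R η = L η := fun η hη => by
    rw [logDer, h.qDeriv_one hη, mul_div_cancel_left₀ _ (h.pos η).ne']
  have htau : ∀ η ∈ quarter, tau R η = tangentAngle L η := fun η hη => by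
    rw [tau_eq_tangentAngle, tangentAngle, hlog η hη]; rfl
  have htd : ∀ η ∈ quarter, tauDeriv R η = 1 - L' η / (1 + L η ^ 2) := fun η hη => by
    have h1 := hadm.hasDerivWithinAt_tau hη
    have h2 := ((hasDerivAt_tangentAngle hL η).hasDerivWithinAt (s := quarter)).congr htau
      (htau η hη)
    exact (uniqueDiffOn_quarter η hη).eq_deriv _ h1 h2
  -- Numerator and denominator both have logarithmic derivative `-L T'`, so the ratio is constant;
  -- at `η = 0` both equal `R (π/2)`.
  set f : ℝ → ℝ := fun η => R (tangentAngle L η) / reflectedRadius R η with hf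
  have hfd : ∀ η ∈ quarter, HasDerivWithinAt f 0 quarter η := by
    intro η hη
    have h1 : HasDerivAt (fun η => R (tangentAngle L η)) _ η :=
      (h.hasDerivAt (tangentAngle L η)).comp η (hasDerivAt_tangentAngle hL η)
    refine (h1.hasDerivWithinAt.fun_div (hadm.hasDerivWithinAt_reflectedRadius hη)
      (hadm.reflectedRadius_pos hη).ne').congr_deriv ?_
    rw [logDeriv_tangentAngle hTT, htd η hη, hlog η hη]
    rw [div_eq_zero_iff]; left; ring
  have hconst := constant_of_derivWithin_zero (f := f) (a := 0) (b := π / 2)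
    (fun η hη => (hfd η hη).differentiableWithinAt)
    (fun η hη => (hfd η (Ico_subset_Icc_self hη)).derivWithin
      (uniqueDiffOn_quarter η (Ico_subset_Icc_self hη)))
  have hone : ∀ η ∈ quarter, R (tangentAngle L η) = reflectedRadius R η := by
    intro η hη
    have h1 := hconst η hη
    have hz := hadm.half_pi_pos
    have h2 : f 0 = 1 := by
      simp only [hf]
      rw [← hadm.reflectedRadius_zero, ← htau 0 zero_mem_quarter, hadm.tau_zero, div_self hz.ne']
    rw [h2] at h1
    exact (div_eq_one_iff_eq (hadm.reflectedRadius_pos hη).ne').1 h1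
  funext θ
  refine hadm.induction_mod_pi (p := fun θ => rTilde R θ = R θ) (fun θ => ?_)
    (fun θ hθ => rTilde_of_mem hθ) (fun η hη => ?_) θ
  · rw [hadm.isProfile.periodic, h.periodic]
  · rw [hadm.rTilde_tau hη, htau η hη, hone η hη]

/-- At `0`, the identity `(T' ∘ T) * T' = 1` and its derivative give `L'` and `L''` at `T 0 = π/2`
in terms of their values at `0`. As `L` vanishes at both angles, `R'' = R L'` and `R''' = R L''`
there. -/
theorem matchingConditions (h : IsProfile R L) (hL : ∀ θ, HasDerivAt L (L' θ) θ)
    (hL' : ∀ θ, HasDerivAt L' (L'' θ) θ)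
    (hTT : ∀ θ, tangentAngle L (tangentAngle L θ) = θ + π) (h0 : L 0 = 0) (hR0 : R 0 = 1) :
    MatchingConditions R := by
  have hπ := logDeriv_half_pi hTT h0
  have hT0 := tangentAngle_zero h0
  have e1 := deriv_mul_deriv hL hTT 0
  rw [hT0, h0, hπ] at e1
  norm_num at e1
  have hd : ∀ θ, HasDerivAt (fun θ => 1 - L' θ / (1 + L θ ^ 2)) _ θ := fun θ =>
    ((hL' θ).fun_div (((hL θ).fun_pow 2).const_add 1) (by positivity)).const_sub 1
  have hprod := ((hd (tangentAngle L 0)).comp 0 (hasDerivAt_tangentAngle hL 0)).fun_mul (hd 0)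
  have hone : (fun θ => ((fun θ => 1 - L' θ / (1 + L θ ^ 2)) ∘ tangentAngle L) θ *
      (1 - L' θ / (1 + L θ ^ 2))) = fun _ => (1 : ℝ) := funext fun θ => deriv_mul_deriv hL hTT θ
  rw [hone] at hprod
  have e2 := hprod.unique (hasDerivAt_const 0 (1 : ℝ))
  simp only [Function.comp, hT0, h0, hπ] at e2
  norm_num at e2
  have hne : 1 - L' 0 ≠ 0 := fun hz => by rw [hz, mul_zero] at e1; exact zero_ne_one e1
  have q20 := h.qDeriv_two hL zero_mem_quarter
  have q2π := h.qDeriv_two hL half_pi_mem_quarter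
  have q30 := h.qDeriv_three hL hL' zero_mem_quarter
  have q3π := h.qDeriv_three hL hL' half_pi_mem_quarter
  simp only [h0, hπ, hR0] at q20 q2π q30 q3π
  norm_num at q20 q2π q30 q3π
  have hL1 : L' (π / 2) = -(L' 0 / (1 - L' 0)) := by field_simp; linarith
  have hL2 : L'' (π / 2) = -(L'' 0 / (1 - L' 0) ^ 3) := by
    have : 1 - L' (π / 2) = (1 - L' 0)⁻¹ := by rw [hL1]; field_simp; ring
    rw [this] at e2
    field_simp at e2 ⊢
    linarith
  refine ⟨?_, ?_⟩
  · rw [q2π, q20, hL1]; ring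
  · rw [q3π, q30, q20, hL2]; ring

end IsProfile

/-! ### Anisotropies whose ball is a reflection -/

variable {H : Plane → ℝ} {R L : ℝ → ℝ}

theorem IsRadial.ballIsReflectionOf (hH : IsRadial H R) (h : IsProfile R L) {c a : ℝ} (hc : 0 < c)
    (hr : rTilde (fun θ => c * R (θ + a)) = fun θ => c * R (θ + a)) :
    BallIsReflectionOf H fun θ => c * R (θ + a) := by
  refine ⟨-a, c, hc, ?_⟩
  rw [hH.closure_unitBall h, hH.setOf_le_one h, image_polarSet h.periodic_two_pi hc, hr]
  simp only [sub_neg_eq_add]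

/-- Rotation and homothety act on the polar radius by a shift and a factor, and a polar set
determines its positive periodic radius. -/
theorem IsRadial.exists_rescale_of_ballIsReflectionOf (hH : IsRadial H R) (h : IsProfile R L)
    {r : ℝ → ℝ} (hr : IsAdmissible r) (hb : BallIsReflectionOf H r) :
    ∃ c φ : ℝ, 0 < c ∧ R = fun θ => c * rTilde r (θ + φ) := by
  obtain ⟨φ, c, hc, he⟩ := hb
  rw [hH.closure_unitBall h, hH.setOf_le_one h, image_polarSet h.periodic_two_pi hc] at he
  have hp : Function.Periodic (fun θ => c * R (θ - φ)) (2 * π) := fun θ => by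
    simp only [show θ + 2 * π - φ = θ - φ + 2 * π by ring, h.periodic_two_pi (θ - φ)]
  have := polarSet_injective hp hr.isProfile.periodic_two_pi (fun θ => mul_pos hc (h.pos _))
    hr.rTilde_pos he
  refine ⟨c⁻¹, φ, inv_pos.2 hc, ?_⟩
  funext θ
  rw [← this]
  simp only [add_sub_cancel_right]
  field_simp
end

noncomputable section

open Filter Topology Real

/-! ### Hölder functions -/

theorem holderOnWith_iff_dist {X Y : Type*} [PseudoMetricSpace X] [PseudoMetricSpace Y] {C α : ℝ≥0}
    {f : X → Y} {s : Set X} :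
    HolderOnWith C α f s ↔ ∀ x ∈ s, ∀ y ∈ s, dist (f x) (f y) ≤ C * dist x y ^ (α : ℝ) := by
  refine forall₄_congr fun x _ y _ => ?_
  rw [edist_nndist, edist_nndist, ← ENNReal.coe_rpow_of_nonneg _ α.coe_nonneg, ← ENNReal.coe_mul,
    ENNReal.coe_le_coe, ← NNReal.coe_le_coe]
  simp

theorem holderOnWith_isometry_comp_iff {X Y Z : Type*} [PseudoMetricSpace X] [PseudoMetricSpace Y]
    [PseudoMetricSpace Z] {C α : ℝ≥0} {φ : Y → Z} (hφ : Isometry φ) {f : X → Y} {s : Set X} :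
    HolderOnWith C α (φ ∘ f) s ↔ HolderOnWith C α f s := by
  simp only [HolderOnWith, Function.comp, hφ.edist_eq]

theorem exists_holderOnWith_of_dist {X Y : Type*} [PseudoMetricSpace X] [PseudoMetricSpace Y]
    {α : ℝ≥0} {f : X → Y} {s : Set X} {C : ℝ}
    (h : ∀ x ∈ s, ∀ y ∈ s, dist (f x) (f y) ≤ C * dist x y ^ (α : ℝ)) :
    ∃ C : ℝ≥0, HolderOnWith C α f s := by
  refine ⟨C.toNNReal, holderOnWith_iff_dist.2 fun x hx y hy => (h x hx y hy).trans ?_⟩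
  exact mul_le_mul_of_nonneg_right (le_coe_toNNReal C) (by positivity)

section Algebra

variable {X : Type*} [PseudoMetricSpace X] {α : ℝ≥0} {s t : Set X}
  {F G W : Type*} [NormedAddCommGroup F] [NormedSpace ℝ F] [NormedAddCommGroup G]
  [NormedSpace ℝ G] [NormedAddCommGroup W] [NormedSpace ℝ W]

theorem exists_holderOnWith_add {F : Type*} [SeminormedAddCommGroup F] {f g : X → F}
    (hf : ∃ C : ℝ≥0, HolderOnWith C α f s) (hg : ∃ C : ℝ≥0, HolderOnWith C α g s) :
    ∃ C : ℝ≥0, HolderOnWith C α (fun x => f x + g x) s := by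
  obtain ⟨C, hC⟩ := hf
  obtain ⟨D, hD⟩ := hg
  rw [holderOnWith_iff_dist] at hC hD
  refine exists_holderOnWith_of_dist (C := C + D) fun x hx y hy => ?_
  rw [add_mul]
  exact (dist_add_add_le _ _ _ _).trans (add_le_add (hC x hx y hy) (hD x hx y hy))

theorem exists_holderOnWith_bilinear (B : F →L[ℝ] G →L[ℝ] W) {f : X → F} {g : X → G} {M N : ℝ}
    (hf : ∃ C : ℝ≥0, HolderOnWith C α f s) (hg : ∃ C : ℝ≥0, HolderOnWith C α g s)
    (hM : ∀ x ∈ s, ‖f x‖ ≤ M) (hN : ∀ x ∈ s, ‖g x‖ ≤ N) :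
    ∃ C : ℝ≥0, HolderOnWith C α (fun x => B (f x) (g x)) s := by
  obtain ⟨C, hC⟩ := hf
  obtain ⟨D, hD⟩ := hg
  rw [holderOnWith_iff_dist] at hC hD
  refine exists_holderOnWith_of_dist (C := ‖B‖ * M * D + ‖B‖ * C * N) fun x hx y hy => ?_
  have e : B (f x) (g x) - B (f y) (g y) = B (f x) (g x - g y) + B (f x - f y) (g y) := by
    simp
  have h1 := hC x hx y hy
  have h2 := hD x hx y hy
  rw [dist_eq_norm] at h1 h2 ⊢
  have hM0 : 0 ≤ M := (norm_nonneg _).trans (hM x hx)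
  rw [e]
  set d := dist x y ^ (α : ℝ)
  have hd : 0 ≤ d := by positivity
  calc ‖B (f x) (g x - g y) + B (f x - f y) (g y)‖
      ≤ ‖B‖ * ‖f x‖ * ‖g x - g y‖ + ‖B‖ * ‖f x - f y‖ * ‖g y‖ :=
        (norm_add_le _ _).trans (add_le_add (B.le_opNorm₂ _ _) (B.le_opNorm₂ _ _))
    _ ≤ ‖B‖ * M * (D * d) + ‖B‖ * (C * d) * N := by
        gcongr
        · exact hM x hx
        · exact hN y hy
    _ = (‖B‖ * M * D + ‖B‖ * C * N) * d := by ring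

theorem exists_holderOnWith_clm_comp (A : F →L[ℝ] G) {f : X → F}
    (hf : ∃ C : ℝ≥0, HolderOnWith C α f s) : ∃ C : ℝ≥0, HolderOnWith C α (fun x => A (f x)) s := by
  obtain ⟨C, hC⟩ := hf
  rw [holderOnWith_iff_dist] at hC
  refine exists_holderOnWith_of_dist (C := ‖A‖ * C) fun x hx y hy => ?_
  rw [dist_eq_norm, ← map_sub, mul_assoc]
  refine (A.le_opNorm _).trans (mul_le_mul_of_nonneg_left ?_ (norm_nonneg _))
  rw [← dist_eq_norm]
  exact hC x hx y hy

/-- Boundedness is needed to absorb the factor `d ^ (1 - α)` of `d = d ^ (1 - α) * d ^ α`. -/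
theorem exists_holderOnWith_of_lipschitzOnWith {F : Type*} [PseudoMetricSpace F] (hα : α ≤ 1)
    {f : X → F} {K : ℝ≥0}
    (hf : LipschitzOnWith K f s) (hs : Bornology.IsBounded s) :
    ∃ C : ℝ≥0, HolderOnWith C α f s := by
  obtain ⟨D, hD⟩ := Metric.isBounded_iff.1 hs
  refine exists_holderOnWith_of_dist (C := K * |D| ^ (1 - α : ℝ)) fun x hx y hy => ?_
  have h1 := hf.dist_le_mul x hx y hy
  refine h1.trans ?_
  rw [mul_assoc]
  refine mul_le_mul_of_nonneg_left ?_ K.2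
  rcases (dist_nonneg (x := x) (y := y)).eq_or_lt with h0 | h0
  · rw [← h0]; positivity
  have hα' : (0 : ℝ) ≤ 1 - α := by
    have : (α : ℝ) ≤ 1 := by exact_mod_cast hα
    linarith
  calc dist x y = dist x y ^ (1 - α : ℝ) * dist x y ^ (α : ℝ) := by
        rw [← rpow_add h0]; simp
    _ ≤ |D| ^ (1 - α : ℝ) * dist x y ^ (α : ℝ) := by
        gcongr
        exact (hD hx hy).trans (le_abs_self D)

end Algebra

/-- `f` is `α`-Hölder near every point of `s`. -/
def LocHolder {X Y : Type*} [PseudoMetricSpace X] [PseudoMetricSpace Y] (α : ℝ≥0) (f : X → Y)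
    (s : Set X) : Prop := ∀ x ∈ s, ∃ U ∈ 𝓝 x, ∃ C : ℝ≥0, HolderOnWith C α f U

theorem LocHolder.continuousAt {X Y : Type*} [PseudoMetricSpace X] [PseudoMetricSpace Y] {α : ℝ≥0}
    {f : X → Y} {s : Set X} (hα : 0 < α) (h : LocHolder α f s) {x : X} (hx : x ∈ s) :
    ContinuousAt f x := by
  obtain ⟨U, hU, C, hC⟩ := h x hx
  exact (hC.continuousOn hα).continuousAt hU

theorem LocHolder.congr {X Y : Type*} [PseudoMetricSpace X] [PseudoMetricSpace Y] {α : ℝ≥0}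
    {f g : X → Y} {s : Set X} (hs : IsOpen s) (hf : LocHolder α f s)
    (h : ∀ x ∈ s, g x = f x) : LocHolder α g s := fun x hx => by
  obtain ⟨U, hU, C, hC⟩ := hf x hx
  refine ⟨U ∩ s, inter_mem hU (hs.mem_nhds hx), C, fun y hy z hz => ?_⟩
  rw [h y hy.2, h z hz.2]
  exact hC y hy.1 z hz.1

/-- A locally Hölder function is Hölder on compact sets. -/
theorem LocHolder.exists_holderOnWith {X Y : Type*} [PseudoMetricSpace X] [PseudoMetricSpace Y]
    {α : ℝ≥0} {f : X → Y} {s K : Set X} (hα : 0 < α) (h : LocHolder α f s) (hK : IsCompact K)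
    (hKs : K ⊆ s) : ∃ C : ℝ≥0, HolderOnWith C α f K := by
  have hf : ContinuousOn f K := fun x hx => (h.continuousAt hα (hKs hx)).continuousWithinAt
  choose! U hU C hC using h
  obtain ⟨t, htK, ht⟩ := hK.elim_nhds_subcover (fun x => interior (U x)) fun x hx =>
    interior_mem_nhds.2 (hU x (hKs hx))
  obtain ⟨δ, hδ, hδ'⟩ := lebesgue_number_lemma_of_metric (c := fun x : t => interior (U x)) hK
    (fun x => isOpen_interior) (by simpa [iUnion_subtype] using ht)
  obtain ⟨M, hM⟩ := Metric.isBounded_iff.1 (hK.image_of_continuousOn hf).isBounded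
  set S : ℝ := ∑ x ∈ t, (C x : ℝ)
  have hS : ∀ x ∈ t, (C x : ℝ) ≤ S := fun x hx =>
    Finset.single_le_sum (f := fun x => (C x : ℝ)) (fun y _ => (C y).2) hx
  have hS0 : 0 ≤ S := Finset.sum_nonneg fun y _ => (C y).2
  refine exists_holderOnWith_of_dist (C := S + |M| / δ ^ (α : ℝ)) fun x hx y hy => ?_
  have hd : 0 ≤ dist x y ^ (α : ℝ) := by positivity
  rw [add_mul]
  -- Below the Lebesgue number both points lie in a common neighbourhood of the cover; above it the
  -- oscillation bound `|M|` suffices, at the cost of dividing by `δ ^ α`.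
  rcases lt_or_ge (dist x y) δ with hlt | hge
  · obtain ⟨i, hi⟩ := hδ' x hx
    have hxi := interior_subset (hi (Metric.mem_ball_self hδ))
    have hyi := interior_subset (hi (Metric.mem_ball'.2 hlt))
    have h1 := holderOnWith_iff_dist.1 (hC i (hKs (htK i i.2))) x hxi y hyi
    have h2 := mul_le_mul_of_nonneg_right (hS i i.2) hd
    have h3 : 0 ≤ |M| / δ ^ (α : ℝ) * dist x y ^ (α : ℝ) := by positivity
    linarith
  · have h1 : dist (f x) (f y) ≤ |M| :=
      (hM (mem_image_of_mem f hx) (mem_image_of_mem f hy)).trans (le_abs_self M)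
    have h2 : δ ^ (α : ℝ) ≤ dist x y ^ (α : ℝ) := rpow_le_rpow hδ.le hge α.2
    have h3 : |M| ≤ |M| / δ ^ (α : ℝ) * dist x y ^ (α : ℝ) := by
      rw [div_mul_eq_mul_div, le_div_iff₀ (by positivity)]
      exact mul_le_mul_of_nonneg_left h2 (abs_nonneg M)
    have h4 := mul_nonneg hS0 hd
    linarith

/-! ### The classes `C^{k,α}` on open sets -/

section HolderClass

variable {E : Type} [NormedAddCommGroup E] [NormedSpace ℝ E]

/-- Functions that are `k` times differentiable near the points of `s`, with a locally `α`-Hölder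
`k`-th derivative. -/
def HolderClass (α : ℝ≥0) : ℕ → ∀ {F : Type} [NormedAddCommGroup F] [NormedSpace ℝ F],
    (E → F) → Set E → Prop
  | 0, _, _, _, f, s => LocHolder α f s
  | k + 1, _, _, _, f, s => DifferentiableOn ℝ f s ∧ HolderClass α k (fderiv ℝ f) s

variable {F G W : Type} [NormedAddCommGroup F] [NormedSpace ℝ F] [NormedAddCommGroup G]
  [NormedSpace ℝ G] [NormedAddCommGroup W] [NormedSpace ℝ W] {α : ℝ≥0} {k : ℕ} {s : Set E}
  {t : Set F}

theorem HolderClass.congr {f g : E → F} (hs : IsOpen s) (hf : HolderClass α k f s)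
    (h : ∀ x ∈ s, g x = f x) : HolderClass α k g s := by
  induction k generalizing F with
  | zero => exact LocHolder.congr hs hf h
  | succ k ih =>
    refine ⟨hf.1.congr h, ih hf.2 fun x hx => ?_⟩
    exact Filter.EventuallyEq.fderiv_eq (eventually_of_mem (hs.mem_nhds hx) h)

theorem LocHolder.of_contDiffOn_one (hα : α ≤ 1) {f : E → F} (hs : IsOpen s)
    (hf : ContDiffOn ℝ 1 f s) : LocHolder α f s := fun x hx => by
  obtain ⟨K, t, ht, hK⟩ := (hf.contDiffAt (hs.mem_nhds hx)).exists_lipschitzOnWith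
  exact ⟨t ∩ Metric.ball x 1, inter_mem ht (Metric.ball_mem_nhds _ one_pos),
    exists_holderOnWith_of_lipschitzOnWith hα (hK.mono inter_subset_left)
      (Metric.isBounded_ball.subset inter_subset_right)⟩

theorem HolderClass.of_contDiffOn (hα : α ≤ 1) {f : E → F} (hs : IsOpen s)
    (hf : ContDiffOn ℝ (k + 1 : ℕ) f s) : HolderClass α k f s := by
  induction k generalizing F with
  | zero => exact LocHolder.of_contDiffOn_one hα hs (by simpa using hf)
  | succ k ih =>
    exact ⟨hf.differentiableOn (by simp),
      ih (hf.fderiv_of_isOpen hs (by push_cast; exact le_rfl))⟩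

theorem HolderClass.continuousOn (hα : 0 < α) {f : E → F} (hf : HolderClass α k f s) :
    ContinuousOn f s := by
  cases k with
  | zero => exact fun x hx => (LocHolder.continuousAt hα hf hx).continuousWithinAt
  | succ k => exact hf.1.continuousOn

theorem HolderClass.contDiffOn_one (hα : 0 < α) {f : E → F} (hs : IsOpen s)
    (hf : HolderClass α (k + 1) f s) : ContDiffOn ℝ 1 f s := by
  rw [show (1 : WithTop ℕ∞) = 0 + 1 by norm_num, contDiffOn_succ_iff_fderiv_of_isOpen hs]
  exact ⟨hf.1, by simp, contDiffOn_zero.2 (hf.2.continuousOn hα)⟩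

theorem HolderClass.pred (hα : 0 < α) (hα1 : α ≤ 1) {f : E → F} (hs : IsOpen s)
    (hf : HolderClass α (k + 1) f s) : HolderClass α k f s := by
  induction k generalizing F with
  | zero => exact LocHolder.of_contDiffOn_one hα1 hs (hf.contDiffOn_one hα hs)
  | succ k ih => exact ⟨hf.1, ih hf.2⟩

theorem HolderClass.add {f g : E → F} (hs : IsOpen s) (hf : HolderClass α k f s)
    (hg : HolderClass α k g s) : HolderClass α k (fun x => f x + g x) s := by
  induction k generalizing F with
  | zero =>
    intro x hx
    obtain ⟨U, hU, hC⟩ := hf x hx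
    obtain ⟨V, hV, hD⟩ := hg x hx
    exact ⟨U ∩ V, inter_mem hU hV, exists_holderOnWith_add
      (hC.imp fun _ h => h.mono inter_subset_left) (hD.imp fun _ h => h.mono inter_subset_right)⟩
  | succ k ih =>
    refine ⟨hf.1.add hg.1, (ih hf.2 hg.2).congr hs fun x hx => ?_⟩
    exact fderiv_fun_add (hf.1.differentiableAt (hs.mem_nhds hx))
      (hg.1.differentiableAt (hs.mem_nhds hx))

theorem HolderClass.clm_comp (A : F →L[ℝ] G) {f : E → F} (hs : IsOpen s)
    (hf : HolderClass α k f s) : HolderClass α k (fun x => A (f x)) s := by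
  induction k generalizing F G with
  | zero =>
    intro x hx
    obtain ⟨U, hU, hC⟩ := hf x hx
    exact ⟨U, hU, exists_holderOnWith_clm_comp A hC⟩
  | succ k ih =>
    refine ⟨A.differentiable.comp_differentiableOn hf.1,
      (ih (ContinuousLinearMap.compL ℝ E F G A) hf.2).congr hs fun x hx => ?_⟩
    exact (A.hasFDerivAt.comp x (hf.1.differentiableAt (hs.mem_nhds hx)).hasFDerivAt).fderiv

/-- The derivative of a bilinear expression is a sum of two bilinear expressions in `f`, `g` and
their derivatives, with operator-valued targets; the induction therefore runs over all target spaces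
at once. -/
theorem HolderClass.bilinear (hα : 0 < α) (hα1 : α ≤ 1) (B : F →L[ℝ] G →L[ℝ] W) {f : E → F}
    {g : E → G} (hs : IsOpen s) (hf : HolderClass α k f s) (hg : HolderClass α k g s) :
    HolderClass α k (fun x => B (f x) (g x)) s := by
  induction k generalizing F G W with
  | zero =>
    intro x hx
    obtain ⟨U, hU, hC⟩ := hf x hx
    obtain ⟨V, hV, hD⟩ := hg x hx
    have b1 : ∀ᶠ y in 𝓝 x, ‖f y‖ < ‖f x‖ + 1 :=
      (LocHolder.continuousAt hα hf hx).norm.eventually_lt_const (lt_add_one _)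
    have b2 : ∀ᶠ y in 𝓝 x, ‖g y‖ < ‖g x‖ + 1 :=
      (LocHolder.continuousAt hα hg hx).norm.eventually_lt_const (lt_add_one _)
    refine ⟨(U ∩ V) ∩ {y | ‖f y‖ < ‖f x‖ + 1 ∧ ‖g y‖ < ‖g x‖ + 1},
      inter_mem (inter_mem hU hV) (b1.and b2), ?_⟩
    exact exists_holderOnWith_bilinear B (M := ‖f x‖ + 1) (N := ‖g x‖ + 1)
      (hC.imp fun _ h => h.mono fun y hy => hy.1.1) (hD.imp fun _ h => h.mono fun y hy => hy.1.2)
      (fun y hy => hy.2.1.le) fun y hy => hy.2.2.le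
  | succ k ih =>
    refine ⟨fun x hx => ((B.hasFDerivAt_of_bilinear
      (hf.1.differentiableAt (hs.mem_nhds hx)).hasFDerivAt
      (hg.1.differentiableAt
        (hs.mem_nhds hx)).hasFDerivAt).differentiableAt).differentiableWithinAt,
      ((ih (B.precompR E) (hf.pred hα hα1 hs) hg.2).add hs
        (ih (B.precompL E) hf.2 (hg.pred hα hα1 hs))).congr hs fun x hx => ?_⟩
    exact (B.hasFDerivAt_of_bilinear (hf.1.differentiableAt (hs.mem_nhds hx)).hasFDerivAt
      (hg.1.differentiableAt (hs.mem_nhds hx)).hasFDerivAt).fderiv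

theorem HolderClass.mul (hα : 0 < α) (hα1 : α ≤ 1) {f g : E → ℝ} (hs : IsOpen s)
    (hf : HolderClass α k f s) (hg : HolderClass α k g s) :
    HolderClass α k (fun x => f x * g x) s :=
  HolderClass.bilinear hα hα1 (ContinuousLinearMap.mul ℝ ℝ) hs hf hg

/-- The chain rule writes the derivative as a bilinear expression in `fderiv g ∘ f` and `fderiv f`.
The separate `C¹` hypothesis serves the base case, where an inner map that is only Hölder would
lower the exponent. -/
theorem HolderClass.comp (hα : 0 < α) (hα1 : α ≤ 1) {g : F → G} {f : E → F} (hs : IsOpen s)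
    (ht : IsOpen t) (hg : HolderClass α k g t) (hf : HolderClass α k f s)
    (hf1 : ContDiffOn ℝ 1 f s) (hst : MapsTo f s t) : HolderClass α k (fun x => g (f x)) s := by
  induction k generalizing G with
  | zero =>
    intro x hx
    obtain ⟨K, U, hU, hK⟩ := (hf1.contDiffAt (hs.mem_nhds hx)).exists_lipschitzOnWith
    obtain ⟨V, hV, C, hC⟩ := hg (f x) (hst hx)
    have hfc : ContinuousAt f x := hf1.continuousOn.continuousAt (hs.mem_nhds hx)
    refine ⟨U ∩ f ⁻¹' V, inter_mem hU (hfc hV),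
      exists_holderOnWith_of_dist (C := C * K ^ (α : ℝ)) fun y hy z hz => ?_⟩
    have h1 := holderOnWith_iff_dist.1 hC (f y) hy.2 (f z) hz.2
    have h2 := hK.dist_le_mul y hy.1 z hz.1
    refine h1.trans ?_
    rw [mul_assoc, ← mul_rpow K.coe_nonneg dist_nonneg]
    exact mul_le_mul_of_nonneg_left (rpow_le_rpow dist_nonneg h2 α.2) C.2
  | succ k ih =>
    have hd : ∀ x ∈ s, HasFDerivAt (fun x => g (f x))
        ((fderiv ℝ g (f x)).comp (fderiv ℝ f x)) x := fun x hx =>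
      (hg.1.differentiableAt (ht.mem_nhds (hst hx))).hasFDerivAt.comp x
        (hf.1.differentiableAt (hs.mem_nhds hx)).hasFDerivAt
    refine ⟨fun x hx => (hd x hx).differentiableAt.differentiableWithinAt,
      (HolderClass.bilinear hα hα1 (ContinuousLinearMap.compL ℝ E F G) hs
        (ih hg.2 (hf.pred hα hα1 hs)) hf.2).congr hs fun x hx => (hd x hx).fderiv⟩

/-- The recursive class differentiates the derivative, so the iterated derivative is unfolded from
the right; currying is an isometry and preserves Hölder constants. -/
theorem HolderClass.iff_iteratedFDeriv (hα : 0 < α) {f : E → F} (hs : IsOpen s) :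
    HolderClass α k f s ↔ ContDiffOn ℝ k f s ∧ LocHolder α (iteratedFDeriv ℝ k f) s := by
  induction k generalizing F with
  | zero =>
    have e : LocHolder α (iteratedFDeriv ℝ 0 f) s ↔ LocHolder α f s := by
      refine forall₂_congr fun x _ => ?_
      refine exists_congr fun U => and_congr_right fun _ => exists_congr fun C => ?_
      rw [iteratedFDeriv_zero_eq_comp]
      exact holderOnWith_isometry_comp_iff (LinearIsometryEquiv.isometry _)
    rw [e]
    refine ⟨fun h => ⟨?_, h⟩, fun h => h.2⟩
    exact contDiffOn_zero.2 (HolderClass.continuousOn (k := 0) hα h)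
  | succ k ih =>
    have e : LocHolder α (iteratedFDeriv ℝ (k + 1) f) s ↔
        LocHolder α (iteratedFDeriv ℝ k (fderiv ℝ f)) s := by
      refine forall₂_congr fun x _ => ?_
      refine exists_congr fun U => and_congr_right fun _ => exists_congr fun C => ?_
      rw [show iteratedFDeriv ℝ (k + 1) f = _ from
        funext fun x => iteratedFDeriv_succ_eq_comp_right]
      exact holderOnWith_isometry_comp_iff (LinearIsometryEquiv.isometry _)
    rw [e]
    push_cast
    rw [contDiffOn_succ_iff_fderiv_of_isOpen hs]
    change DifferentiableOn ℝ f s ∧ HolderClass α k (fderiv ℝ f) s ↔ _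
    rw [ih]
    constructor
    · rintro ⟨h1, h2, h3⟩
      exact ⟨⟨h1, by simp, h2⟩, h3⟩
    · rintro ⟨⟨h1, -, h2⟩, h3⟩
      exact ⟨h1, h2, h3⟩

end HolderClass

theorem isC3HolderLoc_iff {α : ℝ≥0} (hα : 0 < α) {H : Plane → ℝ} :
    IsC3HolderLoc α H ↔ HolderClass α 3 H {0}ᶜ := by
  have ho : IsOpen ({0}ᶜ : Set Plane) := isOpen_compl_singleton
  rw [HolderClass.iff_iteratedFDeriv hα ho, IsC3HolderLoc]
  refine and_congr (by norm_num) ⟨fun h x hx => ?_, fun h K hK hKs => ?_⟩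
  · obtain ⟨K, hK, hKs, hKc⟩ := local_compact_nhds (ho.mem_nhds hx)
    exact ⟨K, hK, h K hKc hKs⟩
  · exact h.exists_holderOnWith hα hK hKs
end

noncomputable section

open Filter Topology Real

/-! ### `C^{3,α}` regularity in the plane and in polar coordinates -/

theorem HolderClass.of_local {E F : Type} [NormedAddCommGroup E] [NormedSpace ℝ E]
    [NormedAddCommGroup F] [NormedSpace ℝ F] {α : ℝ≥0} {k : ℕ} {f : E → F} {s : Set E}
    (h : ∀ x ∈ s, ∃ U : Set E, IsOpen U ∧ x ∈ U ∧ HolderClass α k f U) : HolderClass α k f s := by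
  induction k generalizing F with
  | zero =>
    intro x hx
    obtain ⟨U, -, hxU, hU⟩ := h x hx
    exact hU x hxU
  | succ k ih =>
    refine ⟨fun x hx => ?_, ih fun x hx => ?_⟩
    · obtain ⟨U, hUo, hxU, hU⟩ := h x hx
      exact (hU.1.differentiableAt (hUo.mem_nhds hxU)).differentiableWithinAt
    · obtain ⟨U, hUo, hxU, hU⟩ := h x hx
      exact ⟨U, hUo, hxU, hU.2⟩

variable {α : ℝ≥0} {H : Plane → ℝ} {R L L' L'' : ℝ → ℝ}

theorem HolderClass.inv (hα : 0 < α) (hα1 : α ≤ 1) {E : Type} [NormedAddCommGroup E]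
    [NormedSpace ℝ E] {k : ℕ} {f : E → ℝ} {s : Set E} (hs : IsOpen s)
    (hf : HolderClass α (k + 1) f s) (h0 : ∀ x ∈ s, f x ≠ 0) :
    HolderClass α (k + 1) (fun x => (f x)⁻¹) s := by
  refine HolderClass.comp (g := fun y : ℝ => y⁻¹) (t := {0}ᶜ) hα hα1 hs isOpen_compl_singleton
    (HolderClass.of_contDiffOn hα1 isOpen_compl_singleton ?_) hf (hf.contDiffOn_one hα hs) h0
  exact fun y hy => (contDiffAt_inv ℝ hy).contDiffWithinAt

theorem IsRadial.holderClass_radius (hα : 0 < α) (hα1 : α ≤ 1) (hH : IsRadial H R)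
    (hR : ∀ θ, 0 < R θ) (h3 : HolderClass α 3 H {0}ᶜ) : HolderClass α 3 R univ := by
  have hcomp : HolderClass α 3 (fun θ => H (polar 1 θ)) univ :=
    HolderClass.comp hα hα1 isOpen_univ isOpen_compl_singleton h3
      (HolderClass.of_contDiffOn hα1 isOpen_univ (contDiff_polar 1).contDiffOn)
      (contDiff_polar 1).contDiffOn fun θ _ => polar_ne_zero one_pos θ
  have e : ∀ θ, H (polar 1 θ) = (R θ)⁻¹ := fun θ => by rw [hH _ _ zero_le_one, one_div]
  refine (hcomp.inv hα hα1 isOpen_univ fun θ _ => ?_).congr isOpen_univ fun θ _ => ?_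
  · rw [e]; exact (inv_pos.2 (hR θ)).ne'
  · rw [e, inv_inv]

/-- Around each ray `H` is the norm times `R⁻¹` of the local angle, both the norm and the angle
being smooth away from the origin. -/
theorem IsRadial.holderClass (hα : 0 < α) (hα1 : α ≤ 1) (hH : IsRadial H R)
    (hR : ∀ θ, 0 < R θ) (h3 : HolderClass α 3 R univ) : HolderClass α 3 H {0}ᶜ := by
  refine HolderClass.of_local fun x hx => ?_
  obtain ⟨θ₀, hθ₀⟩ := exists_eq_polar x
  have hopen := isOpen_halfPlane (polar 1 θ₀)
  refine ⟨{x | 0 < ⟪polar 1 θ₀, x⟫}, hopen, ?_, ?_⟩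
  · rw [mem_ofPred_eq]
    conv_rhs => rw [hθ₀]
    exact polar_mem_halfPlane (norm_pos_iff.2 hx) θ₀
  have hang : ∀ n : ℕ, ContDiffOn ℝ n (localAngle θ₀) {x | 0 < ⟪polar 1 θ₀, x⟫} := fun n y hy =>
    (contDiffAt_localAngle hy).contDiffWithinAt
  have hnorm : ContDiffOn ℝ 4 (fun x : Plane => ‖x‖) {x | 0 < ⟪polar 1 θ₀, x⟫} := fun y hy => by
    have hy0 : y ≠ 0 := by
      rintro rfl
      rw [mem_ofPred_eq, inner_zero_right] at hy
      exact lt_irrefl _ hy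
    exact (contDiffAt_norm ℝ hy0).contDiffWithinAt
  have hinv : HolderClass α 3 (fun θ => (R θ)⁻¹) univ :=
    h3.inv hα hα1 isOpen_univ fun θ _ => (hR θ).ne'
  have hc := HolderClass.comp hα hα1 hopen isOpen_univ hinv
    (HolderClass.of_contDiffOn hα1 hopen (hang _)) (by exact_mod_cast hang 1)
    fun _ _ => mem_univ _
  exact ((HolderClass.of_contDiffOn (k := 3) hα1 hopen hnorm).mul hα hα1 hopen hc).congr hopen
    fun y hy => hH.eq_on_halfPlane hy

theorem HolderClass.of_hasDerivAt {k : ℕ} {f f' : ℝ → ℝ} (hf : ∀ x, HasDerivAt f (f' x) x)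
    (hf' : HolderClass α k f' univ) : HolderClass α (k + 1) f univ := by
  refine ⟨fun x _ => (hf x).differentiableAt.differentiableWithinAt, ?_⟩
  refine (hf'.clm_comp (ContinuousLinearMap.toSpanSingletonCLE (𝕜 := ℝ) (E := ℝ) :
    ℝ →L[ℝ] ℝ →L[ℝ] ℝ) isOpen_univ).congr isOpen_univ fun x _ => ?_
  exact (hf x).hasFDerivAt.fderiv

/-- Bootstrap in `R' = R * L`: with `L` in `C^{2,α}`, each use of the equation raises the regularity
of `R` by one. -/
theorem IsProfile.holderClass_three (hα : 0 < α) (hα1 : α ≤ 1) (h : IsProfile R L)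
    (hL : ∀ θ, HasDerivAt L (L' θ) θ) (hL' : ∀ θ, HasDerivAt L' (L'' θ) θ)
    (hL'' : LocHolder α L'' univ) : HolderClass α 3 R univ := by
  have h2 : HolderClass α 2 L univ :=
    .of_hasDerivAt hL (.of_hasDerivAt hL' hL'')
  have h1 := h2.pred hα hα1 isOpen_univ
  have h0 := h1.pred hα hα1 isOpen_univ
  have r0 : HolderClass α 0 R univ :=
    .of_contDiffOn hα1 isOpen_univ (by exact_mod_cast h.contDiff.contDiffOn)
  have r1 : HolderClass α 1 R univ := .of_hasDerivAt h.hasDerivAt (r0.mul hα hα1 isOpen_univ h0)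
  have r2 : HolderClass α 2 R univ := .of_hasDerivAt h.hasDerivAt (r1.mul hα hα1 isOpen_univ h1)
  exact .of_hasDerivAt h.hasDerivAt (r2.mul hα hα1 isOpen_univ h2)

theorem HolderClass.contDiff_three (hα : 0 < α) (h : HolderClass α 3 R univ) : ContDiff ℝ 3 R :=
  contDiffOn_univ.1 ((HolderClass.iff_iteratedFDeriv hα isOpen_univ).1 h).1

theorem HolderClass.isC3HolderOnQuarter (hα : 0 < α) (h : HolderClass α 3 R univ) :
    IsC3HolderOnQuarter α R := by
  have h3 := h.contDiff_three hα
  refine ⟨h3.contDiffOn, ?_⟩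
  obtain ⟨C, hC⟩ := ((HolderClass.iff_iteratedFDeriv hα isOpen_univ).1 h).2.exists_holderOnWith hα
    isCompact_quarter (subset_univ _)
  refine ⟨C, ?_⟩
  have h1 : HolderOnWith C α (iteratedDeriv 3 R) quarter := by
    rw [iteratedDeriv_eq_equiv_comp]
    exact (holderOnWith_isometry_comp_iff (LinearIsometryEquiv.isometry _)).2 hC
  intro x hx y hy
  have e : ∀ z ∈ quarter, qDeriv 3 R z = iteratedDeriv 3 R z := fun z hz =>
    iteratedDerivWithin_eq_iteratedDeriv uniqueDiffOn_quarter h3.contDiffAt hz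
  rw [e x hx, e y hy]
  exact h1 x hx y hy

/-! ### `C^{3,α}` regularity of the reflection -/

theorem exists_holderOnWith_union_Icc {f : ℝ → ℝ} {a b c : ℝ} (hab : a ≤ b) (hbc : b ≤ c)
    (h1 : ∃ C : ℝ≥0, HolderOnWith C α f (Icc a b)) (h2 : ∃ C : ℝ≥0, HolderOnWith C α f (Icc b c)) :
    ∃ C : ℝ≥0, HolderOnWith C α f (Icc a c) := by
  obtain ⟨C, hC⟩ := h1
  obtain ⟨D, hD⟩ := h2
  rw [holderOnWith_iff_dist] at hC hD
  have hb1 : b ∈ Icc a b := right_mem_Icc.2 hab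
  have hb2 : b ∈ Icc b c := left_mem_Icc.2 hbc
  have key : ∀ x ∈ Icc a c, ∀ y ∈ Icc a c, x ≤ y →
      dist (f x) (f y) ≤ (C + D) * dist x y ^ (α : ℝ) := by
    intro x hx y hy hxy
    have hd : 0 ≤ dist x y ^ (α : ℝ) := by positivity
    have c0 := mul_nonneg C.coe_nonneg hd
    have d0 := mul_nonneg D.coe_nonneg hd
    rw [add_mul]
    rcases le_total y b with hyb | hyb
    · linarith [hC x ⟨hx.1, hxy.trans hyb⟩ y ⟨hy.1, hyb⟩]
    rcases le_total b x with hbx | hbx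
    · linarith [hD x ⟨hbx, hx.2⟩ y ⟨hyb, hy.2⟩]
    have e1 := hC x ⟨hx.1, hbx⟩ b hb1
    have e2 := hD b hb2 y ⟨hyb, hy.2⟩
    have m1 : dist x b ^ (α : ℝ) ≤ dist x y ^ (α : ℝ) := by
      refine rpow_le_rpow dist_nonneg ?_ α.coe_nonneg
      rw [Real.dist_eq, Real.dist_eq, abs_of_nonpos (by linarith), abs_of_nonpos (by linarith)]
      linarith
    have m2 : dist b y ^ (α : ℝ) ≤ dist x y ^ (α : ℝ) := by
      refine rpow_le_rpow dist_nonneg ?_ α.coe_nonneg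
      rw [Real.dist_eq, Real.dist_eq, abs_of_nonpos (by linarith), abs_of_nonpos (by linarith)]
      linarith
    have t1 := mul_le_mul_of_nonneg_left m1 C.coe_nonneg
    have t2 := mul_le_mul_of_nonneg_left m2 D.coe_nonneg
    linarith [dist_triangle (f x) (f b) (f y)]
  refine exists_holderOnWith_of_dist (C := C + D) fun x hx y hy => ?_
  rcases le_total x y with hxy | hxy
  · exact key x hx y hy hxy
  · rw [dist_comm (f x), dist_comm x]; exact key y hy x hx hxy

theorem locHolder_of_glue {f : ℝ → ℝ} (hf : Function.Periodic f π)
    (h1 : ∃ C : ℝ≥0, HolderOnWith C α f (Icc 0 (π / 2)))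
    (h2 : ∃ C : ℝ≥0, HolderOnWith C α f (Icc (π / 2) π)) : LocHolder α f univ := by
  intro θ _
  obtain ⟨a, b, ha, hb, hab⟩ := exists_Icc_of_glue
    (P := fun a b => ∃ C : ℝ≥0, HolderOnWith C α f (Icc a b))
    (fun a b c => exists_holderOnWith_union_Icc)
    (fun a b ⟨C, hC⟩ => ⟨C, fun x hx y hy => by
      have := hC (x - π) ⟨by linarith [hx.1], by linarith [hx.2]⟩ (y - π)
        ⟨by linarith [hy.1], by linarith [hy.2]⟩
      rwa [hf.sub_eq, hf.sub_eq, edist_sub_right] at this⟩)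
    (fun a b ⟨C, hC⟩ => ⟨C, fun x hx y hy => by
      have := hC (x + π) ⟨by linarith [hx.1], by linarith [hx.2]⟩ (y + π)
        ⟨by linarith [hy.1], by linarith [hy.2]⟩
      rwa [hf x, hf y, edist_add_right] at this⟩) h1 h2 θ
  exact ⟨Icc a b, Icc_mem_nhds ha hb, hab⟩

theorem exists_holderOnWith_of_contDiffOn (hα1 : α ≤ 1) {f : ℝ → ℝ}
    (hf : ContDiffOn ℝ 1 f quarter) : ∃ C : ℝ≥0, HolderOnWith C α f quarter := by
  obtain ⟨K, hK⟩ := hf.exists_lipschitzOnWith one_ne_zero (convex_Icc _ _) isCompact_quarter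
  exact exists_holderOnWith_of_lipschitzOnWith hα1 hK isCompact_quarter.isBounded

theorem exists_holderOnWith_mul (hα : 0 < α) {f g : ℝ → ℝ}
    (hf : ∃ C : ℝ≥0, HolderOnWith C α f quarter) (hg : ∃ C : ℝ≥0, HolderOnWith C α g quarter) :
    ∃ C : ℝ≥0, HolderOnWith C α (fun x => f x * g x) quarter := by
  obtain ⟨M, hM⟩ := isCompact_quarter.exists_bound_of_continuousOn (hf.choose_spec.continuousOn hα)
  obtain ⟨N, hN⟩ := isCompact_quarter.exists_bound_of_continuousOn (hg.choose_spec.continuousOn hα)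
  exact exists_holderOnWith_bilinear (ContinuousLinearMap.mul ℝ ℝ) hf hg hM hN

/-- The second derivative of `r' / r`. -/
def logDerDeriv₂ (r : ℝ → ℝ) (η : ℝ) : ℝ :=
  qDeriv 3 r η * (r η)⁻¹ + -(qDeriv 2 r η / r η * logDer r η + 2 * logDer r η * logDerDeriv r η)

/-- The second derivative of the logarithmic derivative of `rTilde r` at `tau r η`. -/
def reflectedDeriv₂ (r : ℝ → ℝ) (η : ℝ) : ℝ :=
  (logDerDeriv₂ r η + -(2 * logDer r η * logDerDeriv r η ^ 3 / (1 + logDer r η ^ 2) ^ 2)) *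
    -((tauDeriv r η ^ 3)⁻¹)

namespace IsAdmissible

variable {r : ℝ → ℝ}

theorem hasDerivWithinAt_logDerDeriv (h : IsAdmissible r) (h3 : ContDiffOn ℝ 3 r quarter) {η : ℝ}
    (hη : η ∈ quarter) : HasDerivWithinAt (logDerDeriv r) (logDerDeriv₂ r η) quarter η := by
  have d0 := ContDiffOn.hasDerivWithinAt_qDeriv (n := 3) (k := 0) h3 (by norm_num) hη
  have d1 := ContDiffOn.hasDerivWithinAt_qDeriv (n := 3) (k := 1) h3 (by norm_num) hη
  have d2 := ContDiffOn.hasDerivWithinAt_qDeriv (n := 3) (k := 2) h3 (by norm_num) hη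
  rw [qDeriv_zero] at d0
  have hr := h.pos η hη
  refine (((d2.fun_mul d0).fun_sub (d1.fun_mul d1)).fun_div (d0.fun_pow 2)
    (pow_pos hr 2).ne').congr_deriv ?_
  simp only [logDerDeriv₂, logDerDeriv, logDer]
  norm_num
  field_simp
  ring

theorem hasDerivWithinAt_tauDeriv (h : IsAdmissible r) (h3 : ContDiffOn ℝ 3 r quarter) {η : ℝ}
    (hη : η ∈ quarter) : HasDerivWithinAt (tauDeriv r)
      (-((logDerDeriv₂ r η * (1 + logDer r η ^ 2) - 2 * logDer r η * logDerDeriv r η ^ 2) /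
        (1 + logDer r η ^ 2) ^ 2)) quarter η := by
  refine (((h.hasDerivWithinAt_logDerDeriv h3 hη).fun_div
    (((h.hasDerivWithinAt_logDer hη).fun_pow 2).const_add 1)
    (by positivity)).const_sub 1).congr_deriv ?_
  norm_num
  ring

theorem hasDerivWithinAt_reflected (h : IsAdmissible r) (h3 : ContDiffOn ℝ 3 r quarter) {η : ℝ}
    (hη : η ∈ quarter) (hpos : 0 < tauDeriv r η) :
    HasDerivWithinAt (fun η => -(logDerDeriv r η / tauDeriv r η))
      (reflectedDeriv₂ r η * tauDeriv r η) quarter η := by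
  refine ((h.hasDerivWithinAt_logDerDeriv h3 hη).fun_div
    (h.hasDerivWithinAt_tauDeriv h3 hη) hpos.ne').neg.congr_deriv ?_
  have ht : tauDeriv r η * (1 + logDer r η ^ 2) = 1 + logDer r η ^ 2 - logDerDeriv r η := by
    rw [tauDeriv, sub_mul, div_mul_cancel₀ _ (by positivity)]; ring
  have hl : 0 < 1 + logDer r η ^ 2 := by positivity
  rw [reflectedDeriv₂]
  set t := tauDeriv r η
  set l := logDer r η
  set l₁ := logDerDeriv r η
  set l₂ := logDerDeriv₂ r η
  field_simp
  linear_combination (-l₂ * (1 + l ^ 2)) * ht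

theorem contDiffOn_logDer (h : IsAdmissible r) (h3 : ContDiffOn ℝ 3 r quarter) :
    ContDiffOn ℝ 1 (logDer r) quarter ∧ ContDiffOn ℝ 1 (logDerDeriv r) quarter ∧
      ContDiffOn ℝ 1 (tauDeriv r) quarter := by
  have c : ∀ k < 3, ContDiffOn ℝ 1 (qDeriv k r) quarter := fun k hk => by
    rw [show (1 : WithTop ℕ∞) = 0 + 1 by norm_num,
      contDiffOn_succ_iff_derivWithin uniqueDiffOn_quarter]
    refine ⟨fun η hη =>
      (ContDiffOn.hasDerivWithinAt_qDeriv (n := 3) h3 hk hη).differentiableWithinAt,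
      by simp, contDiffOn_zero.2 ?_⟩
    exact (ContDiffOn.continuousOn_qDeriv (n := 3) (k := k + 1) h3 hk).congr fun η hη =>
      (ContDiffOn.hasDerivWithinAt_qDeriv (n := 3) h3 hk hη).derivWithin (uniqueDiffOn_quarter η hη)
  have c0 := c 0 (by norm_num)
  rw [qDeriv_zero] at c0
  have l0 : ContDiffOn ℝ 1 (logDer r) quarter :=
    (c 1 (by norm_num)).div c0 fun η hη => (h.pos η hη).ne'
  have l1 : ContDiffOn ℝ 1 (logDerDeriv r) quarter :=
    (((c 2 (by norm_num)).mul c0).sub ((c 1 (by norm_num)).mul (c 1 (by norm_num)))).div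
      (c0.pow 2) fun η hη => (pow_pos (h.pos η hη) 2).ne'
  exact ⟨l0, l1, contDiffOn_const.sub (l1.div (contDiffOn_const.add (l0.pow 2))
    fun η _ => by positivity)⟩

/-- The third derivative of `r` is the only ingredient that is merely Hölder, and it enters
linearly; all the other factors are `C¹` on a compact interval. -/
theorem exists_holderOnWith_deriv₂ (hα : 0 < α) (hα1 : α ≤ 1) (h : IsAdmissible r)
    (hr : IsC3HolderOnQuarter α r) (hpos : ∀ η ∈ quarter, 0 < tauDeriv r η) :
    (∃ C : ℝ≥0, HolderOnWith C α (logDerDeriv₂ r) quarter) ∧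
      ∃ C : ℝ≥0, HolderOnWith C α (reflectedDeriv₂ r) quarter := by
  obtain ⟨h3, hC⟩ := hr
  obtain ⟨l0, l1, t1⟩ := h.contDiffOn_logDer h3
  have c0 : ContDiffOn ℝ 1 r quarter := h3.of_le (by norm_num)
  have c2 : ContDiffOn ℝ 1 (fun η => qDeriv 2 r η / r η) quarter := by
    refine (l1.add (l0.pow 2)).congr fun η hη => ?_
    have := (h.pos η hη).ne'
    simp only [logDerDeriv, logDer]
    field_simp
    ring
  have hl2 : ∃ C : ℝ≥0, HolderOnWith C α (logDerDeriv₂ r) quarter := by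
    refine exists_holderOnWith_add (exists_holderOnWith_mul hα hC
      (exists_holderOnWith_of_contDiffOn hα1 (c0.inv fun η hη => (h.pos η hη).ne')))
      (exists_holderOnWith_of_contDiffOn hα1 ?_)
    exact ((c2.mul l0).add ((contDiffOn_const.mul l0).mul l1)).neg
  refine ⟨hl2, exists_holderOnWith_mul hα (exists_holderOnWith_add hl2
    (exists_holderOnWith_of_contDiffOn hα1 ?_)) (exists_holderOnWith_of_contDiffOn hα1 ?_)⟩
  · exact (((contDiffOn_const.mul l0).mul (l1.pow 3)).div
      ((contDiffOn_const.add (l0.pow 2)).pow 2) fun η _ => by positivity).neg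
  · exact ((t1.pow 3).inv fun η hη => (pow_pos (hpos η hη) 3).ne').neg

/-- With `tauDeriv` positive at every point, compactness bounds the derivative `1 / tauDeriv` of the
inverse. The Lipschitz bound keeps the Hölder exponent under composition with it. -/
theorem lipschitzOnWith_inv_tau (h : IsAdmissible r) (hpos : ∀ η ∈ quarter, 0 < tauDeriv r η) :
    ∃ K : ℝ≥0, LipschitzOnWith K (Function.invFunOn (tau r) quarter) (Icc (π / 2) π) := by
  have hc : ContinuousOn (fun η => (tauDeriv r η)⁻¹) quarter :=
    h.continuousOn_tauDeriv.inv₀ fun η hη => (hpos η hη).ne'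
  obtain ⟨M, hM⟩ := isCompact_quarter.exists_bound_of_continuousOn hc
  refine ⟨M.toNNReal, (convex_Icc _ _).lipschitzOnWith_of_nnnorm_hasDerivWithin_le
    (f' := fun θ => (tauDeriv r (Function.invFunOn (tau r) quarter θ))⁻¹)
    (fun θ hθ => ?_) fun θ hθ => ?_⟩
  · rw [← h.image_tau] at hθ ⊢
    obtain ⟨η, hη, rfl⟩ := hθ
    rw [h.strictMonoOn_tau.injOn.leftInvOn_invFunOn hη]
    exact hasDerivWithinAt_of_comp (F := fun x => x) (m := fun η => (tauDeriv r η)⁻¹)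
      (fun x hx => (hasDerivAt_id' x).hasDerivWithinAt.congr_deriv
        (inv_mul_cancel₀ (hpos x hx).ne').symm)
      (fun x hx => h.hasDerivWithinAt_tau hx) (fun x hx => h.tauDeriv_nonneg hx)
      h.strictMonoOn_tau.injOn hc (fun x hx => h.strictMonoOn_tau.injOn.leftInvOn_invFunOn hx) hη
  · rw [← NNReal.coe_le_coe, coe_nnnorm]
    exact (hM _ (h.inv_tau_mem hθ)).trans (le_coe_toNNReal M)

theorem locHolder_reflExt (h : IsAdmissible r)
    (hpos : ∀ η ∈ quarter, 0 < tauDeriv r η) {A B : ℝ → ℝ} (h0 : A (π / 2) = B 0)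
    (h1 : A 0 = B (π / 2)) (hA : ∃ C : ℝ≥0, HolderOnWith C α A quarter)
    (hB : ∃ C : ℝ≥0, HolderOnWith C α B quarter) : LocHolder α (reflExt r A B) univ := by
  refine locHolder_of_glue (periodic_reflExt r A B) ?_ ?_
  · obtain ⟨C, hC⟩ := hA
    refine ⟨C, fun x hx y hy => ?_⟩
    rw [reflExt_of_mem r A B hx, reflExt_of_mem r A B hy]
    exact hC x hx y hy
  · obtain ⟨C, hC⟩ := hB
    obtain ⟨K, hK⟩ := h.lipschitzOnWith_inv_tau hpos
    have hcomp := hC.comp (holderOnWith_one.2 hK) fun θ hθ => h.inv_tau_mem hθ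
    rw [mul_one] at hcomp
    refine ⟨C * K ^ (α : ℝ), fun x hx y hy => ?_⟩
    rw [h.reflExt_eq_comp_inv h0 h1 hx, h.reflExt_eq_comp_inv h0 h1 hy]
    exact hcomp x hx y hy

/-- On the reflected arc the first two derivatives of the logarithmic derivative are `-L'/τ'` and
`reflectedDeriv₂`, evaluated at `τ⁻¹`. The matching conditions state that they agree with the first
arc at `π/2`; the agreement at `π` follows algebraically. -/
theorem holderClass_rTilde (hα : 0 < α) (hα1 : α ≤ 1) (h : IsAdmissible r)
    (hr : IsC3HolderOnQuarter α r) (hcurv : ∀ θ ∈ quarter, CurvatureIneq r θ)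
    (hM : MatchingConditions r) : HolderClass α 3 (rTilde r) univ := by
  have hpos : ∀ η ∈ quarter, 0 < tauDeriv r η := fun η hη =>
    tauDeriv_pos_iff.2 ((curvatureIneq_iff (h.pos η hη)).1 (hcurv η hη))
  have hstar := h.half_pi_pos
  have b0 := h.logDer_zero
  have bπ := h.logDer_half_pi
  obtain ⟨hM1, hM2⟩ := hM
  have l0 : logDerDeriv r 0 = qDeriv 2 r 0 := by
    simp [logDerDeriv, h.boundary.at_zero, h.boundary.deriv_zero]
  have lπ : logDerDeriv r (π / 2) = qDeriv 2 r (π / 2) / r (π / 2) := by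
    rw [logDerDeriv, h.boundary.deriv_half_pi]; field_simp; ring
  have t0 : tauDeriv r 0 = 1 - qDeriv 2 r 0 := by rw [tauDeriv, b0, l0]; norm_num
  have p0 := hpos 0 zero_mem_quarter
  rw [t0] at p0
  have lπ' : logDerDeriv r (π / 2) = -(qDeriv 2 r 0 / (1 - qDeriv 2 r 0)) := by
    rw [lπ, hM1]; field_simp
  have tπ : tauDeriv r (π / 2) = (1 - qDeriv 2 r 0)⁻¹ := by
    rw [tauDeriv, bπ, lπ']; field_simp; ring
  have k0 : logDerDeriv₂ r 0 = qDeriv 3 r 0 := by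
    simp [logDerDeriv₂, b0, h.boundary.at_zero]
  have kπ : logDerDeriv₂ r (π / 2) = -(qDeriv 3 r 0 / (1 - qDeriv 2 r 0) ^ 3) := by
    simp only [logDerDeriv₂, bπ, hM2]; field_simp; ring
  obtain ⟨hold1, hold2⟩ := h.exists_holderOnWith_deriv₂ hα hα1 hr hpos
  have m0 : logDerDeriv r (π / 2) = -(logDerDeriv r 0 / tauDeriv r 0) := by rw [lπ', l0, t0]
  have m1 : logDerDeriv r 0 = -(logDerDeriv r (π / 2) / tauDeriv r (π / 2)) := by
    rw [lπ', l0, tπ]; field_simp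
  have n0 : logDerDeriv₂ r (π / 2) = reflectedDeriv₂ r 0 := by
    rw [reflectedDeriv₂, kπ, k0, t0, b0]; field_simp; ring
  have n1 : logDerDeriv₂ r 0 = reflectedDeriv₂ r (π / 2) := by
    rw [reflectedDeriv₂, kπ, k0, tπ, bπ]; field_simp; ring
  have hL : ∀ θ, HasDerivAt (logDerTilde r)
      (reflExt r (logDerDeriv r) (fun η => -(logDerDeriv r η / tauDeriv r η)) θ) θ := by
    refine h.hasDerivAt_reflExt (by simp [b0, bπ]) (by simp [b0, bπ]) m0 m1
      (fun η hη => h.hasDerivWithinAt_logDer hη) (fun η hη => ?_) ?_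
    · refine (h.hasDerivWithinAt_logDer hη).neg.congr_deriv ?_
      rw [neg_mul, div_mul_cancel₀ _ (hpos η hη).ne']
    · exact (h.continuousOn_logDerDeriv.div h.continuousOn_tauDeriv
        fun η hη => (hpos η hη).ne').neg
  have hL' : ∀ θ, HasDerivAt
      (reflExt r (logDerDeriv r) (fun η => -(logDerDeriv r η / tauDeriv r η)))
      (reflExt r (logDerDeriv₂ r) (reflectedDeriv₂ r) θ) θ :=
    h.hasDerivAt_reflExt m0 m1 n0 n1 (fun η hη => h.hasDerivWithinAt_logDerDeriv hr.1 hη)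
      (fun η hη => h.hasDerivWithinAt_reflected hr.1 hη (hpos η hη))
      (hold2.choose_spec.continuousOn hα)
  exact h.isProfile.holderClass_three hα hα1 hL hL'
    (h.locHolder_reflExt hpos n0 n1 hold1 hold2)

end IsAdmissible
end

noncomputable section

open Filter Topology Real

variable {α : ℝ≥0} {H : Plane → ℝ} {R L : ℝ → ℝ}

/-! ### The correspondence between radius functions and anisotropies -/

theorem IsProfile.contDiff_logDeriv {n : ℕ} (h : IsProfile R L) (hR : ContDiff ℝ (n + 1 : ℕ) R) :
    ContDiff ℝ n L := by
  have e : L = fun θ => deriv R θ / R θ := funext fun θ => by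
    rw [(h.hasDerivAt θ).deriv, mul_div_cancel_left₀ _ (h.pos θ).ne']
  rw [e]
  have h1 : ContDiff ℝ n (deriv R) := by
    have : ContDiff ℝ ((n : WithTop ℕ∞) + 1) R := by exact_mod_cast hR
    exact (contDiff_succ_iff_deriv.1 this).2.2
  exact h1.div (hR.of_le (by exact_mod_cast Nat.le_succ n)) fun θ => (h.pos θ).ne'

/-- The angle is counted from a minimum of the radius: `L` vanishes there, and after scaling the
minimum to one the radius at a right angle is at least one. -/
theorem IsProfile.exists_normalization (h : IsProfile R L) :
    ∃ c a : ℝ, 0 < c ∧ L a = 0 ∧ c * R a = 1 ∧ 1 ≤ c * R (π / 2 + a) := by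
  obtain ⟨a, ha⟩ := h.exists_min
  have hpos := h.pos a
  refine ⟨(R a)⁻¹, a, inv_pos.2 hpos, h.logDeriv_eq_zero_of_min ha, inv_mul_cancel₀ hpos.ne', ?_⟩
  rw [← div_eq_inv_mul, one_le_div hpos]
  exact ha _

theorem IsRadial.exists_admissible (hH : IsRadial H R) (h : IsProfile R L) (hR : ContDiff ℝ 2 R)
    (hT : StrictMono (tangentAngle L)) (hS : SignCondition H) :
    ∃ c a : ℝ, 0 < c ∧ L a = 0 ∧ c * R a = 1 ∧
      (∀ θ, tangentAngle L (tangentAngle L θ) = θ + π) ∧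
      IsAdmissible (fun θ => c * R (θ + a)) ∧ BallIsReflectionOf H (fun θ => c * R (θ + a)) := by
  obtain ⟨c, a, hc, hLa, hca, hone⟩ := h.exists_normalization
  have hTT := (hH.signCondition_iff h hT).1 hS
  have hL1 : ContDiff ℝ 1 L := by
    exact_mod_cast h.contDiff_logDeriv (n := 1) (by exact_mod_cast hR)
  have hLd : ∀ θ, HasDerivAt L (deriv L θ) θ := fun θ =>
    (hL1.differentiable one_ne_zero θ).hasDerivAt
  have h' := h.rescale hc a
  have hL' : ∀ θ, HasDerivAt (fun θ => L (θ + a)) (deriv L (θ + a)) θ := fun θ =>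
    (hLd (θ + a)).comp_add_const θ a
  have hTT' := IsProfile.tangentAngle_tangentAngle_shift hTT a
  have hadm : IsAdmissible fun θ => c * R (θ + a) :=
    h'.isAdmissible (contDiff_const.mul (hR.comp (contDiff_id.add contDiff_const))) hL'
      (IsProfile.strictMono_shift hT a) hTT' (by simpa using hLa) (by simpa using hca) hone
  exact ⟨c, a, hc, hLa, hca, hTT, hadm,
    hH.ballIsReflectionOf h hc (h'.rTilde_eq hadm hTT' hL')⟩

/-! ### Conditions on the quarter depend only on the restriction to it -/

theorem qDeriv_congr {f g : ℝ → ℝ} (h : EqOn f g quarter) (k : ℕ) :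
    EqOn (qDeriv k f) (qDeriv k g) quarter := iteratedDerivWithin_congr h

theorem CurvatureIneq.congr {f g : ℝ → ℝ} (h : EqOn f g quarter) {θ : ℝ} (hθ : θ ∈ quarter)
    (hf : CurvatureIneq f θ) : CurvatureIneq g θ := by
  rw [CurvatureIneq] at hf ⊢
  rwa [← h hθ, ← qDeriv_congr h 1 hθ, ← qDeriv_congr h 2 hθ]

theorem MatchingConditions.congr {f g : ℝ → ℝ} (h : EqOn f g quarter)
    (hf : MatchingConditions f) : MatchingConditions g := by
  rw [MatchingConditions] at hf ⊢
  rwa [← h half_pi_mem_quarter, ← qDeriv_congr h 2 half_pi_mem_quarter,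
    ← qDeriv_congr h 2 zero_mem_quarter, ← qDeriv_congr h 3 half_pi_mem_quarter,
    ← qDeriv_congr h 3 zero_mem_quarter]

theorem IsC3HolderOnQuarter.congr {f g : ℝ → ℝ} (h : EqOn f g quarter)
    (hf : IsC3HolderOnQuarter α f) : IsC3HolderOnQuarter α g := by
  obtain ⟨h3, C, hC⟩ := hf
  refine ⟨h3.congr fun x hx => (h hx).symm, C, fun x hx y hy => ?_⟩
  rw [← qDeriv_congr h 3 hx, ← qDeriv_congr h 3 hy]
  exact hC x hx y hy

theorem isAdmissible_of_isC3HolderOnQuarter {r : ℝ → ℝ} (hpos : ∀ θ ∈ quarter, 0 < r θ)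
    (h3 : IsC3HolderOnQuarter α r) (hcurv : ∀ θ ∈ quarter, CurvatureIneq r θ)
    (hb : BoundaryConditions r) : IsAdmissible r where
  pos := hpos
  contDiffOn := h3.1.of_le (by norm_num)
  ineq := by
    filter_upwards [ae_restrict_mem measurableSet_Icc] with θ hθ
    exact hcurv θ hθ
  boundary := hb

/-- A `C³` profile with `T ∘ T = id + π`, after normalization. -/
theorem IsProfile.curvatureIneq_and_matchingConditions (h : IsProfile R L) (hR : ContDiff ℝ 3 R)
    (hT : StrictMono (tangentAngle L)) (hTT : ∀ θ, tangentAngle L (tangentAngle L θ) = θ + π)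
    (h0 : L 0 = 0) (hR0 : R 0 = 1) :
    (∀ θ ∈ quarter, CurvatureIneq R θ) ∧ MatchingConditions R := by
  have hL2 : ContDiff ℝ 2 L := by
    exact_mod_cast h.contDiff_logDeriv (n := 2) (by exact_mod_cast hR)
  have hLd : ∀ θ, HasDerivAt L (deriv L θ) θ := fun θ =>
    (hL2.differentiable two_ne_zero θ).hasDerivAt
  have hLd' : ∀ θ, HasDerivAt (deriv L) (deriv (deriv L) θ) θ := fun θ =>
    ((contDiff_succ_iff_deriv (n := 1).1 (by norm_num; exact hL2)).2.2.differentiable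
      one_ne_zero θ).hasDerivAt
  exact ⟨fun θ hθ => (h.curvatureIneq_iff hLd hθ).2 (logDeriv_deriv_lt hLd hT hTT θ),
    h.matchingConditions hLd hLd' hTT h0 hR0⟩

theorem IsRadial.uniformlyElliptic (hH : IsRadial H R) (h : IsProfile R L)
    (h2 : ContDiffOn ℝ 2 H {0}ᶜ) (hR : ContDiff ℝ 2 R) (hT : StrictMono (tangentAngle L))
    (hTT : ∀ θ, tangentAngle L (tangentAngle L θ) = θ + π) : UniformlyElliptic H := by
  have hL1 : ContDiff ℝ 1 L := by
    exact_mod_cast h.contDiff_logDeriv (n := 1) (by exact_mod_cast hR)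
  have hLd : ∀ θ, HasDerivAt L (deriv L θ) θ := fun θ =>
    (hL1.differentiable one_ne_zero θ).hasDerivAt
  exact (hH.uniformlyElliptic_iff h h2 hLd (hL1.continuous_deriv le_rfl)).2
    (IsProfile.logDeriv_deriv_lt hLd hT hTT)

theorem IsRadial.strictMono_of_uniformlyElliptic (hH : IsRadial H R) (h : IsProfile R L)
    (h2 : ContDiffOn ℝ 2 H {0}ᶜ) (hR : ContDiff ℝ 2 R) (hU : UniformlyElliptic H) :
    StrictMono (tangentAngle L) := by
  have hL1 : ContDiff ℝ 1 L := by
    exact_mod_cast h.contDiff_logDeriv (n := 1) (by exact_mod_cast hR)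
  have hLd : ∀ θ, HasDerivAt L (deriv L θ) θ := fun θ =>
    (hL1.differentiable one_ne_zero θ).hasDerivAt
  exact IsProfile.strictMono_of_deriv_lt hLd
    ((hH.uniformlyElliptic_iff h h2 hLd (hL1.continuous_deriv le_rfl)).1 hU)

theorem IsAdmissible.signCondition {r : ℝ → ℝ} (h : IsAdmissible r) : SignCondition (HTilde r) :=
  ((HTilde_isRadial h).signCondition_iff h.isProfile h.strictMono_tangentAngle).2
    h.tangentAngle_tangentAngle

theorem IsAnisotropy.exists_isAdmissible (hH : IsAnisotropy H) (heven : ∀ ξ, H (-ξ) = H ξ)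
    (h2 : ContDiffOn ℝ 2 H {0}ᶜ) (hK : HasStrictlyConvexBall H) (hS : SignCondition H) :
    ∃ r : ℝ → ℝ, IsAdmissible r ∧ BallIsReflectionOf H r := by
  have hp := hH.isProfile heven (h2.of_le (by norm_num))
  have hR := hH.contDiff_ballRadius h2
  have hL1 := hp.contDiff_logDeriv (n := 1) (by exact_mod_cast hR)
  rw [HasStrictlyConvexBall, hH.isRadial.closure_unitBall hp] at hK
  have hT := hH.isRadial.strictMono_of_strictConvex hp (hL1.differentiable (by norm_num)) hK
  obtain ⟨c, a, -, -, -, -, hadm, hb⟩ := hH.isRadial.exists_admissible hp hR hT hS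
  exact ⟨_, hadm, hb⟩

theorem IsAnisotropy.uniformlyElliptic_and_signCondition_iff (hα : 0 < α) (hα1 : α ≤ 1)
    (hH : IsAnisotropy H) (heven : ∀ ξ, H (-ξ) = H ξ) (h3 : IsC3HolderLoc α H) :
    (UniformlyElliptic H ∧ SignCondition H) ↔
      ∃ r : ℝ → ℝ, (∀ θ ∈ quarter, 0 < r θ) ∧ IsC3HolderOnQuarter α r ∧
        (∀ θ ∈ quarter, CurvatureIneq r θ) ∧ MatchingConditions r ∧ BoundaryConditions r ∧
        BallIsReflectionOf H r := by
  have h2 : ContDiffOn ℝ 2 H {0}ᶜ := h3.1.of_le (by norm_num)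
  have hp := hH.isProfile heven (h2.of_le (by norm_num))
  have hR3 := hH.contDiff_ballRadius h3.1
  have hR := hH.contDiff_ballRadius h2
  constructor
  · rintro ⟨hU, hS⟩
    have hT := hH.isRadial.strictMono_of_uniformlyElliptic hp h2 hR hU
    obtain ⟨c, a, hc, hLa, hca, hTT, hadm, hb⟩ := hH.isRadial.exists_admissible hp hR hT hS
    have hclass := hH.isRadial.holderClass_radius hα hα1 hH.ballRadius_pos
      ((isC3HolderLoc_iff hα).1 h3)
    have hshift : ContDiff ℝ 4 fun θ : ℝ => θ + a := by fun_prop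
    have hcomp : HolderClass α 3 (fun θ => ballRadius H (θ + a)) univ :=
      HolderClass.comp hα hα1 isOpen_univ isOpen_univ hclass
        (HolderClass.of_contDiffOn hα1 isOpen_univ hshift.contDiffOn)
        (hshift.of_le (by norm_num)).contDiffOn fun _ _ => mem_univ _
    have hmul : HolderClass α 3 (fun θ => c * ballRadius H (θ + a)) univ :=
      hcomp.clm_comp (ContinuousLinearMap.mul ℝ ℝ c) isOpen_univ
    obtain ⟨hcurv, hM⟩ := (hp.rescale hc a).curvatureIneq_and_matchingConditions
      (hmul.contDiff_three hα) (IsProfile.strictMono_shift hT a)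
      (IsProfile.tangentAngle_tangentAngle_shift hTT a) (by simpa using hLa) (by simpa using hca)
    exact ⟨_, hadm.pos, hmul.isC3HolderOnQuarter hα, hcurv, hM, hadm.boundary, hb⟩
  · rintro ⟨r, hpos, hr3, hcurv, -, hbd, hb⟩
    have hadm := isAdmissible_of_isC3HolderOnQuarter hpos hr3 hcurv hbd
    -- The radius of `H` is a shifted multiple of the reflection, so its tangent angle inherits
    -- monotonicity and `T ∘ T = id + π`, from which both conclusions follow.
    obtain ⟨c, φ, hc, hRr⟩ := hH.isRadial.exists_rescale_of_ballIsReflectionOf hp hadm hb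
    have hp' := hadm.isProfile.rescale hc φ
    rw [← hRr] at hp'
    have hT := IsProfile.strictMono_shift hadm.strictMono_tangentAngle φ
    have hTT := IsProfile.tangentAngle_tangentAngle_shift hadm.tangentAngle_tangentAngle φ
    exact ⟨hH.isRadial.uniformlyElliptic hp' h2 hR hT hTT,
      (hH.isRadial.signCondition_iff hp' hT).2 hTT⟩

theorem IsAdmissible.isC3HolderLoc_HTilde_iff (hα : 0 < α) (hα1 : α ≤ 1) {r : ℝ → ℝ}
    (h : IsAdmissible r) :
    (IsC3HolderLoc α (HTilde r) ∧ UniformlyElliptic (HTilde r) ∧ SignCondition (HTilde r)) ↔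
      (IsC3HolderOnQuarter α r ∧ (∀ θ ∈ quarter, CurvatureIneq r θ) ∧ MatchingConditions r) := by
  have hH := HTilde_isRadial h
  have hp := h.isProfile
  have heq : EqOn (rTilde r) r quarter := fun θ hθ => rTilde_of_mem hθ
  constructor
  · rintro ⟨h3, -, -⟩
    have hclass := hH.holderClass_radius hα hα1 hp.pos ((isC3HolderLoc_iff hα).1 h3)
    obtain ⟨hcurv, hM⟩ := hp.curvatureIneq_and_matchingConditions (hclass.contDiff_three hα)
      h.strictMono_tangentAngle h.tangentAngle_tangentAngle
      (by rw [logDerTilde_of_mem zero_mem_quarter, h.logDer_zero])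
      (by rw [rTilde_of_mem zero_mem_quarter, h.boundary.at_zero])
    exact ⟨(hclass.isC3HolderOnQuarter hα).congr heq,
      fun θ hθ => (hcurv θ hθ).congr heq hθ, hM.congr heq⟩
  · rintro ⟨hr3, hcurv, hM⟩
    have hclass := h.holderClass_rTilde hα hα1 hr3 hcurv hM
    have h3 := (isC3HolderLoc_iff hα).2 (hH.holderClass hα hα1 hp.pos hclass)
    exact ⟨h3, hH.uniformlyElliptic hp (h3.1.of_le (by norm_num))
      ((hclass.contDiff_three hα).of_le (by norm_num)) h.strictMono_tangentAngle
      h.tangentAngle_tangentAngle, h.signCondition⟩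
end

/-! ### The proposition -/

theorem proposition1p3 :
    -- from a radius function to an anisotropy
    (∀ r : ℝ → ℝ, IsAdmissible r →
      -- the reflection and its gauge are well defined
      BijOn (tau r) quarter (Icc (Real.pi / 2) Real.pi) ∧
      Function.Periodic (rTilde r) Real.pi ∧
      (∀ θ, 0 < rTilde r θ) ∧
      (∀ θ ∈ quarter, rTilde r θ = r θ) ∧
      (∀ η ∈ quarter, rTilde r (tau r η) = reflectedRadius r η) ∧
      (∀ ρ θ : ℝ, 0 ≤ ρ → θ ∈ Icc 0 (2 * Real.pi) →
        HTilde r (polar ρ θ) = ρ / rTilde r θ) ∧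
      -- regularity, strict convexity and the sign condition
      ContDiff ℝ 1 (rTilde r) ∧
      StrictConvex ℝ (polarSet (rTilde r)) ∧
      SignCondition (HTilde r)) ∧
    -- every even `C²` anisotropy with the sign condition arises in this way
    (∀ H : Plane → ℝ, IsAnisotropy H → (∀ ξ, H (-ξ) = H ξ) → ContDiffOn ℝ 2 H {0}ᶜ →
      HasStrictlyConvexBall H → SignCondition H →
      ∃ r : ℝ → ℝ, IsAdmissible r ∧ BallIsReflectionOf H r) ∧
    -- the `C^{3,α}` characterization, starting from `H`
    (∀ α : ℝ≥0, 0 < α → α ≤ 1 →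
      ∀ H : Plane → ℝ, IsAnisotropy H → (∀ ξ, H (-ξ) = H ξ) → IsC3HolderLoc α H →
      ((UniformlyElliptic H ∧ SignCondition H) ↔
        ∃ r : ℝ → ℝ, (∀ θ ∈ quarter, 0 < r θ) ∧ IsC3HolderOnQuarter α r ∧
          (∀ θ ∈ quarter, CurvatureIneq r θ) ∧ MatchingConditions r ∧ BoundaryConditions r ∧
          BallIsReflectionOf H r)) ∧
    -- the `C^{3,α}` characterization, starting from `r`
    (∀ α : ℝ≥0, 0 < α → α ≤ 1 →
      ∀ r : ℝ → ℝ, IsAdmissible r →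
      ((IsC3HolderLoc α (HTilde r) ∧ UniformlyElliptic (HTilde r) ∧ SignCondition (HTilde r)) ↔
        (IsC3HolderOnQuarter α r ∧ (∀ θ ∈ quarter, CurvatureIneq r θ) ∧
          MatchingConditions r))) := by
  refine ⟨fun r hr => ⟨hr.bijOn_tau, hr.isProfile.periodic, hr.rTilde_pos,
    fun θ hθ => rTilde_of_mem hθ, fun η hη => hr.rTilde_tau hη,
    fun ρ θ hρ _ => HTilde_isRadial hr ρ θ hρ, hr.isProfile.contDiff,
    (HTilde_isRadial hr).strictConvex hr.isProfile hr.strictMono_tangentAngle,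
    hr.signCondition⟩, ?_, ?_, ?_⟩
  · intro H hH heven h2 hK hS
    exact hH.exists_isAdmissible heven h2 hK hS
  · intro α hα hα1 H hH heven h3
    exact hH.uniformlyElliptic_and_signCondition_iff hα hα1 heven h3
  · intro α hα hα1 r hr
    exact hr.isC3HolderLoc_HTilde_iff hα hα1
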